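/- Let $d\ge 1$, write $x=(x_1,\bar x)\in\mathbb R\times\mathbb R^{d-1}$, and let $\alpha>\frac4d$, with in addition $\alpha<\frac4{d-2}$ if $d\ge3$. Put $r=\alpha+2$, $p=\frac{2\alpha(\alpha+2)}{4-(d-2)\alpha}$, and $2^*=\frac{2d}{d-2}$ if $d\ge3$, $2^*=\infty$ if $d\le 2$. Let $V\in L^\infty(\mathbb R^d;\mathbb R)$ satisfy $V\ge0$ and: (i) $V(x_1,\bar x)\to0$ as $x_1\to-\infty$ and $V(x_1,\bar x)\to1$ as $x_1\to+\infty$, uniformly in $\bar x\in\mathbb R^{d-1}$; (ii) there are linearly independent $P_2,\dots,P_d\in\mathbb R^{d-1}$ with $V(x_1,\bar x+k_2P_2+\dots+k_dP_d)=V(x_1,\bar x)$ for all $x_1,\bar x$ and all $(k_2,\dots,k_d)\in\mathbb Z^{d-1}$; (iii) $|\nabla V(x_1,\bar x)|\to0$ as $|x_1|\to\infty$, uniformly in $\bar x$; (iv) there is $C$ with $\|e^{it(\Delta-V)}f\|_{L^\infty}\le C|t|^{-d/2}\|f\|_{L^1}$ for all $t\ne0$ and all $f\in L^1\cap L^2$,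 where $e^{it(\Delta-V)}f$ denotes the solution in $C(\mathbb R;L^2)$ of $i\partial_tu+\Delta u-Vu=0$, $u(0)=f$. (Statements about $V$ are understood almost everywhere and $\nabla V$ is the distributional gradient.) Let $\tau_zf(x)=f(x-z)$, $\|v\|_{\mathcal H}^2=\int(|\nabla v|^2+V|v|^2)\,dx$ and $E(v)=\frac12\int\big(|\nabla v|^2+V|v|^2+\frac2{\alpha+2}|v|^{\alpha+2}\big)dx$. Let $(v_n)_{n\in\mathbb N}$ be a bounded sequence in $H^1(\mathbb R^d)$. Then, after passing to a subsequence of $(v_n)$ (still denoted $(v_n)$), there exist for every $j\ge1$ a function $\psi^j\in H^1$ and sequences $(t_n^j)_n\subset\mathbb R$, $(x_n^j)_n\subset\mathbb R^d$, none of them depending on $J$, such that the functions $R_n^J$ defined for $J\in\mathbb N$ by $$v_n=\sum_{1\le j\le J}e^{it_n^j(\Delta-V)}\tau_{x_n^j}\psi^j+R_n^J$$ belong to $H^1$ and the following hold. 1. For every $j$: either $t_n^j=0$ for all $n$, or $t_n^j\to+\infty$, or $t_n^j\to-\infty$ as $n\to\infty$. 2. For every $j$, with $x_n^j=(x_{n,1}^j,\bar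 x_n^j)$: either $x_n^j=0$ for all $n$; or $|x_{n,1}^j|\to\infty$; or $x_{n,1}^j=0$ and $\bar x_n^j=\sum_{l=2}^dk_{n,l}^jP_l$ for all $n$, with $k_{n,l}^j\in\mathbb Z$ and $\sum_{l=2}^d|k_{n,l}^j|\to\infty$. 3. For all $j\ne k$: $|x_n^j-x_n^k|+|t_n^j-t_n^k|\to\infty$ as $n\to\infty$. 4. For every $\varepsilon>0$ there is $J=J(\varepsilon)$ with $\limsup_{n\to\infty}\|e^{it(\Delta-V)}R_n^J\|_{L^p_t(\mathbb R;L^r_x(\mathbb R^d))}\le\varepsilon$. 5. For every $J\in\mathbb N$, as $n\to\infty$, $$\|v_n\|_{L^2}^2=\sum_{1\le j\le J}\|\psi^j\|_{L^2}^2+\|R_n^J\|_{L^2}^2+o(1),\qquad \|v_n\|_{\mathcal H}^2=\sum_{1\le j\le J}\|\tau_{x_n^j}\psi^j\|_{\mathcal H}^2+\|R_n^J\|_{\mathcal H}^2+o(1).$$ 6. For every $J\in\mathbb N$ and every $2<q<2^*$, as $n\to\infty$, $$\|v_n\|_{L^q}^q=\sum_{1\le j\le J}\|e^{it_n^j(\Delta-V)}\tau_{x_n^j}\psi^j\|_{L^q}^q+\|R_n^J\|_{L^q}^q+o(1).$$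 7. For every $J\in\mathbb N$, as $n\to\infty$, $$E(v_n)=\sum_{1\le j\le J}E\big(e^{it_n^j(\Delta-V)}\tau_{x_n^j}\psi^j\big)+E(R_n^J)+o(1).$$ -/

import Mathlib

open MeasureTheory Filter Topology
open scoped ENNReal SchwartzMap FourierTransform LineDeriv ContDiff

noncomputable section

/-- `ℝ^d` with `d = m + 1`; a point is `x = (x₁, x̄)` with `x₁ = x 0` and `x̄ ∈ ℝ^m`. -/
abbrev Sp (m : ℕ) : Type := EuclideanSpace ℝ (Fin (m + 1))

/-- Complex `L²(ℝ^d)`. -/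
abbrev L2 (m : ℕ) : Type := Lp ℂ 2 (volume : Measure (Sp m))

/-- Real potentials in `L^∞(ℝ^d)`. -/
abbrev LInf (m : ℕ) : Type := Lp ℝ ∞ (volume : Measure (Sp m))

/-- The point `(a, y) ∈ ℝ × ℝ^{d-1}`. -/
def splitPoint {m : ℕ} (a : ℝ) (y : EuclideanSpace ℝ (Fin m)) : Sp m :=
  WithLp.toLp 2 (Fin.cons a (fun i => y i))

/-- The translation `τ_z f (x) = f (x - z)` on `L²`. -/
def translateL2 {m : ℕ} (z : Sp m) (f : L2 m) : L2 m :=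
  Lp.compMeasurePreserving (fun x : Sp m => x - z) (measurePreserving_sub_right volume z) f

/-! ### The linear propagator -/

theorem memLp_freeSymbol (m : ℕ) (t : ℝ) :
    MemLp (fun ξ : Sp m => Complex.exp (((-(4 * Real.pi ^ 2 * t * ‖ξ‖ ^ 2) : ℝ) : ℂ) * Complex.I))
      ∞ (volume : Measure (Sp m)) := by
  refine memLp_top_of_bound (Continuous.aestronglyMeasurable (by fun_prop)) 1 ?_
  exact Eventually.of_forall fun ξ => (Complex.norm_exp_ofReal_mul_I _).le

/-- The symbol `e^{-4π² i t |ξ|²}` of `e^{itΔ}` (with `𝓕 f (ξ) = ∫ e^{-2πi x·ξ} f (x) dx`). -/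
def freeSymbol (m : ℕ) (t : ℝ) : Lp ℂ ∞ (volume : Measure (Sp m)) :=
  (memLp_freeSymbol m t).toLp _

/-- The free propagator `e^{itΔ}` on `L²`, as a Fourier multiplier. -/
def freeFlow {m : ℕ} (t : ℝ) (f : L2 m) : L2 m :=
  𝓕⁻ (freeSymbol m t • 𝓕 f : L2 m)

/-- `u ∈ C(ℝ; L²)` solves `i ∂ₜ u + Δ u - V u = 0`, `u(0) = f`, in the sense of Duhamel's formula
`u(t) = e^{itΔ} f - i ∫₀ᵗ e^{i(t-s)Δ} (V u(s)) ds`. -/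
def IsLinearSolution {m : ℕ} (V : LInf m) (f : L2 m) (u : ℝ → L2 m) : Prop :=
  Continuous u ∧
    ∀ t : ℝ, u t = freeFlow t f - Complex.I • ∫ s in (0 : ℝ)..t, freeFlow (t - s) (V • u s : L2 m)

open Classical in
/-- The propagator `e^{it(Δ-V)}`: it maps `f ∈ L²` to the value at time `t` of the solution of
`i ∂ₜ u + Δ u - V u = 0`, `u(0) = f`, in `C(ℝ; L²)`, which exists and is unique as `V` is bounded. -/
def flow {m : ℕ} (V : LInf m) (t : ℝ) (f : L2 m) : L2 m :=
  if h : ∃ u : ℝ → L2 m, IsLinearSolution V f u then h.choose t else 0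

/-! ### Sobolev space and functionals -/

/-- Membership in `H¹(ℝ^d)`. -/
def MemH1 {m : ℕ} (f : L2 m) : Prop :=
  TemperedDistribution.MemSobolev 1 2 (f : 𝓢'(Sp m, ℂ))

open Classical in
/-- The distributional derivative `∂ᵢ f` as an element of `L²` (zero if it is not in `L²`). -/
def weakPartial {m : ℕ} (i : Fin (m + 1)) (f : L2 m) : L2 m :=
  if h : ∃ g : L2 m, ∂_{(EuclideanSpace.single i (1 : ℝ) : Sp m)} (f : 𝓢'(Sp m, ℂ)) =
      (g : 𝓢'(Sp m, ℂ)) then h.choose else 0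

/-- `‖∇f‖²_{L²}` for `f ∈ H¹`. -/
def gradNormSq {m : ℕ} (f : L2 m) : ℝ := ∑ i, ‖weakPartial i f‖ ^ 2

/-- `‖f‖²_{H¹} = ‖f‖²_{L²} + ‖∇f‖²_{L²}` for `f ∈ H¹`. -/
def h1NormSq {m : ℕ} (f : L2 m) : ℝ := ‖f‖ ^ 2 + gradNormSq f

/-- The energy norm `‖f‖²_𝓗 = ∫ (|∇f|² + V |f|²) dx` for `f ∈ H¹`. -/
def energyNormSq {m : ℕ} (V : LInf m) (f : L2 m) : ℝ :=
  gradNormSq f + ∫ x, V x * ‖f x‖ ^ 2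

/-- `‖f‖_{L^q}^q`. -/
def lqNormPow {m : ℕ} (q : ℝ) (f : L2 m) : ℝ :=
  (eLpNorm f (ENNReal.ofReal q) volume).toReal ^ q

/-- `E(f) = ½ ∫ (|∇f|² + V |f|² + 2/(α+2) |f|^{α+2}) dx` for `f ∈ H¹`. -/
def energy {m : ℕ} (V : LInf m) (α : ℝ) (f : L2 m) : ℝ :=
  1 / 2 * (energyNormSq V f + 2 / (α + 2) * lqNormPow (α + 2) f)

/-- The norm of `L^p_t(ℝ; L^r_x(ℝ^d))`. -/
def mixedNorm {m : ℕ} (p r : ℝ) (u : ℝ → L2 m) : ℝ≥0∞ :=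
  (∫⁻ t, eLpNorm (u t) (ENNReal.ofReal r) volume ^ p) ^ (1 / p)

/-! ### Assumptions on the potential -/

/-- `V → 0` as `x₁ → -∞` and `V → 1` as `x₁ → +∞`, uniformly in `x̄`. -/
def IsSteplike {m : ℕ} (V : LInf m) : Prop :=
  ∀ ε > 0, ∃ R : ℝ, ∀ᵐ x : Sp m, (x 0 ≤ -R → |V x| ≤ ε) ∧ (R ≤ x 0 → |V x - 1| ≤ ε)

/-- `V(x₁, x̄) = V(x₁, x̄ + k₂ P₂ + ⋯ + k_d P_d)` for all integers `k₂, …, k_d`. -/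
def IsPeriodicPotential {m : ℕ} (P : Fin m → EuclideanSpace ℝ (Fin m)) (V : LInf m) : Prop :=
  ∀ k : Fin m → ℤ, ∀ᵐ x : Sp m, V (x + splitPoint 0 (∑ l, k l • P l)) = V x

/-- `|∇V| → 0` as `|x₁| → ∞`, uniformly in `x̄`: on some region `|x₁| > R₀` the distributional
gradient of `V` is a locally integrable field `G`, and `G → 0` uniformly as `|x₁| → ∞`. -/
def GradientVanishes {m : ℕ} (V : LInf m) : Prop :=
  ∃ (R₀ : ℝ) (G : Sp m → Sp m),
    LocallyIntegrableOn G {x : Sp m | R₀ < |x 0|} ∧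
    (∀ φ : Sp m → ℝ, ContDiff ℝ ∞ φ → HasCompactSupport φ →
      tsupport φ ⊆ {x : Sp m | R₀ < |x 0|} →
      ∀ w : Sp m, ∫ x, V x * fderiv ℝ φ x w = -∫ x, inner ℝ (G x) w * φ x) ∧
    ∀ ε > 0, ∃ R : ℝ, ∀ᵐ x : Sp m, R ≤ |x 0| → ‖G x‖ ≤ ε

/-- `‖e^{it(Δ-V)} f‖_{L^∞} ≤ C |t|^{-d/2} ‖f‖_{L¹}` for all `t ≠ 0`; the propagator being defined on
`L²`, the bound is required for `f ∈ L¹ ∩ L²`. -/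
def DispersiveEstimate {m : ℕ} (V : LInf m) : Prop :=
  ∃ C : ℝ, ∀ t : ℝ, t ≠ 0 → ∀ f : L2 m, MemLp f 1 volume →
    eLpNorm (flow V t f) ∞ volume ≤
      ENNReal.ofReal (C * |t| ^ (-((m + 1 : ℕ) : ℝ) / 2)) * eLpNorm f 1 volume

end

/-! ### Limits along ultrafilters -/

section UltrafilterLimits

variable {ι : Type*} (𝒰 : Ultrafilter ι)

/-! The proof is a concentration-compactness argument run in `L²`. A frame is a time and a position;
`pushE` places a profile in a frame and `pullE` undoes this, both unitarily. The profiles of a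
bounded sequence are the weak limits of `pullE V (t n) (x n) (u n)` over all choices of frames. Each
round subtracts a profile whose norm is at least half the supremum over all frames
(`exists_profile`, `ExtractionState.exists_next`).

The potential is not translation invariant, so frames have to be compared with care. By
`pullE_pushE_eq`, passing from one frame to another is a translation composed with the propagator of
the shifted potential `V(· + y n)`. After a displacement that converges, `y n` is `0`, a lattice
point, or has first coordinate tending to `±∞`. The shifted potential then converges strongly to
`V`, `1` or `0` (`IsSpaceParam.exists_potTendsto`), and the propagators follow (`tendsto_flowE`).
Hence frames at bounded distance see the same profile up to a unitary map
(`WeakTendsto.change_frame`). Frames that separate do not see each other's profiles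
(`weakTendsto_pullE_pushE`), by dispersion if the times separate and by translation if the positions
do. A new nonzero profile is therefore automatically orthogonal to the old ones.

Every expansion reduces to splitting off one profile from a remainder whose pull-back is weakly
null, followed by telescoping (`tendsto_sub_sum_of_step`). For the quadratic functionals the cross
terms vanish because the flow preserves the `L²` norm and the energy norm. For `L^q`, a profile with
time `0` is handled by a Brezis–Lieb splitting and a profile with `|t n| → ∞` tends to zero by
dispersion (`tendsto_lqNormPow_step`).

For the remainders, `V ≥ 0` and the expansions bound `∑ ‖ψ j‖²` and give an `H¹` bound that does not
depend on `J`. So `‖ψ J‖ → 0`, and by near-maximality all weak limits of the `J`-th remainder are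
small. All its low-frequency averages are then small, uniformly in time and position
(`eventually_inner_flowE_le_of_maximal`), and subcriticality turns this into a small `L^r` norm
uniform in time (`exists_setLIntegral_rpow_le`). Finally `α > 4/d` says that `p` exceeds the
Strichartz exponent `2 / decayExp m r`. A weak-type `TT*` bound in time, interpolated with the
uniform bound, controls the mixed norm (`DispersiveEstimate.exists_mixedNorm_le`).

Limits are taken along a nonprincipal ultrafilter, where bounded quantities converge without passing
to subsequences. Only countably many properties have to survive, so an honest subsequence can be
chosen at the end (`Selects.exists_strictMono`). -/

theorem Ultrafilter.exists_tendsto_of_norm_le {E : Type*} [NormedAddCommGroup E] [ProperSpace E]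
    {f : ι → E} {C : ℝ} (h : ∀ᶠ n in (𝒰 : Filter ι), ‖f n‖ ≤ C) :
    ∃ a, Tendsto f 𝒰 (𝓝 a) := by
  have hK := isCompact_closedBall (0 : E) C
  obtain ⟨a, -, ha⟩ := hK.ultrafilter_le_nhds' (𝒰.map f)
    (by
      rw [Ultrafilter.mem_map]
      filter_upwards [h] with n hn
      simpa using hn)
  exact ⟨a, ha⟩

/-- For each `C` the ultrafilter decides between `f ≤ C` and `f > C`. This dichotomy replaces the
passage to subsequences in all later case distinctions. -/
theorem Ultrafilter.tendsto_atTop_or_le (f : ι → ℝ) :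
    Tendsto f 𝒰 atTop ∨ ∃ C, ∀ᶠ n in (𝒰 : Filter ι), f n ≤ C := by
  by_cases h : ∃ C, ∀ᶠ n in (𝒰 : Filter ι), f n ≤ C
  · exact Or.inr h
  · refine Or.inl (tendsto_atTop.2 fun C => ?_)
    push Not at h
    exact (h C).mono fun _ hn => hn.le

end UltrafilterLimits

/-! ### Weak convergence in Hilbert spaces -/

section Weak

variable {ι : Type*} {H : Type*} [NormedAddCommGroup H] [InnerProductSpace ℂ H]

/-- Weak convergence in a Hilbert space along a filter. -/
def WeakTendsto (u : ι → H) (l : Filter ι) (ψ : H) : Prop :=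
  ∀ g : H, Tendsto (fun n => inner ℂ g (u n)) l (𝓝 (inner ℂ g ψ))

/-- Along an ultrafilter the pairings with all test vectors converge at once, so neither
separability nor a diagonal argument is needed. The limits form a bounded functional, which Riesz
represents. -/
theorem exists_weakTendsto [CompleteSpace H] (𝒰 : Ultrafilter ι) {u : ι → H} {C : ℝ}
    (hu : ∀ n, ‖u n‖ ≤ C) : ∃ ψ, WeakTendsto u 𝒰 ψ := by
  have hex : ∀ g : H, ∃ a : ℂ, Tendsto (fun n => inner ℂ (u n) g) 𝒰 (𝓝 a) := fun g =>
    𝒰.exists_tendsto_of_norm_le (C := C * ‖g‖) (Eventually.of_forall fun n =>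
      (norm_inner_le_norm _ _).trans (by gcongr; exact hu n))
  choose L hL using hex
  let Λ : H →ₗ[ℂ] ℂ :=
    { toFun := L
      map_add' := fun f g => tendsto_nhds_unique (hL (f + g))
        (by simpa only [inner_add_right] using (hL f).add (hL g))
      map_smul' := fun c f => tendsto_nhds_unique (hL (c • f))
        (by simpa only [inner_smul_right, smul_eq_mul, RingHom.id_apply] using
          (hL f).const_mul c) }
  let Λ' : H →L[ℂ] ℂ := Λ.mkContinuous C fun g =>
    le_of_tendsto (hL g).norm (Eventually.of_forall fun n =>
      (norm_inner_le_norm _ _).trans (by gcongr; exact hu n))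
  refine ⟨(InnerProductSpace.toDual ℂ H).symm Λ', fun g => ?_⟩
  have h1 : inner ℂ g ((InnerProductSpace.toDual ℂ H).symm Λ') = (starRingEnd ℂ) (L g) := by
    rw [← inner_conj_symm, InnerProductSpace.toDual_symm_apply]; rfl
  rw [h1]
  refine ((Complex.continuous_conj.tendsto _).comp (hL g)).congr fun n => ?_
  simp [inner_conj_symm]

theorem WeakTendsto.norm_le {l : Filter ι} [l.NeBot] {u : ι → H} {ψ : H} {C : ℝ}
    (h : WeakTendsto u l ψ) (hu : ∀ᶠ n in l, ‖u n‖ ≤ C) : ‖ψ‖ ≤ C := by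
  have hC : 0 ≤ C := by
    obtain ⟨n, hn⟩ := hu.exists
    exact (norm_nonneg _).trans hn
  have h1 : ‖(inner ℂ ψ ψ : ℂ)‖ ≤ ‖ψ‖ * C :=
    le_of_tendsto (h ψ).norm (hu.mono fun n hn =>
      (norm_inner_le_norm _ _).trans (by gcongr))
  rw [inner_self_eq_norm_sq_to_K] at h1
  simp only [norm_pow] at h1
  have h2 : ‖ψ‖ * ‖ψ‖ ≤ ‖ψ‖ * C := by simpa [sq] using h1
  rcases (norm_nonneg ψ).eq_or_lt' with h0 | h0
  · rw [h0]; exact hC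
  · exact le_of_mul_le_mul_left h2 h0

theorem WeakTendsto.unique {l : Filter ι} [l.NeBot] {u : ι → H} {ψ φ : H}
    (h : WeakTendsto u l ψ) (h' : WeakTendsto u l φ) : ψ = φ :=
  ext_inner_left ℂ fun g => tendsto_nhds_unique (h g) (h' g)

theorem WeakTendsto.sub {l : Filter ι} {u v : ι → H} {ψ φ : H}
    (h : WeakTendsto u l ψ) (h' : WeakTendsto v l φ) :
    WeakTendsto (fun n => u n - v n) l (ψ - φ) := fun g => by
  simpa only [inner_sub_right] using (h g).sub (h' g)

theorem WeakTendsto.congr {l : Filter ι} {u v : ι → H} {ψ : H}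
    (h : WeakTendsto u l ψ) (huv : ∀ n, u n = v n) : WeakTendsto v l ψ := fun g =>
  (h g).congr fun n => by rw [huv n]

theorem weakTendsto_const {l : Filter ι} {ψ : H} : WeakTendsto (fun _ => ψ) l ψ :=
  fun _ => tendsto_const_nhds

theorem WeakTendsto.inner_left {l : Filter ι} {u : ι → H} {ψ : H} {C : ℝ}
    (h : WeakTendsto u l ψ) (hu : ∀ n, ‖u n‖ ≤ C) {g : ι → H} {g₀ : H}
    (hg : Tendsto g l (𝓝 g₀)) :
    Tendsto (fun n => inner ℂ (g n) (u n)) l (𝓝 (inner ℂ g₀ ψ)) := by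
  have h1 : Tendsto (fun n => inner ℂ (g n - g₀) (u n)) l (𝓝 (0 : ℂ)) := by
    refine squeeze_zero_norm (a := fun n => ‖g n - g₀‖ * C)
      (fun n => (norm_inner_le_norm _ _).trans (by gcongr; exact hu n)) ?_
    have := (tendsto_iff_norm_sub_tendsto_zero.1 hg).mul_const C
    simpa using this
  have h2 := h1.add (h g₀)
  simpa only [inner_sub_left, sub_add_cancel, zero_add] using h2

/-- Isometries whose inverses converge strongly preserve weak limits. -/
theorem WeakTendsto.map_isometry {l : Filter ι} {u : ι → H} {ψ : H} {C : ℝ}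
    (h : WeakTendsto u l ψ) (hu : ∀ n, ‖u n‖ ≤ C) {A : ι → H ≃ₗᵢ[ℂ] H} {B : H ≃ₗᵢ[ℂ] H}
    (hA : ∀ g, Tendsto (fun n => (A n).symm g) l (𝓝 (B.symm g))) :
    WeakTendsto (fun n => A n (u n)) l (B ψ) := fun g => by
  have := h.inner_left hu (hA g)
  have e : ∀ (D : H ≃ₗᵢ[ℂ] H) (x y : H), inner ℂ (D.symm x) y = inner ℂ x (D y) :=
    fun D x y => by rw [← D.inner_map_map, D.apply_symm_apply]
  simpa only [e] using this

/-- Weak convergence of bounded families can be tested on a dense set. -/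
theorem WeakTendsto.of_dense {l : Filter ι} {u : ι → H} {ψ : H} {C : ℝ} (hu : ∀ n, ‖u n‖ ≤ C)
    {D : Set H} (hD : Dense D)
    (h : ∀ g ∈ D, Tendsto (fun n => inner ℂ g (u n)) l (𝓝 (inner ℂ g ψ))) :
    WeakTendsto u l ψ := fun g => by
  rw [Metric.tendsto_nhds]
  intro ε hε
  obtain ⟨g', hg', hd⟩ := hD.exists_dist_lt g (ε := ε / (2 * (|C| + ‖ψ‖ + 1))) (by positivity)
  filter_upwards [Metric.tendsto_nhds.1 (h g' hg') (ε / 2) (by positivity)] with n hn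
  have e : inner ℂ g (u n) - inner ℂ g ψ =
      inner ℂ (g - g') (u n - ψ) + (inner ℂ g' (u n) - inner ℂ g' ψ) := by
    simp only [inner_sub_left, inner_sub_right]; ring
  rw [dist_eq_norm] at hn hd ⊢
  rw [e]
  have h1 : ‖u n - ψ‖ ≤ |C| + ‖ψ‖ + 1 := by
    have := norm_sub_le (u n) ψ
    have := hu n
    have := le_abs_self C
    linarith
  calc _ ≤ ‖g - g'‖ * ‖u n - ψ‖ + ‖inner ℂ g' (u n) - inner ℂ g' ψ‖ :=
        (norm_add_le _ _).trans (by gcongr; exact norm_inner_le_norm _ _)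
    _ < ε / (2 * (|C| + ‖ψ‖ + 1)) * (|C| + ‖ψ‖ + 1) + ε / 2 := by
        refine add_lt_add_of_le_of_lt ?_ hn
        gcongr
    _ = ε := by
        have : |C| + ‖ψ‖ + 1 ≠ 0 := by positivity
        field_simp; ring

end Weak

/-- Pointwise convergence to zero of equi-Lipschitz maps is uniform on compact sets. -/
theorem eventually_forall_norm_lt_of_isCompact {ι X E : Type*} [PseudoMetricSpace X]
    [SeminormedAddCommGroup E] {l : Filter ι} {T : ι → X → E} {K : ℝ}
    (hT : ∀ n x y, ‖T n x - T n y‖ ≤ K * dist x y) (h0 : ∀ x, Tendsto (fun n => T n x) l (𝓝 0))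
    {s : Set X} (hs : IsCompact s) {ε : ℝ} (hε : 0 < ε) :
    ∀ᶠ n in l, ∀ x ∈ s, ‖T n x‖ < ε := by
  set δ := ε / (2 * (|K| + 1)) with hδ
  have hδ0 : 0 < δ := by positivity
  obtain ⟨t, hts, htf, hcov⟩ := hs.finite_cover_balls hδ0
  have h1 : ∀ᶠ n in l, ∀ y ∈ t, ‖T n y‖ < ε / 2 := by
    rw [htf.eventually_all]
    intro y _
    have := (h0 y).norm
    rw [norm_zero] at this
    exact this.eventually_lt_const (by positivity)
  filter_upwards [h1] with n hn x hx
  obtain ⟨y, hy, hxy⟩ := Set.mem_iUnion₂.1 (hcov hx)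
  rw [Metric.mem_ball] at hxy
  have h2 : ‖T n x - T n y‖ ≤ (|K| + 1) * δ := (hT n x y).trans (by
    have : K ≤ |K| + 1 := by linarith [le_abs_self K]
    gcongr)
  have h3 : (|K| + 1) * δ = ε / 2 := by
    rw [hδ]; have : |K| + 1 ≠ 0 := by positivity
    field_simp
  have h4 : ‖T n x‖ ≤ ‖T n x - T n y‖ + ‖T n y‖ := by
    simpa using norm_add_le (T n x - T n y) (T n y)
  linarith [hn y hy]

noncomputable section

variable {m : ℕ}

/-! ### The space `L²` -/

theorem L2.norm_sq_eq_integral (f : L2 m) : ‖f‖ ^ 2 = ∫ x, ‖f x‖ ^ 2 := by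
  have h := L2.inner_def (𝕜 := ℂ) f f
  rw [inner_self_eq_norm_sq_to_K] at h
  have h2 : (∫ x, inner ℂ (f x) (f x)) = ((∫ x, ‖f x‖ ^ 2 : ℝ) : ℂ) := by
    rw [← integral_complex_ofReal]
    congr 1; ext x
    rw [inner_self_eq_norm_sq_to_K]; push_cast; rfl
  rw [h2] at h
  exact Complex.ofReal_injective (by rw [← h]; push_cast; rfl)

theorem L2.integrable_norm_sq (f : L2 m) : Integrable (fun x => ‖f x‖ ^ 2) :=
  (memLp_two_iff_integrable_sq_norm (Lp.aestronglyMeasurable f)).1 (Lp.memLp f)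

theorem L2.enorm_sq_eq_lintegral (f : L2 m) : ‖f‖ₑ ^ 2 = ∫⁻ x, ‖f x‖ₑ ^ 2 := by
  rw [Lp.enorm_def, eLpNorm_eq_lintegral_rpow_enorm_toReal (by norm_num) (by norm_num)]
  rw [← ENNReal.rpow_natCast, ← ENNReal.rpow_mul]
  simp

/-- Isometries do not enlarge the error in the vector, so an increment is bounded by `‖p.2 - q.2‖`
plus an increment along one orbit. -/
theorem continuous_uncurry_of_isometry {X H : Type*} [TopologicalSpace X] [NormedAddCommGroup H]
    [InnerProductSpace ℂ H] {A : X → H ≃ₗᵢ[ℂ] H} (hA : ∀ f, Continuous fun t => A t f) :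
    Continuous fun q : X × H => A q.1 q.2 := by
  refine continuous_iff_continuousAt.2 fun q => ?_
  rw [ContinuousAt, tendsto_iff_norm_sub_tendsto_zero]
  have h1 : Tendsto (fun p : X × H => ‖p.2 - q.2‖ + ‖A p.1 q.2 - A q.1 q.2‖)
      (𝓝 q) (𝓝 (0 + 0)) := by
    refine Tendsto.add ?_ ?_
    · exact tendsto_iff_norm_sub_tendsto_zero.1 continuous_snd.continuousAt
    · exact tendsto_iff_norm_sub_tendsto_zero.1 ((hA q.2).comp continuous_fst).continuousAt
  rw [add_zero] at h1
  refine squeeze_zero (fun _ => norm_nonneg _) (fun p => ?_) h1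
  have : A p.1 p.2 - A q.1 q.2 = A p.1 (p.2 - q.2) + (A p.1 q.2 - A q.1 q.2) := by
    rw [map_sub]; abel
  rw [this]
  refine (norm_add_le _ _).trans ?_
  rw [(A p.1).norm_map]

/-! ### Translations -/

theorem coeFn_translateL2 (z : Sp m) (f : L2 m) :
    translateL2 z f =ᵐ[volume] fun x => f (x - z) :=
  Lp.coeFn_compMeasurePreserving _ _

theorem translateL2_add (z w : Sp m) (f : L2 m) :
    translateL2 (z + w) f = translateL2 z (translateL2 w f) := by
  refine Lp.ext ?_
  have h := (measurePreserving_sub_right (volume : Measure (Sp m)) z).quasiMeasurePreserving.ae_eq_comp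
    (coeFn_translateL2 w f)
  filter_upwards [coeFn_translateL2 (z + w) f, coeFn_translateL2 z (translateL2 w f), h]
    with x h1 h2 h3
  rw [h1, h2]
  simp only [Function.comp_apply] at h3
  rw [h3, sub_sub]

theorem translateL2_zero (f : L2 m) : translateL2 0 f = f := by
  refine Lp.ext ?_
  filter_upwards [coeFn_translateL2 0 f] with x h1
  rw [h1, sub_zero]

/-- Translation as a unitary operator. -/
def transE (z : Sp m) : L2 m ≃ₗᵢ[ℂ] L2 m where
  toFun := translateL2 z
  invFun := translateL2 (-z)
  map_add' f g := map_add _ f g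
  map_smul' c f := by
    refine Lp.ext ?_
    have h := (measurePreserving_sub_right (volume : Measure (Sp m)) z).quasiMeasurePreserving.ae_eq_comp
      (Lp.coeFn_smul c f)
    filter_upwards [coeFn_translateL2 z (c • f), Lp.coeFn_smul c (translateL2 z f),
      coeFn_translateL2 z f, h] with x h1 h2 h3 h4
    simp only [Function.comp_apply] at h4
    rw [h1, h4, RingHom.id_apply, h2, Pi.smul_apply, Pi.smul_apply, h3]
  left_inv f := by rw [← translateL2_add, neg_add_cancel, translateL2_zero]
  right_inv f := by rw [← translateL2_add, add_neg_cancel, translateL2_zero]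
  norm_map' f := Lp.norm_compMeasurePreserving _ _

theorem transE_symm (z : Sp m) : (transE z).symm = transE (-z) := by
  ext1 f; rfl

theorem transE_add (z w : Sp m) (f : L2 m) : transE (z + w) f = transE z (transE w f) :=
  translateL2_add z w f

theorem transE_zero (f : L2 m) : transE 0 f = f := translateL2_zero f

theorem coeFn_transE (z : Sp m) (f : L2 m) : transE z f =ᵐ[volume] fun x => f (x - z) :=
  coeFn_translateL2 z f

theorem continuous_transE (f : L2 m) : Continuous fun z : Sp m => transE z f := by
  have h : Continuous fun z : Sp m => (⟨fun x => x - z, by fun_prop⟩ : C(Sp m, Sp m)) :=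
    ContinuousMap.continuous_of_continuous_uncurry _ (by
      simp only [Function.uncurry_def, ContinuousMap.coe_mk]; fun_prop)
  exact (continuous_const (y := f)).compMeasurePreservingLp h
    (fun z => measurePreserving_sub_right volume z) (by norm_num)

/-! ### Multiplication operators -/

/-- Multiplication by a real bounded function. -/
def potMul (V : LInf m) : L2 m →L[ℂ] L2 m :=
  LinearMap.mkContinuous
    { toFun := fun f => (V • f : L2 m)
      map_add' := fun f g => Lp.add_smul V f g
      map_smul' := fun c f => by
        refine Lp.ext ?_
        filter_upwards [Lp.coeFn_lpSMul (r := 2) V (c • f), Lp.coeFn_smul c f,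
          Lp.coeFn_smul c (V • f : L2 m), Lp.coeFn_lpSMul (r := 2) V f] with x h1 h2 h3 h4
        rw [h1, RingHom.id_apply, h3, Pi.smul_apply, h4, Pi.smul_apply', Pi.smul_apply', h2,
          Pi.smul_apply, smul_comm] } ‖V‖ fun f => Lp.norm_smul_le V f

theorem potMul_apply (V : LInf m) (f : L2 m) : potMul V f = (V • f : L2 m) := rfl

theorem norm_potMul_le (V : LInf m) (f : L2 m) : ‖potMul V f‖ ≤ ‖V‖ * ‖f‖ :=
  Lp.norm_smul_le V f

theorem coeFn_potMul (V : LInf m) (f : L2 m) :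
    potMul V f =ᵐ[volume] fun x => (V x : ℂ) * f x := by
  filter_upwards [Lp.coeFn_lpSMul (r := 2) V f] with x hx
  rw [potMul_apply, hx, Pi.smul_apply', Complex.real_smul]

theorem inner_potMul_left (V : LInf m) (f g : L2 m) :
    inner ℂ (potMul V f) g = inner ℂ f (potMul V g) := by
  rw [L2.inner_def, L2.inner_def]
  refine integral_congr_ae ?_
  filter_upwards [coeFn_potMul V f, coeFn_potMul V g] with x h1 h2
  rw [h1, h2]
  simp only [RCLike.inner_apply, map_mul, Complex.conj_ofReal]; ring

theorem inner_potMul_eq_integral (V : LInf m) (f : L2 m) :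
    inner ℂ f (potMul V f) = ((∫ x, V x * ‖f x‖ ^ 2 : ℝ) : ℂ) := by
  rw [L2.inner_def, ← integral_complex_ofReal]
  refine integral_congr_ae ?_
  filter_upwards [coeFn_potMul V f] with x h1
  rw [h1]
  simp only [RCLike.inner_apply, mul_assoc, Complex.mul_conj, Complex.normSq_eq_norm_sq]
  push_cast; ring

/-! ### The free propagator -/

theorem coeFn_fourier_freeFlow (t : ℝ) (f : L2 m) :
    (𝓕 (freeFlow t f) : L2 m) =ᵐ[volume] fun ξ =>
      Complex.exp (((-(4 * Real.pi ^ 2 * t * ‖ξ‖ ^ 2) : ℝ) : ℂ) * Complex.I) * (𝓕 f : L2 m) ξ := by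
  rw [freeFlow, FourierTransform.fourier_fourierInv_eq]
  filter_upwards [Lp.coeFn_lpSMul (r := 2) (freeSymbol m t) (𝓕 f : L2 m),
    (memLp_freeSymbol m t).coeFn_toLp] with ξ h1 h2
  rw [h1, Pi.smul_apply', freeSymbol, h2, smul_eq_mul]

theorem fourier_injective : Function.Injective (fun f : L2 m => (𝓕 f : L2 m)) :=
  (Lp.fourierTransformₗᵢ (Sp m) ℂ).injective

theorem freeFlow_add (s t : ℝ) (f : L2 m) : freeFlow (s + t) f = freeFlow s (freeFlow t f) := by
  refine fourier_injective (Lp.ext ?_)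
  filter_upwards [coeFn_fourier_freeFlow (s + t) f, coeFn_fourier_freeFlow s (freeFlow t f),
    coeFn_fourier_freeFlow t f] with ξ h1 h2 h3
  simp only [h1, h2, h3]
  rw [← mul_assoc, ← Complex.exp_add]
  congr 2
  push_cast; ring

theorem freeFlow_zero (f : L2 m) : freeFlow 0 f = f := by
  refine fourier_injective (Lp.ext ?_)
  filter_upwards [coeFn_fourier_freeFlow 0 f] with ξ h1
  simp only [h1]
  simp

/-- The free propagator as a unitary operator. -/
def freeE (t : ℝ) : L2 m ≃ₗᵢ[ℂ] L2 m where
  toFun := freeFlow t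
  invFun := freeFlow (-t)
  map_add' f g := by
    simp only [freeFlow, FourierTransform.fourier_add, Lp.add_smul,
      FourierTransform.fourierInv_add]
  map_smul' c f := by
    simp only [freeFlow, FourierTransform.fourier_smul, RingHom.id_apply]
    rw [← Lp.smul_comm, FourierTransform.fourierInv_smul]
  left_inv f := by rw [← freeFlow_add, neg_add_cancel, freeFlow_zero]
  right_inv f := by rw [← freeFlow_add, add_neg_cancel, freeFlow_zero]
  norm_map' f := by
    change ‖freeFlow t f‖ = ‖f‖
    rw [← Lp.norm_fourier_eq (freeFlow t f), ← Lp.norm_fourier_eq f, Lp.norm_def, Lp.norm_def]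
    congr 1
    refine eLpNorm_congr_norm_ae ?_
    filter_upwards [coeFn_fourier_freeFlow t f] with ξ h
    rw [h, norm_mul, Complex.norm_exp_ofReal_mul_I, one_mul]

theorem freeE_apply (t : ℝ) (f : L2 m) : freeE t f = freeFlow t f := rfl

theorem freeE_add (s t : ℝ) (f : L2 m) : freeE (s + t) f = freeE s (freeE t f) :=
  freeFlow_add s t f

theorem freeE_zero (f : L2 m) : freeE 0 f = f := freeFlow_zero f

/-- By Plancherel the squared increment is an integral over frequencies dominated by `4 |𝓕 f|²`. -/
theorem continuous_freeE (f : L2 m) : Continuous fun t : ℝ => freeE t f := by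
  refine continuous_iff_continuousAt.2 fun t₀ => ?_
  have key : ∀ t, ‖freeE t f - freeE t₀ f‖ ^ 2 = ∫ ξ : Sp m,
      ‖Complex.exp (((-(4 * Real.pi ^ 2 * t * ‖ξ‖ ^ 2) : ℝ) : ℂ) * Complex.I) -
        Complex.exp (((-(4 * Real.pi ^ 2 * t₀ * ‖ξ‖ ^ 2) : ℝ) : ℂ) * Complex.I)‖ ^ 2 *
        ‖(𝓕 f : L2 m) ξ‖ ^ 2 := fun t => by
    rw [← Lp.norm_fourier_eq, L2.norm_sq_eq_integral]
    refine integral_congr_ae ?_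
    have : (𝓕 (freeE t f - freeE t₀ f) : L2 m) = 𝓕 (freeE t f) - 𝓕 (freeE t₀ f) :=
      (Lp.fourierTransformₗᵢ (Sp m) ℂ).map_sub _ _
    rw [this]
    filter_upwards [Lp.coeFn_sub (𝓕 (freeE t f) : L2 m) (𝓕 (freeE t₀ f) : L2 m),
      coeFn_fourier_freeFlow t f, coeFn_fourier_freeFlow t₀ f] with ξ h1 h2 h3
    rw [h1, Pi.sub_apply, freeE_apply, freeE_apply, h2, h3, ← sub_mul, norm_mul, mul_pow]
  have lim : Tendsto (fun t => ‖freeE t f - freeE t₀ f‖ ^ 2) (𝓝 t₀) (𝓝 0) := by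
    simp only [key]
    have := tendsto_integral_filter_of_dominated_convergence (l := 𝓝 t₀)
      (F := fun t (ξ : Sp m) =>
        ‖Complex.exp (((-(4 * Real.pi ^ 2 * t * ‖ξ‖ ^ 2) : ℝ) : ℂ) * Complex.I) -
        Complex.exp (((-(4 * Real.pi ^ 2 * t₀ * ‖ξ‖ ^ 2) : ℝ) : ℂ) * Complex.I)‖ ^ 2 *
        ‖(𝓕 f : L2 m) ξ‖ ^ 2) (f := fun _ => 0) (μ := volume)
      (fun ξ => 4 * ‖(𝓕 f : L2 m) ξ‖ ^ 2) ?_ ?_ ?_ ?_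
    · simpa using this
    · refine Eventually.of_forall fun t => ?_
      refine AEStronglyMeasurable.mul (Continuous.aestronglyMeasurable (by fun_prop)) ?_
      exact (L2.integrable_norm_sq _).aestronglyMeasurable
    · refine Eventually.of_forall fun t => Eventually.of_forall fun ξ => ?_
      rw [Real.norm_of_nonneg (by positivity)]
      gcongr
      have h1 := norm_sub_le
        (Complex.exp (((-(4 * Real.pi ^ 2 * t * ‖ξ‖ ^ 2) : ℝ) : ℂ) * Complex.I))
        (Complex.exp (((-(4 * Real.pi ^ 2 * t₀ * ‖ξ‖ ^ 2) : ℝ) : ℂ) * Complex.I))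
      rw [Complex.norm_exp_ofReal_mul_I, Complex.norm_exp_ofReal_mul_I] at h1
      calc _ ≤ ((1 : ℝ) + 1) ^ 2 := by gcongr
        _ = 4 := by norm_num
    · exact (L2.integrable_norm_sq _).const_mul _
    · refine Eventually.of_forall fun ξ => ?_
      have hc : Continuous fun t : ℝ =>
          ‖Complex.exp (((-(4 * Real.pi ^ 2 * t * ‖ξ‖ ^ 2) : ℝ) : ℂ) * Complex.I) -
          Complex.exp (((-(4 * Real.pi ^ 2 * t₀ * ‖ξ‖ ^ 2) : ℝ) : ℂ) * Complex.I)‖ ^ 2 *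
          ‖(𝓕 f : L2 m) ξ‖ ^ 2 := by fun_prop
      have := hc.tendsto t₀
      simpa using this
  rw [ContinuousAt, tendsto_iff_norm_sub_tendsto_zero]
  have := lim.sqrt
  simpa [Real.sqrt_sq (norm_nonneg _)] using this

/-! ### The Fourier transform on `L²` -/

theorem L2.locallyIntegrable (f : L2 m) : LocallyIntegrable f volume :=
  (Lp.memLp f).locallyIntegrable (by norm_num)

/-- On `L¹ ∩ L²` the inverse Fourier transform is given by the integral formula. -/
theorem coeFn_fourierInv_of_integrable (g : L2 m) (hg : Integrable g volume) :
    (𝓕⁻ g : L2 m) =ᵐ[volume] 𝓕⁻ (g : Sp m → ℂ) := by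
  have hL : Continuous fun p : Sp m × Sp m => (-innerₗ (Sp m)) p.1 p.2 := by
    simp only [LinearMap.neg_apply, innerₗ_apply_apply]; fun_prop
  have hcont : Continuous (𝓕⁻ (g : Sp m → ℂ)) :=
    VectorFourier.fourierIntegral_continuous Real.continuous_fourierChar hL hg
  refine ae_eq_of_integral_contDiff_smul_eq (L2.locallyIntegrable _) hcont.locallyIntegrable ?_
  intro φ hφ hφc
  have hg₁ : HasCompactSupport (Complex.ofRealCLM ∘ φ) := hφc.comp_left rfl
  have hg₂ : ContDiff ℝ ∞ (Complex.ofRealCLM ∘ φ) := by fun_prop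
  set Φ : 𝓢(Sp m, ℂ) := hg₁.toSchwartzMap hg₂ with hΦ
  have e1 : ∀ h : Sp m → ℂ, ∫ x, φ x • h x = ∫ x, Φ x • h x := fun h => by
    congr 1
  rw [e1, e1]
  have h1 : ∫ x, Φ x • (𝓕⁻ g : L2 m) x = (((𝓕⁻ g : L2 m) : 𝓢'(Sp m, ℂ)) Φ) := by
    rw [Lp.toTemperedDistribution_apply]
  rw [h1, ← Lp.fourierInv_toTemperedDistribution_eq, TemperedDistribution.fourierInv_apply,
    Lp.toTemperedDistribution_apply]
  have h2 := VectorFourier.integral_fourierIntegral_smul_eq_flip (L := -innerₗ (Sp m))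
    (μ := volume) (ν := volume) Real.continuous_fourierChar hL Φ.integrable hg
  have h3 : (-innerₗ (Sp m)).flip = -innerₗ (Sp m) := by
    ext x y; simp [real_inner_comm]
  rw [h3] at h2
  rw [SchwartzMap.fourierInv_coe]
  exact h2

theorem norm_fourierInv_le_integral (g : Sp m → ℂ) (x : Sp m) :
    ‖𝓕⁻ g x‖ ≤ ∫ ξ, ‖g ξ‖ :=
  VectorFourier.norm_fourierIntegral_le_integral_norm _ _ _ _ _

theorem memLp_modSymbol (z : Sp m) :
    MemLp (fun ξ : Sp m => Complex.exp (((2 * Real.pi * inner ℝ ξ z : ℝ) : ℂ) * Complex.I))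
      ∞ (volume : Measure (Sp m)) := by
  refine memLp_top_of_bound (Continuous.aestronglyMeasurable (by fun_prop)) 1 ?_
  exact Eventually.of_forall fun ξ => (Complex.norm_exp_ofReal_mul_I _).le

/-- The Fourier transform turns translations into modulations. -/
theorem coeFn_fourier_transE (z : Sp m) (f : L2 m) :
    (𝓕 (transE z f) : L2 m) =ᵐ[volume] fun ξ =>
      Complex.exp (((2 * Real.pi * inner ℝ ξ (-z) : ℝ) : ℂ) * Complex.I) * (𝓕 f : L2 m) ξ := by
  set M : Lp ℂ ∞ (volume : Measure (Sp m)) := (memLp_modSymbol (-z)).toLp _ with hM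
  have key : ∀ g : L2 m, transE z (𝓕⁻ g) = (𝓕⁻ (M • g : L2 m) : L2 m) := by
    intro g
    have hc2 : Continuous fun g : L2 m => (M • g : L2 m) := by
      refine continuous_iff_continuousAt.2 fun g₀ => ?_
      rw [ContinuousAt, tendsto_iff_norm_sub_tendsto_zero]
      have h1 : Tendsto (fun g => ‖M‖ * ‖g - g₀‖) (𝓝 g₀) (𝓝 (‖M‖ * 0)) :=
        (tendsto_iff_norm_sub_tendsto_zero.1 tendsto_id).const_mul _
      rw [mul_zero] at h1
      refine squeeze_zero (fun _ => norm_nonneg _) (fun g => ?_) h1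
      have : (M • g - M • g₀ : L2 m) = M • (g - g₀) := by
        rw [sub_eq_add_neg, sub_eq_add_neg, Lp.add_smul, Lp.smul_neg]
      rw [this]
      exact Lp.norm_smul_le _ _
    -- Both sides are continuous in `g`, so Schwartz functions suffice; for them the inverse
    -- transforms are given by convergent integrals.
    refine DenseRange.induction_on (p := fun g : L2 m => transE z (𝓕⁻ g) = 𝓕⁻ (M • g : L2 m))
      (SchwartzMap.denseRange_toLpCLM (F := ℂ) (p := 2) (μ := (volume : Measure (Sp m)))
        ENNReal.ofNat_ne_top) g ?_ ?_
    · exact isClosed_eq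
        ((transE z).continuous.comp (Lp.fourierTransformₗᵢ (Sp m) ℂ).symm.continuous)
        ((Lp.fourierTransformₗᵢ (Sp m) ℂ).symm.continuous.comp hc2)
    · intro φ
      rw [SchwartzMap.toLpCLM_apply]
      set g : L2 m := φ.toLp 2 with hg
      have hgφ : g =ᵐ[volume] φ := φ.coeFn_toLp 2 _
      have hMg : (M • g : L2 m) =ᵐ[volume] fun ξ =>
          Complex.exp (((2 * Real.pi * inner ℝ ξ (-z) : ℝ) : ℂ) * Complex.I) * φ ξ := by
        filter_upwards [Lp.coeFn_lpSMul (r := 2) M g, (memLp_modSymbol (-z)).coeFn_toLp, hgφ]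
          with ξ h1 h2 h3
        rw [h1, Pi.smul_apply', hM, h2, h3, smul_eq_mul]
      have hgi : Integrable g volume := φ.integrable.congr hgφ.symm
      have hMi : Integrable (M • g : L2 m) volume := by
        refine Integrable.congr ?_ hMg.symm
        refine φ.integrable.bdd_mul (c := 1) (Continuous.aestronglyMeasurable (by fun_prop)) ?_
        exact Eventually.of_forall fun ξ => (Complex.norm_exp_ofReal_mul_I _).le
      refine Lp.ext ?_
      have h4 := (measurePreserving_sub_right (volume : Measure (Sp m)) z).quasiMeasurePreserving.ae_eq_comp
        (coeFn_fourierInv_of_integrable g hgi)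
      filter_upwards [coeFn_transE z (𝓕⁻ g : L2 m), h4,
        coeFn_fourierInv_of_integrable (M • g : L2 m) hMi] with x h1 h2 h3
      simp only [Function.comp_apply] at h2
      rw [h1, h2, h3, Real.fourierInv_congr_ae hMg, Real.fourierInv_congr_ae hgφ,
        Real.fourierInv_eq', Real.fourierInv_eq']
      congr 1; ext ξ
      rw [smul_eq_mul, smul_eq_mul, ← mul_assoc, ← Complex.exp_add]
      congr 2
      rw [inner_sub_right, inner_neg_right]
      push_cast; ring
  have h := key (𝓕 f)
  rw [FourierTransform.fourierInv_fourier_eq] at h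
  rw [h, FourierTransform.fourier_fourierInv_eq]
  filter_upwards [Lp.coeFn_lpSMul (r := 2) M (𝓕 f : L2 m), (memLp_modSymbol (-z)).coeFn_toLp]
    with ξ h1 h2
  rw [h1, Pi.smul_apply', hM, h2, smul_eq_mul]

theorem freeE_transE (t : ℝ) (z : Sp m) (f : L2 m) :
    freeE t (transE z f) = transE z (freeE t f) := by
  refine fourier_injective (Lp.ext ?_)
  filter_upwards [coeFn_fourier_freeFlow t (transE z f), coeFn_fourier_transE z (freeE t f),
    coeFn_fourier_freeFlow t f, coeFn_fourier_transE z f] with ξ h1 h2 h3 h4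
  simp only [freeE_apply] at *
  rw [h1, h2, h3, h4]; ring

/-! ### The Sobolev space `H¹` on the Fourier side -/

/-- A bridge from tempered distributions to almost everywhere identities: smooth compactly supported
functions already separate locally integrable functions. Through it, Sobolev membership and weak
derivatives become statements about `𝓕 f`. -/
theorem smulLeftCLM_eq_iff {g : Sp m → ℂ} (hg : g.HasTemperateGrowth) (h k : L2 m) :
    TemperedDistribution.smulLeftCLM ℂ g (h : 𝓢'(Sp m, ℂ)) = (k : 𝓢'(Sp m, ℂ)) ↔
      k =ᵐ[volume] fun ξ => g ξ * h ξ := by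
  have hgc : Continuous g := hg.1.continuous
  constructor
  · intro H
    refine ae_eq_of_integral_contDiff_smul_eq (L2.locallyIntegrable _) ?_ ?_
    · have := (L2.locallyIntegrable h).locallyIntegrableOn Set.univ
      have := this.continuousOn_mul hgc.continuousOn (isClosed_univ.isLocallyClosed)
      exact locallyIntegrableOn_univ.1 this
    intro φ hφ hφc
    have hg₁ : HasCompactSupport (Complex.ofRealCLM ∘ φ) := hφc.comp_left rfl
    have hg₂ : ContDiff ℝ ∞ (Complex.ofRealCLM ∘ φ) := by fun_prop
    set Φ : 𝓢(Sp m, ℂ) := hg₁.toSchwartzMap hg₂ with hΦ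
    have e1 : ∀ h : Sp m → ℂ, ∫ x, φ x • h x = ∫ x, Φ x • h x := fun h => by
      congr 1
    rw [e1, e1]
    have := congrArg (fun T : 𝓢'(Sp m, ℂ) => T Φ) H
    simp only [TemperedDistribution.smulLeftCLM_apply_apply,
      Lp.toTemperedDistribution_apply] at this
    rw [← this]
    congr 1; ext x
    rw [SchwartzMap.smulLeftCLM_apply_apply hg]
    simp only [smul_eq_mul]; ring
  · intro H
    ext Φ
    simp only [TemperedDistribution.smulLeftCLM_apply_apply,
      Lp.toTemperedDistribution_apply]
    refine integral_congr_ae ?_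
    filter_upwards [H] with x hx
    rw [SchwartzMap.smulLeftCLM_apply_apply hg, hx]
    simp only [smul_eq_mul]; ring

theorem fourier_tempered_injective :
    Function.Injective (fun f : 𝓢'(Sp m, ℂ) => (𝓕 f : 𝓢'(Sp m, ℂ))) := fun f g h => by
  have := congrArg (fun T : 𝓢'(Sp m, ℂ) => (𝓕⁻ T : 𝓢'(Sp m, ℂ))) h
  simpa only [FourierTransform.fourierInv_fourier_eq] using this

theorem lineDeriv_eq_iff (w : Sp m) (f g : L2 m) :
    ∂_{w} (f : 𝓢'(Sp m, ℂ)) = (g : 𝓢'(Sp m, ℂ)) ↔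
      (𝓕 g : L2 m) =ᵐ[volume] fun ξ =>
        (2 * Real.pi * Complex.I) * ((inner ℝ ξ w : ℝ) : ℂ) * (𝓕 f : L2 m) ξ := by
  have hg : (fun ξ : Sp m => ((inner ℝ ξ w : ℝ) : ℂ)).HasTemperateGrowth := by fun_prop
  have hg' : (fun ξ : Sp m => (2 * Real.pi * Complex.I) *
      ((inner ℝ ξ w : ℝ) : ℂ)).HasTemperateGrowth := by fun_prop
  rw [← smulLeftCLM_eq_iff hg', ← fourier_tempered_injective.eq_iff]
  simp only [TemperedDistribution.fourier_lineDerivOp_eq, Lp.fourier_toTemperedDistribution_eq]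
  have := TemperedDistribution.smulLeftCLM_smul (F := ℂ) hg (2 * Real.pi * Complex.I)
  have e : (fun ξ : Sp m => (2 * Real.pi * Complex.I) * ((inner ℝ ξ w : ℝ) : ℂ)) =
      (2 * Real.pi * Complex.I : ℂ) • (fun ξ : Sp m => ((inner ℝ ξ w : ℝ) : ℂ)) := by
    ext ξ; simp
  rw [e, this]
  rfl

/-- The Dirichlet integral of `f`, up to the factor `4π²`, computed on the Fourier side. -/
def dirichlet (f : L2 m) : ℝ≥0∞ := ∫⁻ ξ, ‖ξ‖ₑ ^ 2 * ‖(𝓕 f : L2 m) ξ‖ₑ ^ 2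

theorem memH1_iff (f : L2 m) : MemH1 f ↔ dirichlet f < ⊤ := by
  have hg : (fun ξ : Sp m => (((1 + ‖ξ‖ ^ 2) ^ ((1 : ℝ) / 2) : ℝ) : ℂ)).HasTemperateGrowth := by
    fun_prop
  rw [MemH1, TemperedDistribution.memSobolev_iff_exists_smulLeftCLM_fourier]
  simp only [Lp.fourier_toTemperedDistribution_eq]
  simp only [smulLeftCLM_eq_iff hg]
  have hsq : ∀ ξ : Sp m, ∀ z : ℂ, ‖(((1 + ‖ξ‖ ^ 2) ^ ((1 : ℝ) / 2) : ℝ) : ℂ) * z‖ₑ ^ 2 =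
      ‖z‖ₑ ^ 2 + ‖ξ‖ₑ ^ 2 * ‖z‖ₑ ^ 2 := fun ξ z => by
    rw [enorm_mul, mul_pow]
    have : ‖(((1 + ‖ξ‖ ^ 2) ^ ((1 : ℝ) / 2) : ℝ) : ℂ)‖ₑ ^ 2 = 1 + ‖ξ‖ₑ ^ 2 := by
      rw [← ofReal_norm, ← ofReal_norm, Complex.norm_real, Real.norm_of_nonneg (by positivity),
        ← ENNReal.ofReal_pow (by positivity), ← ENNReal.ofReal_pow (by positivity),
        ← Real.rpow_natCast, ← Real.rpow_mul (by positivity), ← ENNReal.ofReal_one,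
        ← ENNReal.ofReal_add (by positivity) (by positivity)]
      norm_num
    rw [this]; ring
  have hmeas : AEStronglyMeasurable (fun ξ : Sp m =>
      (((1 + ‖ξ‖ ^ 2) ^ ((1 : ℝ) / 2) : ℝ) : ℂ) * (𝓕 f : L2 m) ξ) volume :=
    (hg.1.continuous.aestronglyMeasurable).mul (Lp.aestronglyMeasurable _)
  have hfin : ∫⁻ ξ, ‖(𝓕 f : L2 m) ξ‖ₑ ^ 2 < (⊤ : ℝ≥0∞) := by
    rw [← L2.enorm_sq_eq_lintegral]; exact ENNReal.pow_lt_top enorm_lt_top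
  have key : MemLp (fun ξ : Sp m =>
      (((1 + ‖ξ‖ ^ 2) ^ ((1 : ℝ) / 2) : ℝ) : ℂ) * (𝓕 f : L2 m) ξ) 2 volume ↔ dirichlet f < ⊤ := by
    rw [MemLp, and_iff_right hmeas,
      eLpNorm_lt_top_iff_lintegral_rpow_enorm_lt_top (by norm_num) (by norm_num)]
    have : ∀ ξ : Sp m, ‖(((1 + ‖ξ‖ ^ 2) ^ ((1 : ℝ) / 2) : ℝ) : ℂ) * (𝓕 f : L2 m) ξ‖ₑ ^
        (2 : ℝ≥0∞).toReal = ‖(𝓕 f : L2 m) ξ‖ₑ ^ 2 + ‖ξ‖ₑ ^ 2 * ‖(𝓕 f : L2 m) ξ‖ₑ ^ 2 := fun ξ => by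
      rw [← hsq]; norm_num
    simp only [this]
    rw [lintegral_add_left' ((Lp.aestronglyMeasurable _).enorm.pow_const 2), ENNReal.add_lt_top,
      and_iff_right hfin, dirichlet]
  rw [← key]
  constructor
  · rintro ⟨k, hk⟩
    exact (memLp_congr_ae hk).1 (Lp.memLp k)
  · intro h
    exact ⟨h.toLp _, h.coeFn_toLp⟩

/-- Finiteness of the Dirichlet integral puts the multiplied transform in `L²`, so the default value
`0` in `weakPartial` does not occur. -/
theorem coeFn_fourier_weakPartial {f : L2 m} (hf : dirichlet f < ⊤) (i : Fin (m + 1)) :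
    (𝓕 (weakPartial i f) : L2 m) =ᵐ[volume] fun ξ =>
      (2 * Real.pi * Complex.I) * (ξ i : ℂ) * (𝓕 f : L2 m) ξ := by
  have hex : ∃ g : L2 m, ∂_{(EuclideanSpace.single i (1 : ℝ) : Sp m)} (f : 𝓢'(Sp m, ℂ)) =
      (g : 𝓢'(Sp m, ℂ)) := by
    have hL : MemLp (fun ξ : Sp m => (2 * Real.pi * Complex.I) *
        ((inner ℝ ξ (EuclideanSpace.single i (1 : ℝ)) : ℝ) : ℂ) * (𝓕 f : L2 m) ξ) 2 volume := by
      refine ⟨(Continuous.aestronglyMeasurable (by fun_prop)).mul (Lp.aestronglyMeasurable _), ?_⟩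
      rw [eLpNorm_lt_top_iff_lintegral_rpow_enorm_lt_top (by norm_num) (by norm_num)]
      have hle : ∀ ξ : Sp m, ‖(2 * Real.pi * Complex.I) *
          ((inner ℝ ξ (EuclideanSpace.single i (1 : ℝ)) : ℝ) : ℂ) * (𝓕 f : L2 m) ξ‖ₑ ^
          (2 : ℝ≥0∞).toReal ≤ ‖(2 * Real.pi * Complex.I : ℂ)‖ₑ ^ 2 *
            (‖ξ‖ₑ ^ 2 * ‖(𝓕 f : L2 m) ξ‖ₑ ^ 2) := fun ξ => by
        have : ‖((inner ℝ ξ (EuclideanSpace.single i (1 : ℝ)) : ℝ) : ℂ)‖ₑ ≤ ‖ξ‖ₑ := by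
          rw [← ofReal_norm, ← ofReal_norm, Complex.norm_real]
          refine ENNReal.ofReal_le_ofReal ((norm_inner_le_norm _ _).trans ?_)
          simp
        rw [ENNReal.toReal_ofNat, show (2 : ℝ) = ((2 : ℕ) : ℝ) by norm_num, ENNReal.rpow_natCast,
          enorm_mul, enorm_mul, mul_pow, mul_pow, mul_assoc]
        gcongr
      refine (lintegral_mono hle).trans_lt ?_
      rw [lintegral_const_mul' _ _ (by finiteness)]
      exact ENNReal.mul_lt_top (by finiteness) hf
    refine ⟨𝓕⁻ (hL.toLp _), ?_⟩
    rw [lineDeriv_eq_iff, FourierTransform.fourier_fourierInv_eq]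
    exact hL.coeFn_toLp
  have hw : ∂_{(EuclideanSpace.single i (1 : ℝ) : Sp m)} (f : 𝓢'(Sp m, ℂ)) =
      (weakPartial i f : 𝓢'(Sp m, ℂ)) := by
    rw [weakPartial, dif_pos hex]; exact hex.choose_spec
  rw [lineDeriv_eq_iff] at hw
  filter_upwards [hw] with ξ hξ
  rw [hξ, EuclideanSpace.inner_single_right]
  simp

theorem ofReal_gradNormSq {f : L2 m} (hf : dirichlet f < ⊤) :
    ENNReal.ofReal (gradNormSq f) = ENNReal.ofReal (4 * Real.pi ^ 2) * dirichlet f := by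
  have h1 : ∀ i, ENNReal.ofReal (‖weakPartial i f‖ ^ 2) =
      ∫⁻ ξ : Sp m, ENNReal.ofReal (4 * Real.pi ^ 2) *
        (ENNReal.ofReal ((ξ i) ^ 2) * ‖(𝓕 f : L2 m) ξ‖ₑ ^ 2) := fun i => by
    rw [ENNReal.ofReal_pow (norm_nonneg _), ofReal_norm, ← ofReal_norm, ← Lp.norm_fourier_eq,
      ofReal_norm, L2.enorm_sq_eq_lintegral]
    refine lintegral_congr_ae ?_
    filter_upwards [coeFn_fourier_weakPartial hf i] with ξ hξ
    rw [hξ, enorm_mul, mul_pow, ← mul_assoc]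
    congr 1
    rw [← ofReal_norm, ← ENNReal.ofReal_pow (norm_nonneg _), ← ENNReal.ofReal_mul (by positivity)]
    congr 1
    simp only [norm_mul, Complex.norm_I, Complex.norm_real, RCLike.norm_ofNat, mul_one,
      Real.norm_eq_abs, mul_pow, sq_abs]
    ring
  rw [gradNormSq, ENNReal.ofReal_sum_of_nonneg (fun i _ => by positivity)]
  simp only [h1]
  rw [← lintegral_finsetSum' _ (fun i _ => ?_)]
  · rw [dirichlet, ← lintegral_const_mul' _ _ ENNReal.ofReal_ne_top]
    refine lintegral_congr fun ξ => ?_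
    rw [← Finset.mul_sum, ← Finset.sum_mul, ← ENNReal.ofReal_sum_of_nonneg (fun i _ => by positivity),
      ← ofReal_norm ξ, ← ENNReal.ofReal_pow (norm_nonneg ξ), EuclideanSpace.norm_sq_eq]
    simp
  · have h2 : AEMeasurable (fun ξ : Sp m => ENNReal.ofReal ((ξ i) ^ 2)) volume := by
      exact (by fun_prop : Continuous fun ξ : Sp m => (ξ i) ^ 2).measurable.ennreal_ofReal.aemeasurable
    exact (h2.mul ((Lp.aestronglyMeasurable (𝓕 f : L2 m)).enorm.pow_const 2)).const_mul _

theorem gradNormSq_nonneg (f : L2 m) : 0 ≤ gradNormSq f :=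
  Finset.sum_nonneg fun _ _ => by positivity

theorem gradNormSq_eq {f : L2 m} (hf : dirichlet f < ⊤) :
    gradNormSq f = 4 * Real.pi ^ 2 * (dirichlet f).toReal := by
  have := congrArg ENNReal.toReal (ofReal_gradNormSq hf)
  rwa [ENNReal.toReal_ofReal (gradNormSq_nonneg f), ENNReal.toReal_mul,
    ENNReal.toReal_ofReal (by positivity)] at this

end

noncomputable section

/-! ### Bounded perturbations of unitary groups -/

/-- A strongly continuous one-parameter group of unitary operators. -/
structure UnitaryGroup (H : Type*) [NormedAddCommGroup H] [InnerProductSpace ℂ H] where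
  /-- The operator at time `t`. -/
  U : ℝ → H ≃ₗᵢ[ℂ] H
  zero : ∀ f, U 0 f = f
  add : ∀ s t f, U (s + t) f = U s (U t f)
  cont : ∀ f, Continuous fun t => U t f

namespace UnitaryGroup

variable {H : Type*} [NormedAddCommGroup H] [InnerProductSpace ℂ H] (G : UnitaryGroup H)
  (B : H →L[ℂ] H)

theorem apply_neg (t : ℝ) (f : H) : G.U t (G.U (-t) f) = f := by
  rw [← G.add, add_neg_cancel, G.zero]

theorem neg_apply (t : ℝ) (f : H) : G.U (-t) (G.U t f) = f := by
  rw [← G.add, neg_add_cancel, G.zero]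

theorem continuous_uncurry : Continuous fun q : ℝ × H => G.U q.1 q.2 :=
  continuous_uncurry_of_isometry G.cont

/-- Solutions of Duhamel's formula for the generator of `G` perturbed by `-i B`. -/
def IsMild (f : H) (u : ℝ → H) : Prop :=
  Continuous u ∧ ∀ t : ℝ, u t = G.U t f - Complex.I • ∫ s in (0 : ℝ)..t, G.U (t - s) (B (u s))

variable {G B}

theorem continuous_interaction :
    Continuous fun q : ℝ × H => G.U (-q.1) (B (G.U q.1 q.2)) :=
  G.continuous_uncurry.comp
    ((continuous_fst.neg).prodMk (B.continuous.comp G.continuous_uncurry))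

theorem hasDerivAt_map (A : H ≃ₗᵢ[ℂ] H) {u : ℝ → H} {u' : H} {t : ℝ} (hu : HasDerivAt u u' t) :
    HasDerivAt (fun s => A (u s)) (A u') t :=
  ((A.toContinuousLinearEquiv : H →L[ℂ] H).restrictScalars ℝ).hasFDerivAt.comp_hasDerivAt t hu

/-- The energy identity for the inhomogeneous equation in the interaction picture. -/
theorem hasDerivAt_norm_sq (hB : ∀ x y, inner ℂ (B x) y = inner ℂ x (B y)) {w : ℝ → H} {h : H}
    {t : ℝ} (hw : HasDerivAt w (-(Complex.I • G.U (-t) (B (G.U t (w t)))) + h) t) :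
    HasDerivAt (fun s => ‖w s‖ ^ 2) (2 * (inner ℂ (w t) h).re) t := by
  have h1 := hw.inner ℂ hw
  have h2 : HasDerivAt (fun s => (inner ℂ (w s) (w s)).re) _ t :=
    (Complex.reCLM.hasFDerivAt.comp_hasDerivAt t h1)
  have e : (fun s => (inner ℂ (w s) (w s)).re) = fun s => ‖w s‖ ^ 2 := by
    ext s; rw [inner_self_eq_norm_sq_to_K]
    rw [← RCLike.ofReal_pow]; rfl
  rw [e] at h2
  refine h2.congr_deriv ?_
  set C := G.U (-t) (B (G.U t (w t))) with hC
  -- Symmetry of `B` makes this inner product real, so the term `-i C` contributes nothing to the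
  -- derivative of `‖w‖²`.
  have hsym : inner ℂ (w t) C = inner ℂ C (w t) := by
    have e1 : inner ℂ (w t) C = inner ℂ (G.U t (w t)) (B (G.U t (w t))) := by
      rw [← (G.U t).inner_map_map, hC, G.apply_neg]
    have e2 : inner ℂ C (w t) = inner ℂ (B (G.U t (w t))) (G.U t (w t)) := by
      rw [← (G.U t).inner_map_map, hC, G.apply_neg]
    rw [e1, e2, hB]
  have hsym' : (inner ℂ h (w t)).re = (inner ℂ (w t) h).re := by
    rw [← inner_conj_symm, Complex.conj_re]
  simp only [inner_add_left, inner_add_right, inner_neg_left, inner_neg_right, inner_smul_left,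
    inner_smul_right, hsym, Complex.reCLM_apply, Complex.add_re, hsym']
  simp
  ring

variable [CompleteSpace H]

/-- Mild solutions in the interaction picture. -/
theorem isMild_iff {f : H} {u : ℝ → H} :
    G.IsMild B f u ↔ u 0 = f ∧ ∀ t, HasDerivAt (fun t => G.U (-t) (u t))
      (-(Complex.I • G.U (-t) (B (u t)))) t := by
  have hG : ∀ u : ℝ → H, Continuous u → Continuous fun t => G.U (-t) (B (u t)) :=
    fun u hu => G.continuous_uncurry.comp (continuous_neg.prodMk (B.continuous.comp hu))
  have hpull : ∀ u : ℝ → H, Continuous u → ∀ t : ℝ,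
      ∫ s in (0 : ℝ)..t, G.U (t - s) (B (u s)) =
        G.U t (∫ s in (0 : ℝ)..t, G.U (-s) (B (u s))) := fun u hu t => by
    have := ((G.U t).toContinuousLinearEquiv :
      H →L[ℂ] H).intervalIntegral_comp_comm ((hG u hu).intervalIntegrable (μ := volume) 0 t)
    refine Eq.trans ?_ this
    congr 1; ext1 s
    change G.U (t - s) (B (u s)) = G.U t (G.U (-s) (B (u s)))
    rw [← G.add, sub_eq_add_neg]
  constructor
  · rintro ⟨hu, h⟩
    have hw : ∀ t, G.U (-t) (u t) =
        f - Complex.I • ∫ s in (0 : ℝ)..t, G.U (-s) (B (u s)) := fun t => by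
      rw [h t, hpull u hu t, ← map_smul, ← map_sub, G.neg_apply]
    refine ⟨?_, fun t => ?_⟩
    · have := h 0
      simpa [G.zero] using this
    · simp only [hw]
      exact ((((hG u hu).integral_hasStrictDerivAt 0 t).hasDerivAt).const_smul
        Complex.I).const_sub f
  · rintro ⟨h0, h⟩
    have hwc : Continuous fun t => G.U (-t) (u t) :=
      continuous_iff_continuousAt.2 fun t => (h t).continuousAt
    have huc : Continuous u := by
      have := G.continuous_uncurry.comp (continuous_id.prodMk hwc)
      refine this.congr fun t => ?_
      simp only [Function.comp_apply, id, G.apply_neg]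
    refine ⟨huc, fun t => ?_⟩
    have h1 := intervalIntegral.integral_eq_sub_of_hasDerivAt (a := 0) (b := t) (fun s _ => h s)
      (((hG u huc).const_smul Complex.I).neg.intervalIntegrable (μ := volume) 0 t)
    rw [intervalIntegral.integral_neg, intervalIntegral.integral_smul, neg_zero, G.zero, h0] at h1
    rw [hpull u huc t, ← map_smul, ← map_sub, sub_eq_add_neg, h1, add_sub_cancel, G.apply_neg]

/-- In the interaction picture the equation is an integral equation with a bounded, continuous,
linear integrand. Writing the unknown as `cosh (lam t) • y t` with `y` bounded makes the Picard map
a contraction on the whole line, so no local solutions have to be glued. The even weight `cosh`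
treats both time directions together. -/
theorem exists_isMild (G : UnitaryGroup H) (B : H →L[ℂ] H) (f : H) : ∃ u, G.IsMild B f u := by
  set K : ℝ := ‖B‖ with hK
  have hK0 : 0 ≤ K := norm_nonneg _
  -- The contraction factor is `K / lam`, since the primitive of `cosh (lam t)` is `sinh (lam t) /
  -- lam`. This choice makes it at most `1/2` and keeps `lam > 0` when `K = 0`.
  set lam : ℝ := 2 * K + 1 with hlam
  have hlam0 : 0 < lam := by positivity
  set A : ℝ → H → H := fun s y => G.U (-s) (B (G.U s y)) with hA
  have hAc : Continuous fun q : ℝ × H => A q.1 q.2 := continuous_interaction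
  have hAsub : ∀ s y z, A s y - A s z = A s (y - z) := fun s y z => by
    simp only [hA, map_sub]
  have hAnorm : ∀ s y, ‖A s y‖ ≤ K * ‖y‖ := fun s y => by
    simp only [hA, LinearIsometryEquiv.norm_map]
    refine (B.le_opNorm _).trans ?_
    rw [LinearIsometryEquiv.norm_map]
  have hAsmul : ∀ s (c : ℝ) y, A s (c • y) = c • A s y := fun s c y => by
    simp only [hA, ← Complex.coe_smul c, map_smul]
  have hcosh : ∀ t : ℝ, 0 < Real.cosh (lam * t) := fun t => Real.cosh_pos _
  have hcc : Continuous fun t : ℝ => Real.cosh (lam * t) :=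
    Real.continuous_cosh.comp (by fun_prop)
  have hI : ∀ y : ℝ → H, Continuous y →
      Continuous fun s => Real.cosh (lam * s) • A s (y s) := fun y hy =>
    hcc.smul (hAc.comp (continuous_id.prodMk hy))
  have hcint : ∀ t : ℝ, ∫ s in (0 : ℝ)..t, Real.cosh (lam * s) = Real.sinh (lam * t) / lam := by
    intro t
    have hd : ∀ s ∈ Set.uIcc 0 t, HasDerivAt (fun s => Real.sinh (lam * s) / lam)
        (Real.cosh (lam * s)) s := fun s _ => by
      have := ((Real.hasDerivAt_sinh (lam * s)).comp s ((hasDerivAt_id s).const_mul lam)).div_const lam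
      refine this.congr_deriv ?_
      field_simp
    rw [intervalIntegral.integral_eq_sub_of_hasDerivAt hd (hcc.intervalIntegrable _ _)]
    simp
  have hbound : ∀ (y : ℝ → H) (B : ℝ), (∀ s, ‖y s‖ ≤ B) → ∀ t : ℝ,
      ‖(Real.cosh (lam * t))⁻¹ • ∫ s in (0 : ℝ)..t, Real.cosh (lam * s) • A s (y s)‖ ≤
        K / lam * B := by
    intro y B hB t
    have hB0 : 0 ≤ B := (norm_nonneg _).trans (hB 0)
    have h1 : ‖∫ s in (0 : ℝ)..t, Real.cosh (lam * s) • A s (y s)‖ ≤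
        |∫ s in (0 : ℝ)..t, Real.cosh (lam * s) * (K * B)| := by
      refine intervalIntegral.norm_integral_le_abs_of_norm_le
        (Eventually.of_forall fun s => ?_) ((hcc.mul_const _).intervalIntegrable _ _)
      rw [norm_smul, Real.norm_of_nonneg (hcosh s).le]
      gcongr
      exact (hAnorm s _).trans (by gcongr; exact hB s)
    rw [intervalIntegral.integral_mul_const, hcint, abs_mul, abs_div, abs_of_pos hlam0,
      abs_of_nonneg (by positivity : 0 ≤ K * B)] at h1
    have h2 : |Real.sinh (lam * t)| ≤ Real.cosh (lam * t) := by
      rw [abs_le]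
      constructor
      · have := Real.sinh_lt_cosh (-(lam * t))
        rw [Real.sinh_neg, Real.cosh_neg] at this
        linarith
      · exact (Real.sinh_lt_cosh _).le
    rw [norm_smul, norm_inv, Real.norm_of_nonneg (hcosh t).le]
    calc _ ≤ (Real.cosh (lam * t))⁻¹ * (Real.cosh (lam * t) / lam * (K * B)) := by
          have := (hcosh t).le
          gcongr
          exact h1.trans (by gcongr)
      _ = K / lam * B := by
          have := (hcosh t).ne'
          field_simp
  set Φ₀ : (ℝ → H) → ℝ → H := fun y t => (Real.cosh (lam * t))⁻¹ •
    (f - Complex.I • ∫ s in (0 : ℝ)..t, Real.cosh (lam * s) • A s (y s)) with hΦ₀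
  have hΦc : ∀ y : ℝ → H, Continuous y → Continuous (Φ₀ y) := fun y hy => by
    refine (hcc.inv₀ fun t => (hcosh t).ne').smul (continuous_const.sub ?_)
    refine continuous_const.smul ?_
    exact intervalIntegral.continuous_primitive (fun a b => (hI y hy).intervalIntegrable a b) 0
  have hΦeq : ∀ y t, Φ₀ y t = (Real.cosh (lam * t))⁻¹ • f - Complex.I •
      ((Real.cosh (lam * t))⁻¹ • ∫ s in (0 : ℝ)..t, Real.cosh (lam * s) • A s (y s)) := by
    intro y t
    simp only [hΦ₀, smul_sub]
    rw [smul_comm]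
  have hΦb : ∀ (y : ℝ → H) (B : ℝ), (∀ s, ‖y s‖ ≤ B) → ∀ t, ‖Φ₀ y t‖ ≤ ‖f‖ + K / lam * B := by
    intro y B hB t
    rw [hΦeq]
    refine (norm_sub_le _ _).trans ?_
    gcongr
    · rw [norm_smul, norm_inv, Real.norm_of_nonneg (hcosh t).le]
      have : (Real.cosh (lam * t))⁻¹ ≤ 1 := inv_le_one_of_one_le₀ (Real.one_le_cosh _)
      exact mul_le_of_le_one_left (norm_nonneg _) this
    · rw [norm_smul, Complex.norm_I, one_mul]
      exact hbound y B hB t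
  let Φ : BoundedContinuousFunction ℝ H → BoundedContinuousFunction ℝ H := fun y =>
    BoundedContinuousFunction.ofNormedAddCommGroup (Φ₀ y) (hΦc y y.continuous) _
      (hΦb y ‖y‖ y.norm_coe_le_norm)
  have hcontr : ContractingWith (1 / 2) Φ := by
    refine ⟨by norm_num, LipschitzWith.of_dist_le_mul fun y z => ?_⟩
    rw [BoundedContinuousFunction.dist_le (by positivity)]
    intro t
    change dist (Φ₀ y t) (Φ₀ z t) ≤ _
    have e : Φ₀ y t - Φ₀ z t = -(Complex.I • ((Real.cosh (lam * t))⁻¹ •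
        ∫ s in (0 : ℝ)..t, Real.cosh (lam * s) • A s (y s - z s))) := by
      rw [hΦeq, hΦeq, sub_sub_sub_cancel_left, ← smul_sub, ← smul_sub,
        ← intervalIntegral.integral_sub ((hI z z.continuous).intervalIntegrable _ _)
          ((hI y y.continuous).intervalIntegrable _ _), ← smul_neg, ← smul_neg,
        ← intervalIntegral.integral_neg]
      congr 3; ext1 s
      rw [← hAsub, ← smul_sub, ← smul_neg, neg_sub]
    rw [dist_eq_norm, e, norm_neg, norm_smul, Complex.norm_I, one_mul]
    refine (hbound _ (dist y z) (fun s => ?_) t).trans ?_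
    · rw [← dist_eq_norm]; exact BoundedContinuousFunction.dist_coe_le_dist s
    · gcongr
      rw [div_le_iff₀ hlam0]
      have : ((1 / 2 : NNReal) : ℝ) = 1 / 2 := by norm_num
      rw [this, hlam]; linarith
  obtain ⟨y, hy⟩ : ∃ y, Φ y = y := ⟨_, hcontr.fixedPoint_isFixedPt⟩
  set w : ℝ → H := fun t => Real.cosh (lam * t) • y t with hw
  have hwc : Continuous w := hcc.smul y.continuous
  have hweq : ∀ t, w t = f - Complex.I • ∫ s in (0 : ℝ)..t, A s (w s) := fun t => by
    have h1 : y t = Φ₀ y t := by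
      conv_lhs => rw [← hy]
      rfl
    simp only [hw, hAsmul]
    rw [h1]
    simp only [hΦ₀]
    rw [smul_inv_smul₀ (hcosh t).ne']
  refine ⟨fun t => G.U t (w t), isMild_iff.2 ⟨?_, fun t => ?_⟩⟩
  · simp only [G.zero]
    rw [hweq]; simp
  · have e : (fun t => G.U (-t) (G.U t (w t))) = w := by
      ext1 t; rw [G.neg_apply]
    rw [e]
    have hAw : Continuous fun s => A s (w s) := hAc.comp (continuous_id.prodMk hwc)
    have h1 := ((hAw.integral_hasStrictDerivAt 0 t).hasDerivAt.const_smul Complex.I).const_sub f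
    refine HasDerivAt.congr_of_eventuallyEq h1 (Eventually.of_forall fun t => hweq t)

theorem IsMild.norm_eq (hB : ∀ x y, inner ℂ (B x) y = inner ℂ x (B y)) {f : H} {u : ℝ → H}
    (h : G.IsMild B f u) (t : ℝ) : ‖u t‖ = ‖f‖ := by
  obtain ⟨h0, hd⟩ := isMild_iff.1 h
  have hd' : ∀ t, HasDerivAt (fun s => ‖G.U (-s) (u s)‖ ^ 2) 0 t := fun t => by
    have := hasDerivAt_norm_sq (G := G) hB (w := fun t => G.U (-t) (u t)) (h := 0)
      (t := t) (by rw [add_zero, G.apply_neg]; exact hd t)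
    simpa using this
  have h1 := is_const_of_deriv_eq_zero (fun t => (hd' t).differentiableAt)
    (fun t => (hd' t).deriv) t 0
  simp only [LinearIsometryEquiv.norm_map, h0] at h1
  exact (sq_eq_sq₀ (norm_nonneg _) (norm_nonneg _)).1 h1

theorem IsMild.add {f g : H} {u v : ℝ → H} (hu : G.IsMild B f u) (hv : G.IsMild B g v) :
    G.IsMild B (f + g) (fun t => u t + v t) := by
  rw [isMild_iff] at *
  refine ⟨by rw [hu.1, hv.1], fun t => ?_⟩
  have := (hu.2 t).add (hv.2 t)
  simp only [map_add, smul_add, neg_add]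
  exact this

theorem IsMild.const_smul {f : H} {u : ℝ → H} (c : ℂ) (hu : G.IsMild B f u) :
    G.IsMild B (c • f) (fun t => c • u t) := by
  rw [isMild_iff] at *
  refine ⟨by rw [hu.1], fun t => ?_⟩
  have := (hu.2 t).const_smul c
  simp only [map_smul]
  rw [smul_comm, ← smul_neg]
  exact this

/-- The difference is a mild solution with zero datum and its norm is conserved, so no Gronwall
inequality is needed. -/
theorem IsMild.unique (hB : ∀ x y, inner ℂ (B x) y = inner ℂ x (B y)) {f : H} {u v : ℝ → H}
    (hu : G.IsMild B f u) (hv : G.IsMild B f v) (t : ℝ) : u t = v t := by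
  have h := (hu.add (hv.const_smul (-1))).norm_eq hB t
  rw [neg_one_smul, neg_one_smul, add_neg_cancel, norm_zero, norm_eq_zero, add_neg_eq_zero] at h
  exact h

theorem IsMild.shift {f : H} {u : ℝ → H} (hu : G.IsMild B f u) (s : ℝ) :
    G.IsMild B (u s) (fun t => u (t + s)) := by
  rw [isMild_iff] at *
  refine ⟨by rw [zero_add], fun t => ?_⟩
  have h2 := hasDerivAt_map (G.U s) ((hu.2 (t + s)).comp_add_const t s)
  have e : ∀ (r : ℝ) (x : H), G.U s (G.U (-(r + s)) x) = G.U (-r) x := fun r x => by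
    rw [← G.add]; congr 2; ring
  simpa only [map_neg, map_smul, e] using h2

/-- Mild solutions are mapped to mild solutions by operators intertwining the equations. -/
theorem IsMild.map {B' : H →L[ℂ] H} {A : H ≃ₗᵢ[ℂ] H} (hA : ∀ t f, G.U t (A f) = A (G.U t f))
    (hAB : ∀ f, A (B' f) = B (A f)) {f : H} {u : ℝ → H} (hu : G.IsMild B' f u) :
    G.IsMild B (A f) (fun t => A (u t)) := by
  rw [isMild_iff] at *
  refine ⟨by rw [hu.1], fun t => ?_⟩
  have h2 := hasDerivAt_map A (hu.2 t)
  simpa only [map_neg, map_smul, ← hA, hAB] using h2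

/-- Continuous dependence of mild solutions on the perturbation. -/
theorem tendsto_of_isMild {ι : Type*} {l : Filter ι} {Bn : ι → H →L[ℂ] H}
    (hBs : ∀ n x y, inner ℂ (Bn n x) y = inner ℂ x (Bn n y))
    (hBsym : ∀ x y, inner ℂ (B x) y = inner ℂ x (B y)) {K : ℝ} (hK : ∀ n, ‖Bn n‖ ≤ K)
    (hBn : ∀ f, Tendsto (fun n => Bn n f) l (𝓝 (B f))) {f : H} {un : ι → ℝ → H} {u : ℝ → H}
    (hun : ∀ n, G.IsMild (Bn n) f (un n)) (hu : G.IsMild B f u)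
    {s : ι → ℝ} {s₀ : ℝ} (hs : Tendsto s l (𝓝 s₀)) :
    Tendsto (fun n => un n (s n)) l (𝓝 (u s₀)) := by
  set T : ℝ := |s₀| + 1 with hT
  have hT0 : 0 < T := by positivity
  -- Strong convergence of the uniformly bounded `Bn n` is uniform on the compact piece of orbit `u
  -- '' [-T, T]`, the only place where `Bn n - B` is evaluated.
  have hcomp : IsCompact ((fun t => u t) '' Set.Icc (-T) T) :=
    isCompact_Icc.image hu.1
  have hsub : Tendsto (fun n => un n (s n) - u (s n)) l (𝓝 0) := by
    rw [tendsto_zero_iff_norm_tendsto_zero, Metric.tendsto_nhds]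
    intro ε hε
    -- The energy identity leaves only the inhomogeneity `Bn n (u t) - B (u t)`. The derivative of
    -- `‖D‖²` is thus at most `4 (‖f‖ + 1) δ`, and over a time at most `T` this amounts to `ε² / 2`.
    set δ : ℝ := ε ^ 2 / (8 * (‖f‖ + 1) * T) with hδ
    have hδ0 : 0 < δ := by positivity
    have h1 := eventually_forall_norm_lt_of_isCompact (l := l)
      (T := fun n g => Bn n g - B g) (K := K + ‖B‖)
      (fun n x y => by
        have : Bn n x - B x - (Bn n y - B y) =
            Bn n (x - y) - B (x - y) := by
          simp only [map_sub]; abel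
        rw [this, dist_eq_norm, add_mul]
        refine (norm_sub_le _ _).trans (add_le_add ?_ (B.le_opNorm _))
        exact ((Bn n).le_opNorm _).trans (by gcongr; exact hK n))
      (fun g => by
        have := (hBn g).sub_const (B g)
        rwa [sub_self] at this) hcomp hδ0
    have h2 : ∀ᶠ n in l, |s n| < T :=
      hs.abs.eventually_lt_const (by rw [hT]; linarith)
    filter_upwards [h1, h2] with n hn hsn
    set D : ℝ → H := fun t =>
      G.U (-t) (un n t) - G.U (-t) (u t) with hD
    set h : ℝ → H := fun t =>
      -(Complex.I • G.U (-t) (Bn n (u t) - B (u t))) with hh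
    have hder : ∀ t, HasDerivAt (fun s => ‖D s‖ ^ 2) (2 * (inner ℂ (D t) (h t)).re) t := by
      intro t
      refine hasDerivAt_norm_sq (G := G) (hBs n) ?_
      have a1 := (isMild_iff.1 (hun n)).2 t
      have a2 := (isMild_iff.1 hu).2 t
      refine (a1.sub a2).congr_deriv ?_
      have e : G.U t (D t) = un n t - u t := by
        simp only [hD]
        rw [map_sub, G.apply_neg, G.apply_neg]
      rw [e]
      simp only [hh]
      rw [sub_neg_eq_add, ← sub_eq_zero]
      simp only [map_sub, smul_sub]
      abel
    have hDn : ∀ t, ‖D t‖ ≤ 2 * ‖f‖ := fun t => by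
      refine (norm_sub_le _ _).trans ?_
      simp only [LinearIsometryEquiv.norm_map]
      rw [(hun n).norm_eq (hBs n), hu.norm_eq hBsym]; linarith
    have hbd : ∀ t ∈ Set.Icc (-T) T, ‖2 * (inner ℂ (D t) (h t)).re‖ ≤ 4 * (‖f‖ + 1) * δ := by
      intro t ht
      have b1 : ‖h t‖ ≤ δ := by
        simp only [hh, norm_smul, norm_neg, Complex.norm_I, one_mul,
          LinearIsometryEquiv.norm_map]
        exact (hn _ ⟨t, ht, rfl⟩).le
      have b2 : |(inner ℂ (D t) (h t)).re| ≤ ‖D t‖ * ‖h t‖ :=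
        (Complex.abs_re_le_norm _).trans (norm_inner_le_norm _ _)
      rw [norm_mul, Real.norm_eq_abs, Real.norm_eq_abs, abs_two]
      calc 2 * |(inner ℂ (D t) (h t)).re| ≤ 2 * ((2 * ‖f‖) * δ) := by
            gcongr
            exact b2.trans (mul_le_mul (hDn t) b1 (norm_nonneg _) (by positivity))
        _ ≤ 4 * (‖f‖ + 1) * δ := by nlinarith
    have hmv := (convex_Icc (-T) T).norm_image_sub_le_of_norm_hasDerivWithin_le
      (fun t _ => (hder t).hasDerivWithinAt) hbd
      (x := 0) (y := s n) ⟨by linarith, hT0.le⟩ (abs_le.1 hsn.le)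
    have hD0 : D 0 = 0 := by
      simp only [hD]
      rw [(isMild_iff.1 (hun n)).1, (isMild_iff.1 hu).1, sub_self]
    rw [hD0, norm_zero] at hmv
    simp only [ne_eq, OfNat.ofNat_ne_zero, not_false_eq_true, zero_pow, sub_zero, norm_pow,
      Real.norm_eq_abs, abs_norm] at hmv
    have hfin : ‖D (s n)‖ ^ 2 < ε ^ 2 := by
      calc ‖D (s n)‖ ^ 2 ≤ 4 * (‖f‖ + 1) * δ * T := hmv.trans (mul_le_mul_of_nonneg_left hsn.le (by positivity))
        _ = ε ^ 2 / 2 := by rw [hδ]; field_simp; norm_num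
        _ < ε ^ 2 := by have : 0 < ε ^ 2 := by positivity
                        linarith
    have hDe : ‖D (s n)‖ = ‖un n (s n) - u (s n)‖ := by
      simp only [hD]
      rw [← map_sub, LinearIsometryEquiv.norm_map]
    rw [dist_zero_right, norm_norm, ← hDe]
    exact lt_of_pow_lt_pow_left₀ 2 hε.le hfin
  have h3 : Tendsto (fun n => u (s n)) l (𝓝 (u s₀)) := (hu.1.tendsto s₀).comp hs
  simpa using hsub.add h3

end UnitaryGroup

/-! ### The propagator -/

/-- The free propagator as a unitary group. -/
def freeGroup (m : ℕ) : UnitaryGroup (L2 m) where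
  U := freeE
  zero := freeE_zero
  add := freeE_add
  cont := continuous_freeE

theorem isLinearSolution_iff_isMild (V : LInf m) (f : L2 m) (u : ℝ → L2 m) :
    IsLinearSolution V f u ↔ (freeGroup m).IsMild (potMul V) f u := Iff.rfl

theorem isMild_flow (V : LInf m) (f : L2 m) :
    (freeGroup m).IsMild (potMul V) f (fun t => flow V t f) := by
  have h : ∃ u, IsLinearSolution V f u := UnitaryGroup.exists_isMild (freeGroup m) (potMul V) f
  rw [← isLinearSolution_iff_isMild]
  simp only [flow, dif_pos h]
  exact h.choose_spec

theorem UnitaryGroup.IsMild.eq_flow {V : LInf m} {f : L2 m} {u : ℝ → L2 m}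
    (hu : (freeGroup m).IsMild (potMul V) f u) (t : ℝ) : u t = flow V t f :=
  hu.unique (inner_potMul_left V) (isMild_flow V f) t

theorem flow_zero (V : LInf m) (f : L2 m) : flow V 0 f = f :=
  (UnitaryGroup.isMild_iff.1 (isMild_flow V f)).1

theorem flow_add (V : LInf m) (s t : ℝ) (f : L2 m) :
    flow V (s + t) f = flow V s (flow V t f) :=
  ((isMild_flow V f).shift t).eq_flow s

/-- The propagator `e^{it(Δ-V)}` as a unitary operator. -/
def flowE (V : LInf m) (t : ℝ) : L2 m ≃ₗᵢ[ℂ] L2 m where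
  toFun := flow V t
  invFun := flow V (-t)
  map_add' f g := (((isMild_flow V f).add (isMild_flow V g)).eq_flow t).symm
  map_smul' c f := (((isMild_flow V f).const_smul c).eq_flow t).symm
  left_inv f := by rw [← flow_add, neg_add_cancel, flow_zero]
  right_inv f := by rw [← flow_add, add_neg_cancel, flow_zero]
  norm_map' f := (isMild_flow V f).norm_eq (inner_potMul_left V) t

theorem flowE_apply (V : LInf m) (t : ℝ) (f : L2 m) : flowE V t f = flow V t f := rfl

theorem flowE_symm (V : LInf m) (t : ℝ) : (flowE V t).symm = flowE V (-t) := by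
  ext1 f; rfl

theorem flowE_add (V : LInf m) (s t : ℝ) (f : L2 m) :
    flowE V (s + t) f = flowE V s (flowE V t f) := flow_add V s t f

theorem flowE_zero (V : LInf m) (f : L2 m) : flowE V 0 f = f := flow_zero V f

theorem flowE_neg_apply (V : LInf m) (t : ℝ) (f : L2 m) : flowE V (-t) (flowE V t f) = f := by
  rw [← flowE_add, neg_add_cancel, flowE_zero]

theorem flowE_apply_neg (V : LInf m) (t : ℝ) (f : L2 m) : flowE V t (flowE V (-t) f) = f := by
  rw [← flowE_add, add_neg_cancel, flowE_zero]

theorem continuous_flowE (V : LInf m) (f : L2 m) : Continuous fun t => flowE V t f :=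
  (isMild_flow V f).1

/-- Translation of potentials: `V(· + z)`. -/
def shiftPot (z : Sp m) (V : LInf m) : LInf m :=
  Lp.compMeasurePreserving (fun x : Sp m => x + z) (measurePreserving_add_right volume z) V

theorem coeFn_shiftPot (z : Sp m) (V : LInf m) :
    shiftPot z V =ᵐ[volume] fun x => V (x + z) :=
  Lp.coeFn_compMeasurePreserving _ _

theorem norm_shiftPot (z : Sp m) (V : LInf m) : ‖shiftPot z V‖ = ‖V‖ :=
  Lp.norm_compMeasurePreserving _ _

/-- With `freeE_transE` this says that translation intertwines the equations with potentials `V(· +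
z)` and `V`; the covariance of the propagator then follows from uniqueness. -/
theorem transE_potMul_shiftPot (z : Sp m) (V : LInf m) (f : L2 m) :
    transE z (potMul (shiftPot z V) f) = potMul V (transE z f) := by
  refine Lp.ext ?_
  have hq := (measurePreserving_sub_right (volume : Measure (Sp m)) z).quasiMeasurePreserving
  filter_upwards [coeFn_transE z (potMul (shiftPot z V) f), coeFn_potMul V (transE z f),
    coeFn_transE z f, hq.ae_eq_comp (coeFn_potMul (shiftPot z V) f),
    hq.ae_eq_comp (coeFn_shiftPot z V)] with x h1 h2 h3 h4 h5
  simp only [Function.comp_apply] at h4 h5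
  rw [h1, h2, h3, h4, h5, sub_add_cancel]

/-- Covariance of the propagator under translations. -/
theorem flowE_transE (V : LInf m) (t : ℝ) (z : Sp m) (f : L2 m) :
    flowE V t (transE z f) = transE z (flowE (shiftPot z V) t f) :=
  (((isMild_flow (shiftPot z V) f).map (B := potMul V) (A := transE z)
    (fun t f => freeE_transE t z f) (transE_potMul_shiftPot z V)).eq_flow t).symm

theorem opNorm_potMul_le (V : LInf m) : ‖potMul V‖ ≤ ‖V‖ :=
  (potMul V).opNorm_le_bound (norm_nonneg _) (norm_potMul_le V)

/-- Strong continuity of the propagator with respect to the potential. -/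
theorem tendsto_flowE {ι : Type*} {l : Filter ι} {Vn : ι → LInf m} {W : LInf m} {K : ℝ}
    (hK : ∀ n, ‖Vn n‖ ≤ K)
    (hV : ∀ f : L2 m, Tendsto (fun n => potMul (Vn n) f) l (𝓝 (potMul W f)))
    {s : ι → ℝ} {s₀ : ℝ} (hs : Tendsto s l (𝓝 s₀)) (f : L2 m) :
    Tendsto (fun n => flowE (Vn n) (s n) f) l (𝓝 (flowE W s₀ f)) :=
  UnitaryGroup.tendsto_of_isMild (fun n => inner_potMul_left (Vn n)) (inner_potMul_left W)
    (fun n => (opNorm_potMul_le _).trans (hK n)) hV (fun n => isMild_flow (Vn n) f)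
    (isMild_flow W f) hs

end

noncomputable section

namespace UnitaryGroup

variable {H : Type*} [NormedAddCommGroup H] [InnerProductSpace ℂ H] {G : UnitaryGroup H}
  {B : H →L[ℂ] H}

/-- The perturbed and the free group have the same domain of differentiability. -/
theorem IsMild.hasDerivAt_sub [CompleteSpace H] {f : H} {u : ℝ → H} (hu : G.IsMild B f u) :
    HasDerivAt (fun t => u t - G.U t f) (-(Complex.I • B f)) 0 := by
  obtain ⟨h0, hd⟩ := isMild_iff.1 hu
  have h1 := hd 0
  rw [neg_zero, G.zero, h0] at h1
  rw [hasDerivAt_iff_tendsto_slope_zero] at h1 ⊢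
  have h2 : Tendsto (fun t : ℝ => G.U t (t⁻¹ • (G.U (-(0 + t)) (u (0 + t)) - G.U (-0) (u 0))))
      (𝓝[≠] 0) (𝓝 (G.U 0 (-(Complex.I • B f)))) := by
    have h3 : Tendsto (fun t : ℝ => (t, t⁻¹ • (G.U (-(0 + t)) (u (0 + t)) - G.U (-0) (u 0))))
        (𝓝[≠] 0) (𝓝 (0, -(Complex.I • B f))) :=
      (tendsto_id.mono_left nhdsWithin_le_nhds).prodMk_nhds h1
    exact (G.continuous_uncurry.tendsto _).comp h3
  rw [G.zero] at h2
  refine h2.congr fun t => ?_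
  simp only [zero_add, neg_zero, G.zero, h0, sub_self, sub_zero]
  rw [← Complex.coe_smul, map_smul, map_sub, G.apply_neg, Complex.coe_smul]

end UnitaryGroup

variable {m : ℕ}

/-! ### Fourier multipliers with bounded real symbols -/

/-- The Fourier transform on `L²` as a unitary operator. -/
abbrev fourE (m : ℕ) : L2 m ≃ₗᵢ[ℂ] L2 m := Lp.fourierTransformₗᵢ (Sp m) ℂ

/-- The Fourier multiplier with symbol `a`. -/
def fMul (a : LInf m) : L2 m →L[ℂ] L2 m :=
  ((fourE m).symm.toContinuousLinearEquiv : L2 m →L[ℂ] L2 m) ∘L potMul a ∘L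
    ((fourE m).toContinuousLinearEquiv : L2 m →L[ℂ] L2 m)

theorem fourier_fMul (a : LInf m) (f : L2 m) : (𝓕 (fMul a f) : L2 m) = potMul a (𝓕 f) :=
  FourierTransform.fourier_fourierInv_eq (potMul a (𝓕 f : L2 m))

theorem coeFn_fourier_fMul (a : LInf m) (f : L2 m) :
    (𝓕 (fMul a f) : L2 m) =ᵐ[volume] fun ξ => (a ξ : ℂ) * (𝓕 f : L2 m) ξ := by
  rw [fourier_fMul]; exact coeFn_potMul a _

theorem inner_fMul_left (a : LInf m) (f g : L2 m) :
    inner ℂ (fMul a f) g = inner ℂ f (fMul a g) := by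
  rw [← Lp.inner_fourier_eq (fMul a f) g, ← Lp.inner_fourier_eq f (fMul a g), fourier_fMul,
    fourier_fMul, inner_potMul_left]

theorem inner_fMul_self (a : LInf m) (f : L2 m) :
    inner ℂ f (fMul a f) = ((∫ ξ, a ξ * ‖(𝓕 f : L2 m) ξ‖ ^ 2 : ℝ) : ℂ) := by
  rw [← Lp.inner_fourier_eq f (fMul a f), fourier_fMul, inner_potMul_eq_integral]

theorem fMul_comm (a b : LInf m) (f : L2 m) : fMul a (fMul b f) = fMul b (fMul a f) := by
  refine fourier_injective (Lp.ext ?_)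
  filter_upwards [coeFn_fourier_fMul a (fMul b f), coeFn_fourier_fMul b (fMul a f),
    coeFn_fourier_fMul a f, coeFn_fourier_fMul b f] with ξ h1 h2 h3 h4
  rw [h1, h2, h3, h4]; ring

theorem fMul_freeE (a : LInf m) (t : ℝ) (f : L2 m) : fMul a (freeE t f) = freeE t (fMul a f) := by
  refine fourier_injective (Lp.ext ?_)
  filter_upwards [coeFn_fourier_fMul a (freeE t f), coeFn_fourier_freeFlow t (fMul a f),
    coeFn_fourier_fMul a f, coeFn_fourier_freeFlow t f] with ξ h1 h2 h3 h4
  simp only [freeE_apply] at *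
  rw [h1, h2, h3, h4]; ring

theorem memLp_cutoff {a : Sp m → ℝ} (ha : Continuous a) (R : ℝ) :
    MemLp ((Metric.ball (0 : Sp m) R).indicator a) ∞ volume := by
  obtain ⟨C, hC⟩ := (isCompact_closedBall (0 : Sp m) R).exists_bound_of_continuousOn
    ha.continuousOn
  refine memLp_top_of_bound (ha.aestronglyMeasurable.indicator measurableSet_ball) |C|
    (Eventually.of_forall fun ξ => ?_)
  by_cases h : ξ ∈ Metric.ball (0 : Sp m) R
  · rw [Set.indicator_of_mem h]
    exact (hC ξ (Metric.ball_subset_closedBall h)).trans (le_abs_self C)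
  · rw [Set.indicator_of_notMem h, norm_zero]; positivity

/-- The symbol `a` cut off to the ball of radius `R`. -/
def cutoff (a : Sp m → ℝ) (ha : Continuous a) (R : ℝ) : LInf m := (memLp_cutoff ha R).toLp _

theorem coeFn_cutoff {a : Sp m → ℝ} (ha : Continuous a) (R : ℝ) :
    cutoff a ha R =ᵐ[volume] (Metric.ball (0 : Sp m) R).indicator a :=
  (memLp_cutoff ha R).coeFn_toLp

/-- The projection to the frequencies `|ξ| < R`. -/
def lowPass (R : ℝ) : L2 m →L[ℂ] L2 m := fMul (cutoff (fun _ => 1) continuous_const R)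

theorem coeFn_fourier_lowPass (R : ℝ) (f : L2 m) :
    (𝓕 (lowPass R f) : L2 m) =ᵐ[volume] (Metric.ball (0 : Sp m) R).indicator (𝓕 f : L2 m) := by
  filter_upwards [coeFn_fourier_fMul (cutoff (fun _ => 1) continuous_const R) f,
    coeFn_cutoff (m := m) (a := fun _ => 1) continuous_const R] with ξ h1 h2
  rw [lowPass, h1, h2]
  by_cases h : ξ ∈ Metric.ball (0 : Sp m) R
  · rw [Set.indicator_of_mem h, Set.indicator_of_mem h]; simp
  · rw [Set.indicator_of_notMem h, Set.indicator_of_notMem h]; simp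

/-- The operator `-Δ` restricted to the frequencies `|ξ| < R`. -/
def lowLap (R : ℝ) : L2 m →L[ℂ] L2 m :=
  fMul (cutoff (fun ξ => 4 * Real.pi ^ 2 * ‖ξ‖ ^ 2) (by fun_prop) R)

theorem coeFn_fourier_lowLap (R : ℝ) (f : L2 m) :
    (𝓕 (lowLap R f) : L2 m) =ᵐ[volume] (Metric.ball (0 : Sp m) R).indicator
      (fun ξ => ((4 * Real.pi ^ 2 * ‖ξ‖ ^ 2 : ℝ) : ℂ) * (𝓕 f : L2 m) ξ) := by
  filter_upwards [coeFn_fourier_fMul (cutoff (fun ξ => 4 * Real.pi ^ 2 * ‖ξ‖ ^ 2)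
    (by fun_prop) R) f, coeFn_cutoff (m := m) (a := fun ξ => 4 * Real.pi ^ 2 * ‖ξ‖ ^ 2)
    (by fun_prop) R] with ξ h1 h2
  rw [lowLap, h1, h2]
  by_cases h : ξ ∈ Metric.ball (0 : Sp m) R
  · rw [Set.indicator_of_mem h, Set.indicator_of_mem h]
  · rw [Set.indicator_of_notMem h, Set.indicator_of_notMem h]; simp

theorem norm_lowPass_le (R : ℝ) (f : L2 m) : ‖lowPass R f‖ ≤ ‖f‖ := by
  rw [← Lp.norm_fourier_eq (lowPass R f), ← Lp.norm_fourier_eq f]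
  refine Lp.norm_le_norm_of_ae_le ?_
  filter_upwards [coeFn_fourier_lowPass R f] with ξ h
  rw [h]
  exact norm_indicator_le_norm_self _ _

theorem coeFn_fourier_sub (f g : L2 m) :
    (𝓕 (f - g) : L2 m) =ᵐ[volume] fun ξ => (𝓕 f : L2 m) ξ - (𝓕 g : L2 m) ξ := by
  have : (𝓕 (f - g) : L2 m) = 𝓕 f - 𝓕 g := (fourE m).map_sub f g
  rw [this]
  exact Lp.coeFn_sub _ _

theorem coeFn_fourier_add (f g : L2 m) :
    (𝓕 (f + g) : L2 m) =ᵐ[volume] fun ξ => (𝓕 f : L2 m) ξ + (𝓕 g : L2 m) ξ := by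
  have : (𝓕 (f + g) : L2 m) = 𝓕 f + 𝓕 g := (fourE m).map_add f g
  rw [this]
  exact Lp.coeFn_add _ _

/-- Low-pass filters converge strongly to the identity. -/
theorem tendsto_lowPass (f : L2 m) :
    Tendsto (fun n : ℕ => lowPass (n : ℝ) f) atTop (𝓝 f) := by
  rw [tendsto_iff_norm_sub_tendsto_zero]
  have h1 : ∀ n : ℕ, ‖lowPass (n : ℝ) f - f‖ ^ 2 = ‖f‖ ^ 2 -
      ∫ ξ in Metric.ball (0 : Sp m) n, ‖(𝓕 f : L2 m) ξ‖ ^ 2 := fun n => by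
    rw [← Lp.norm_fourier_eq (lowPass (n : ℝ) f - f), ← Lp.norm_fourier_eq f,
      L2.norm_sq_eq_integral, L2.norm_sq_eq_integral, ← integral_indicator measurableSet_ball,
      ← integral_sub (L2.integrable_norm_sq _)
        ((L2.integrable_norm_sq _).indicator measurableSet_ball)]
    refine integral_congr_ae ?_
    filter_upwards [coeFn_fourier_sub (lowPass (n : ℝ) f) f, coeFn_fourier_lowPass (n : ℝ) f]
      with ξ h1 h2
    rw [h1, h2]
    by_cases h : ξ ∈ Metric.ball (0 : Sp m) n
    · simp [Set.indicator_of_mem h]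
    · simp [Set.indicator_of_notMem h]
  have h2 := (aecover_ball (μ := (volume : Measure (Sp m))) (x := 0)
    tendsto_natCast_atTop_atTop).integral_tendsto_of_countably_generated
    (L2.integrable_norm_sq (𝓕 f : L2 m))
  rw [← L2.norm_sq_eq_integral, Lp.norm_fourier_eq] at h2
  have h3 : Tendsto (fun n : ℕ => ‖lowPass (n : ℝ) f - f‖ ^ 2) atTop (𝓝 0) := by
    simp only [h1]
    have := h2.const_sub (‖f‖ ^ 2)
    rwa [sub_self] at this
  simpa [Real.sqrt_sq (norm_nonneg _)] using h3.sqrt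

/-! ### The Dirichlet integral -/

theorem tendsto_setLIntegral_dirichlet (f : L2 m) :
    Tendsto (fun n : ℕ => ∫⁻ ξ in Metric.ball (0 : Sp m) n, ‖ξ‖ₑ ^ 2 * ‖(𝓕 f : L2 m) ξ‖ₑ ^ 2)
      atTop (𝓝 (dirichlet f)) :=
  (aecover_ball (μ := (volume : Measure (Sp m))) (x := 0)
    tendsto_natCast_atTop_atTop).lintegral_tendsto_of_countably_generated
    (((by fun_prop : Continuous fun ξ : Sp m => ‖ξ‖ₑ ^ 2).aemeasurable).mul
      ((Lp.aestronglyMeasurable _).enorm.pow_const 2))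

theorem re_inner_lowLap (R : ℝ) (f : L2 m) :
    ENNReal.ofReal (inner ℂ f (lowLap R f)).re = ENNReal.ofReal (4 * Real.pi ^ 2) *
      ∫⁻ ξ in Metric.ball (0 : Sp m) R, ‖ξ‖ₑ ^ 2 * ‖(𝓕 f : L2 m) ξ‖ₑ ^ 2 := by
  set a := cutoff (m := m) (fun ξ => 4 * Real.pi ^ 2 * ‖ξ‖ ^ 2) (by fun_prop) R with ha
  rw [lowLap, inner_fMul_self, Complex.ofReal_re, ← lintegral_indicator measurableSet_ball,
    ← lintegral_const_mul' _ _ ENNReal.ofReal_ne_top]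
  have hae : ∀ᵐ ξ, a ξ * ‖(𝓕 f : L2 m) ξ‖ ^ 2 = (Metric.ball (0 : Sp m) R).indicator
      (fun ξ => 4 * Real.pi ^ 2 * ‖ξ‖ ^ 2 * ‖(𝓕 f : L2 m) ξ‖ ^ 2) ξ := by
    filter_upwards [coeFn_cutoff (m := m) (a := fun ξ => 4 * Real.pi ^ 2 * ‖ξ‖ ^ 2)
      (by fun_prop) R] with ξ h
    rw [ha, h]
    by_cases h : ξ ∈ Metric.ball (0 : Sp m) R
    · rw [Set.indicator_of_mem h, Set.indicator_of_mem h]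
    · rw [Set.indicator_of_notMem h, Set.indicator_of_notMem h]; simp
  have hint : Integrable (fun ξ => a ξ * ‖(𝓕 f : L2 m) ξ‖ ^ 2) volume := by
    refine (L2.integrable_norm_sq (𝓕 f : L2 m)).bdd_mul (c := ‖a‖) (Lp.aestronglyMeasurable a) ?_
    have := ae_le_eLpNormEssSup (f := a) (μ := volume)
    filter_upwards [this] with ξ hξ
    rw [Lp.norm_def, eLpNorm_exponent_top]
    have hfin : eLpNormEssSup a volume < ⊤ := by
      have := Lp.eLpNorm_lt_top a
      rwa [eLpNorm_exponent_top] at this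
    have := ENNReal.toReal_mono hfin.ne hξ
    simpa using this
  rw [ofReal_integral_eq_lintegral_ofReal hint]
  · refine lintegral_congr_ae ?_
    filter_upwards [hae] with ξ h
    rw [h]
    by_cases h : ξ ∈ Metric.ball (0 : Sp m) R
    · rw [Set.indicator_of_mem h, Set.indicator_of_mem h, mul_assoc,
        ENNReal.ofReal_mul (p := 4 * Real.pi ^ 2) (by positivity),
        ENNReal.ofReal_mul (p := ‖ξ‖ ^ 2) (by positivity),
        ENNReal.ofReal_pow (norm_nonneg _), ENNReal.ofReal_pow (norm_nonneg _), ofReal_norm,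
        ofReal_norm]
    · rw [Set.indicator_of_notMem h, Set.indicator_of_notMem h]; simp
  · filter_upwards [hae] with ξ h
    rw [h]
    exact Set.indicator_nonneg (fun _ _ => by positivity) _

/-- The truncated forms are defined on all of `L²` and exhaust the Dirichlet integral, so `H¹`
membership can be decided by a limit of bounded operators. -/
theorem tendsto_re_inner_lowLap (f : L2 m) :
    Tendsto (fun n : ℕ => ENNReal.ofReal (inner ℂ f (lowLap (n : ℝ) f)).re) atTop
      (𝓝 (ENNReal.ofReal (4 * Real.pi ^ 2) * dirichlet f)) := by
  simp only [re_inner_lowLap]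
  exact ENNReal.Tendsto.const_mul (tendsto_setLIntegral_dirichlet f) (Or.inr ENNReal.ofReal_ne_top)

theorem four_pi_sq_pos : ENNReal.ofReal (4 * Real.pi ^ 2) ≠ 0 := by
  exact (ENNReal.ofReal_pos.2 (by positivity)).ne'

theorem re_inner_lowLap_nonneg (R : ℝ) (f : L2 m) : 0 ≤ (inner ℂ f (lowLap R f)).re := by
  rw [lowLap, inner_fMul_self, Complex.ofReal_re]
  refine integral_nonneg_of_ae ?_
  filter_upwards [coeFn_cutoff (m := m) (a := fun ξ => 4 * Real.pi ^ 2 * ‖ξ‖ ^ 2)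
      (by fun_prop) R] with ξ h
  rw [h]
  exact mul_nonneg (Set.indicator_nonneg (fun _ _ => by positivity) _) (by positivity)

/-- If the truncated Dirichlet integrals converge, the limit is the full Dirichlet integral. -/
theorem dirichlet_of_tendsto {f : L2 m} {L : ℝ}
    (h : Tendsto (fun n : ℕ => (inner ℂ f (lowLap (n : ℝ) f)).re) atTop (𝓝 L)) :
    dirichlet f < ⊤ ∧ gradNormSq f = L := by
  have h1 := tendsto_nhds_unique (tendsto_re_inner_lowLap f)
    ((ENNReal.continuous_ofReal.tendsto L).comp h)
  have h2 : dirichlet f < ⊤ := by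
    by_contra hc
    rw [not_lt, top_le_iff] at hc
    rw [hc, ENNReal.mul_top four_pi_sq_pos] at h1
    exact ENNReal.ofReal_ne_top h1.symm
  refine ⟨h2, ?_⟩
  rw [← ofReal_gradNormSq h2] at h1
  have hL : 0 ≤ L := ge_of_tendsto h (Eventually.of_forall fun n => re_inner_lowLap_nonneg _ _)
  exact (ENNReal.ofReal_eq_ofReal_iff (gradNormSq_nonneg f) hL).1 h1

theorem re_inner_lowLap_le {f : L2 m} (hf : dirichlet f < ⊤) (R : ℝ) :
    (inner ℂ f (lowLap R f)).re ≤ gradNormSq f := by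
  rw [← ENNReal.ofReal_le_ofReal_iff (gradNormSq_nonneg f), re_inner_lowLap, ofReal_gradNormSq hf]
  gcongr
  exact setLIntegral_le_lintegral _ _

theorem dirichlet_of_le {f : L2 m} {M : ℝ}
    (h : ∀ n : ℕ, (inner ℂ f (lowLap (n : ℝ) f)).re ≤ M) :
    dirichlet f < ⊤ ∧ gradNormSq f ≤ M := by
  have hM : 0 ≤ M := (re_inner_lowLap_nonneg _ _).trans (h 0)
  have h1 : ENNReal.ofReal (4 * Real.pi ^ 2) * dirichlet f ≤ ENNReal.ofReal M :=
    le_of_tendsto (tendsto_re_inner_lowLap f)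
      (Eventually.of_forall fun n => ENNReal.ofReal_le_ofReal (h n))
  have h2 : dirichlet f < ⊤ := by
    by_contra hc
    rw [not_lt, top_le_iff] at hc
    rw [hc, ENNReal.mul_top four_pi_sq_pos] at h1
    exact absurd h1 (by simp)
  refine ⟨h2, ?_⟩
  rw [← ofReal_gradNormSq h2] at h1
  exact (ENNReal.ofReal_le_ofReal_iff hM).1 h1

/-! ### Conservation of the energy -/

/-- On the band `|ξ| < R` the symbol of the generator is bounded by `X = 4π²R²`, so `|e^z - 1 - z| ≤
|z|²` gives a remainder of order `t²` uniformly in the frequency. Band-limited data are the core on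
which energy conservation is computed. -/
theorem hasDerivAt_freeE_lowPass (R : ℝ) (f : L2 m) :
    HasDerivAt (fun t => freeE t (lowPass R f)) (-(Complex.I • lowLap R f)) 0 := by
  set X : ℝ := 4 * Real.pi ^ 2 * R ^ 2 with hX
  have hX0 : 0 ≤ X := by positivity
  have key : ∀ t : ℝ, |t| * (X + 1) ≤ 1 →
      ‖freeE t (lowPass R f) - lowPass R f + t • (Complex.I • lowLap R f)‖ ≤
        X ^ 2 * t ^ 2 * ‖f‖ := by
    intro t ht
    rw [← Lp.norm_fourier_eq, ← Lp.norm_fourier_eq f]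
    refine Lp.norm_le_mul_norm_of_ae_le_mul ?_
    have e3 : (𝓕 (t • (Complex.I • lowLap R f)) : L2 m) = ((t : ℂ) * Complex.I) • 𝓕 (lowLap R f) := by
      rw [← algebraMap_smul ℂ t (Complex.I • lowLap R f), smul_smul]
      exact (fourE m).map_smul _ _
    filter_upwards [coeFn_fourier_add (freeE t (lowPass R f) - lowPass R f)
        (t • (Complex.I • lowLap R f)), coeFn_fourier_sub (freeE t (lowPass R f)) (lowPass R f),
      coeFn_fourier_freeFlow t (lowPass R f), coeFn_fourier_lowPass R f,
      coeFn_fourier_lowLap R f, Lp.coeFn_smul ((t : ℂ) * Complex.I) (𝓕 (lowLap R f) : L2 m)]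
      with ξ h1 h2 h3 h4 h5 h6
    rw [h1, h2, freeE_apply, h3, h4, e3, h6, Pi.smul_apply, h5]
    by_cases h : ξ ∈ Metric.ball (0 : Sp m) R
    · rw [Set.indicator_of_mem h, Set.indicator_of_mem h]
      have hξ : 4 * Real.pi ^ 2 * ‖ξ‖ ^ 2 ≤ X := by
        rw [mem_ball_zero_iff] at h
        rw [hX]; gcongr
      set z : ℂ := ((-(4 * Real.pi ^ 2 * t * ‖ξ‖ ^ 2) : ℝ) : ℂ) * Complex.I with hz
      have hzn : ‖z‖ ≤ X * |t| := by
        rw [hz, norm_mul, Complex.norm_I, mul_one, Complex.norm_real, norm_neg, Real.norm_eq_abs]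
        rw [show 4 * Real.pi ^ 2 * t * ‖ξ‖ ^ 2 = (4 * Real.pi ^ 2 * ‖ξ‖ ^ 2) * t by ring, abs_mul,
          abs_of_nonneg (by positivity)]
        gcongr
      have hz1 : ‖z‖ ≤ 1 := hzn.trans (by nlinarith [abs_nonneg t])
      have e : Complex.exp z * (𝓕 f : L2 m) ξ - (𝓕 f : L2 m) ξ +
          ((t : ℂ) * Complex.I) • (((4 * Real.pi ^ 2 * ‖ξ‖ ^ 2 : ℝ) : ℂ) * (𝓕 f : L2 m) ξ) =
          (Complex.exp z - 1 - z) * (𝓕 f : L2 m) ξ := by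
        rw [hz, smul_eq_mul]; push_cast; ring
      rw [e, norm_mul]
      gcongr
      calc _ ≤ ‖z‖ ^ 2 := Complex.norm_exp_sub_one_sub_id_le hz1
        _ ≤ (X * |t|) ^ 2 := by gcongr
        _ = X ^ 2 * t ^ 2 := by rw [mul_pow, sq_abs]
    · rw [Set.indicator_of_notMem h, Set.indicator_of_notMem h]
      simp only [mul_zero, sub_zero, smul_zero, add_zero, norm_zero]
      positivity
  rw [hasDerivAt_iff_tendsto_slope_zero, tendsto_iff_norm_sub_tendsto_zero]
  have hsq : Tendsto (fun t : ℝ => X ^ 2 * |t| * ‖f‖) (𝓝[≠] 0) (𝓝 0) := by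
    have : Tendsto (fun t : ℝ => X ^ 2 * |t| * ‖f‖) (𝓝 0) (𝓝 (X ^ 2 * |0| * ‖f‖)) :=
      (by fun_prop : Continuous fun t : ℝ => X ^ 2 * |t| * ‖f‖).tendsto 0
    simp only [abs_zero, mul_zero, zero_mul] at this
    exact this.mono_left nhdsWithin_le_nhds
  have hsmall : ∀ᶠ t : ℝ in 𝓝[≠] 0, |t| * (X + 1) < 1 := by
    have : Tendsto (fun t : ℝ => |t| * (X + 1)) (𝓝 0) (𝓝 (|0| * (X + 1))) :=
      (by fun_prop : Continuous fun t : ℝ => |t| * (X + 1)).tendsto 0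
    rw [abs_zero, zero_mul] at this
    exact (this.mono_left nhdsWithin_le_nhds).eventually_lt_const one_pos
  refine squeeze_zero' (Eventually.of_forall fun _ => norm_nonneg _) ?_ hsq
  filter_upwards [hsmall, self_mem_nhdsWithin] with t ht ht0
  have ht0' : t ≠ 0 := ht0
  rw [zero_add, freeE_zero, sub_neg_eq_add]
  have e : t⁻¹ • (freeE t (lowPass R f) - lowPass R f) + Complex.I • lowLap R f =
      t⁻¹ • (freeE t (lowPass R f) - lowPass R f + t • (Complex.I • lowLap R f)) := by
    rw [smul_add, inv_smul_smul₀ ht0']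
  rw [e, norm_smul, norm_inv, Real.norm_eq_abs]
  calc |t|⁻¹ * ‖_‖ ≤ |t|⁻¹ * (X ^ 2 * t ^ 2 * ‖f‖) := by gcongr; exact key t ht.le
    _ = X ^ 2 * |t| * ‖f‖ := by
      have : |t| ≠ 0 := abs_ne_zero.2 ht0'
      rw [← sq_abs t]; field_simp

theorem lowLap_lowPass_of_le {R S : ℝ} (h : R ≤ S) (f : L2 m) :
    lowLap S (lowPass R f) = lowLap R f := by
  refine fourier_injective (Lp.ext ?_)
  filter_upwards [coeFn_fourier_lowLap S (lowPass R f), coeFn_fourier_lowPass R f,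
    coeFn_fourier_lowLap R f] with ξ h1 h2 h3
  rw [h1, h3]
  by_cases hR : ξ ∈ Metric.ball (0 : Sp m) R
  · rw [Set.indicator_of_mem hR, Set.indicator_of_mem (Metric.ball_subset_ball h hR), h2,
      Set.indicator_of_mem hR]
  · rw [Set.indicator_of_notMem hR]
    by_cases hS : ξ ∈ Metric.ball (0 : Sp m) S
    · rw [Set.indicator_of_mem hS, h2, Set.indicator_of_notMem hR, mul_zero]
    · rw [Set.indicator_of_notMem hS]

theorem potMul_re (V : LInf m) (f : L2 m) :
    (inner ℂ f (potMul V f)).re = ∫ x, V x * ‖f x‖ ^ 2 := by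
  rw [inner_potMul_eq_integral, Complex.ofReal_re]

theorem energyNormSq_eq (V : LInf m) (f : L2 m) :
    energyNormSq V f = gradNormSq f + (inner ℂ f (potMul V f)).re := by
  rw [energyNormSq, potMul_re]

/-- Energy conservation for frequency-localized data. -/
theorem energyNormSq_flowE_lowPass (V : LInf m) (t R : ℝ) (f₀ : L2 m) :
    dirichlet (flowE V t (lowPass R f₀)) < ⊤ ∧
      energyNormSq V (flowE V t (lowPass R f₀)) = energyNormSq V (lowPass R f₀) := by
  set f := lowPass R f₀ with hf
  set u := flowE V t f with hu
  set g : L2 m := -(Complex.I • (lowLap R f₀ + potMul V f)) with hg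
  have hder0 : HasDerivAt (fun s => flowE V s f) g 0 := by
    have h1 := (isMild_flow V f).hasDerivAt_sub.add (hasDerivAt_freeE_lowPass R f₀)
    have e : (fun s => flowE V s f) =
        ((fun t => flow V t f - (freeGroup m).U t f) + fun t => freeE t (lowPass R f₀)) := by
      ext1 s
      simp only [Pi.add_apply]
      change flow V s f = flow V s f - freeE s f + freeE s f
      rw [sub_add_cancel]
    rw [e]
    refine h1.congr_deriv ?_
    rw [hg, smul_add, neg_add, add_comm]
  have hderu : HasDerivAt (fun s => flowE V s u) (flowE V t g) 0 := by
    have h1 := UnitaryGroup.hasDerivAt_map (flowE V t) hder0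
    refine h1.congr_of_eventuallyEq (Eventually.of_forall fun s => ?_)
    simp only [hu]
    rw [← flowE_add, ← flowE_add, add_comm s t]
  -- The full orbit of `u` is differentiable at `0` because that of `f` is. The bounded potential
  -- changes the derivative only by `-i V u`, so the free orbit of `u` is differentiable as well,
  -- with derivative `k`.
  set k : L2 m := flowE V t g + Complex.I • potMul V u with hk
  have hfree : HasDerivAt (fun s => freeE s u) k 0 := by
    have h1 := hderu.sub (isMild_flow V u).hasDerivAt_sub
    rw [sub_neg_eq_add] at h1
    have e : (fun s => freeE s u) =
        ((fun s => flowE V s u) - fun t => flow V t u - (freeGroup m).U t u) := by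
      ext1 s
      simp only [Pi.sub_apply]
      change freeE s u = flow V s u - (flow V s u - freeE s u)
      rw [sub_sub_cancel]
    rw [e]
    exact h1
  -- Below every cutoff `k` agrees with `-i (-Δ) u`. The truncated Dirichlet forms of `u` therefore
  -- converge, which yields both `u ∈ H¹` and the value of its gradient norm.
  have hPk : ∀ S : ℝ, lowPass S k = -(Complex.I • lowLap S u) := fun S => by
    have h1 : HasDerivAt (fun s => lowPass S (freeE s u)) (lowPass S k) 0 :=
      ((lowPass S : L2 m →L[ℂ] L2 m).restrictScalars ℝ).hasFDerivAt.comp_hasDerivAt 0 hfree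
    have h2 := hasDerivAt_freeE_lowPass S u
    refine h1.unique (h2.congr_of_eventuallyEq (Eventually.of_forall fun s => ?_))
    exact fMul_freeE _ _ _
  have hlim : Tendsto (fun n : ℕ => (inner ℂ u (lowLap (n : ℝ) u)).re) atTop
      (𝓝 (inner ℂ u (Complex.I • k)).re) := by
    have h1 : Tendsto (fun n : ℕ => (inner ℂ u (Complex.I • lowPass (n : ℝ) k)).re) atTop
        (𝓝 (inner ℂ u (Complex.I • k)).re) := by
      have h2 := (tendsto_lowPass k).const_smul Complex.I
      exact (Complex.continuous_re.tendsto _).comp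
        (((continuous_const.inner continuous_id).tendsto _).comp h2)
    refine h1.congr fun n => ?_
    rw [hPk, smul_neg, smul_smul, Complex.I_mul_I, neg_one_smul, neg_neg]
  have hlimf : Tendsto (fun n : ℕ => (inner ℂ f (lowLap (n : ℝ) f)).re) atTop
      (𝓝 (inner ℂ f (lowLap R f₀)).re) := by
    refine tendsto_const_nhds.congr' ?_
    filter_upwards [eventually_ge_atTop ⌈R⌉₊] with n hn
    rw [hf, lowLap_lowPass_of_le (Nat.ceil_le.1 hn)]
  obtain ⟨hD, hDe⟩ := dirichlet_of_tendsto hlim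
  obtain ⟨-, hfe⟩ := dirichlet_of_tendsto hlimf
  refine ⟨hD, ?_⟩
  rw [energyNormSq_eq, energyNormSq_eq, hDe, hfe]
  have e1 : Complex.I • k = flowE V t (lowLap R f₀ + potMul V f) - potMul V u := by
    rw [hk, hg, smul_add, smul_smul, Complex.I_mul_I, neg_one_smul, map_neg, map_smul, smul_neg,
      smul_smul, Complex.I_mul_I, neg_one_smul, neg_neg, sub_eq_add_neg]
  rw [e1, inner_sub_right, Complex.sub_re, sub_add_cancel, hu, LinearIsometryEquiv.inner_map_map,
    inner_add_right, Complex.add_re]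

theorem tendsto_energy_pot (V : LInf m) {ι : Type*} {l : Filter ι} {u : ι → L2 m} {f : L2 m}
    (h : Tendsto u l (𝓝 f)) :
    Tendsto (fun n => (inner ℂ (u n) (potMul V (u n))).re) l (𝓝 (inner ℂ f (potMul V f)).re) :=
  (Complex.continuous_re.tendsto _).comp
    (((continuous_id.inner (potMul V).continuous).tendsto f).comp h)

theorem gradNormSq_lowPass_le {f : L2 m} (hf : dirichlet f < ⊤) (R : ℝ) :
    dirichlet (lowPass R f) < ⊤ ∧ gradNormSq (lowPass R f) ≤ gradNormSq f := by
  have hlimf : Tendsto (fun n : ℕ => (inner ℂ (lowPass R f) (lowLap (n : ℝ) (lowPass R f))).re) atTop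
      (𝓝 (inner ℂ (lowPass R f) (lowLap R f)).re) := by
    refine tendsto_const_nhds.congr' ?_
    filter_upwards [eventually_ge_atTop ⌈R⌉₊] with n hn
    rw [lowLap_lowPass_of_le (Nat.ceil_le.1 hn)]
  obtain ⟨h1, h2⟩ := dirichlet_of_tendsto hlimf
  refine ⟨h1, ?_⟩
  rw [h2]
  have e : (inner ℂ (lowPass R f) (lowLap R f) : ℂ) = inner ℂ f (lowLap R f) := by
    rw [lowPass, inner_fMul_left, lowLap, fMul_comm]
    change inner ℂ f (lowLap R (lowPass R f)) = inner ℂ f (lowLap R f)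
    rw [lowLap_lowPass_of_le le_rfl]
  rw [e]
  exact re_inner_lowLap_le hf R

/-- Weak lower semicontinuity of the Dirichlet integral. -/
theorem dirichlet_of_weakTendsto {ι : Type*} {l : Filter ι} [l.NeBot] {u : ι → L2 m} {f : L2 m}
    (h : WeakTendsto u l f) {M : ℝ}
    (hM : ∀ᶠ n in l, dirichlet (u n) < ⊤ ∧ gradNormSq (u n) ≤ M) :
    dirichlet f < ⊤ ∧ gradNormSq f ≤ M := by
  refine dirichlet_of_le fun N => ?_
  set T : L2 m →L[ℂ] L2 m := lowLap (N : ℝ) with hT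
  have h1 : Tendsto (fun n => (inner ℂ f (T (u n))).re) l (𝓝 (inner ℂ f (T f)).re) := by
    have := h (T f)
    simp only [hT, lowLap, inner_fMul_left] at this ⊢
    exact (Complex.continuous_re.tendsto _).comp this
  have hsym : ∀ x y : L2 m, (inner ℂ (T x) y : ℂ) = inner ℂ x (T y) := fun x y => by
    rw [hT, lowLap, inner_fMul_left]
  -- Positivity of the form at `y - x` bounds the quadratic expression from below by one affine in
  -- `y`, which passes to weak limits.
  have hineq : ∀ x y : L2 m, 2 * (inner ℂ x (T y)).re - (inner ℂ x (T x)).re ≤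
      (inner ℂ y (T y)).re := fun x y => by
    have h2 := re_inner_lowLap_nonneg (N : ℝ) (y - x)
    rw [← hT] at h2
    have h3 : (inner ℂ y (T x)).re = (inner ℂ x (T y)).re := by
      rw [← hsym, ← inner_conj_symm, Complex.conj_re]
    simp only [map_sub, inner_sub_left, inner_sub_right, Complex.sub_re, h3] at h2
    linarith
  have h4 : Tendsto (fun n => 2 * (inner ℂ f (T (u n))).re - (inner ℂ f (T f)).re) l
      (𝓝 (inner ℂ f (T f)).re) := by
    have := (h1.const_mul 2).sub_const (inner ℂ f (T f)).re
    rwa [two_mul, add_sub_cancel_right] at this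
  refine le_of_tendsto h4 ?_
  filter_upwards [hM] with n hn
  exact (hineq f (u n)).trans ((re_inner_lowLap_le hn.1 _).trans hn.2)

/-- Band-limited approximations conserve the energy. In the limit the potential part converges,
while the gradient part is only lower semicontinuous; this is why an inequality comes first. -/
theorem energyNormSq_flowE_le (V : LInf m) (t : ℝ) {f : L2 m} (hf : dirichlet f < ⊤) :
    dirichlet (flowE V t f) < ⊤ ∧ energyNormSq V (flowE V t f) ≤ energyNormSq V f := by
  have hconv := tendsto_lowPass f
  have hconv' : Tendsto (fun n : ℕ => flowE V t (lowPass (n : ℝ) f)) atTop (𝓝 (flowE V t f)) :=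
    ((flowE V t).continuous.tendsto f).comp hconv
  have hweak : WeakTendsto (fun n : ℕ => flowE V t (lowPass (n : ℝ) f)) atTop (flowE V t f) :=
    fun g => ((continuous_const.inner continuous_id).tendsto _).comp hconv'
  have hp1 := tendsto_energy_pot V hconv
  have hp2 := tendsto_energy_pot V hconv'
  have hgrad : ∀ n : ℕ, dirichlet (flowE V t (lowPass (n : ℝ) f)) < ⊤ ∧
      gradNormSq (flowE V t (lowPass (n : ℝ) f)) ≤ gradNormSq f +
        ((inner ℂ (lowPass (n : ℝ) f) (potMul V (lowPass (n : ℝ) f))).re -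
        (inner ℂ (flowE V t (lowPass (n : ℝ) f))
          (potMul V (flowE V t (lowPass (n : ℝ) f)))).re) := fun n => by
    obtain ⟨h1, h2⟩ := energyNormSq_flowE_lowPass V t n f
    refine ⟨h1, ?_⟩
    rw [energyNormSq_eq, energyNormSq_eq] at h2
    have := (gradNormSq_lowPass_le hf n).2
    linarith
  have hlim := (hp1.sub hp2).const_add (gradNormSq f)
  set L := gradNormSq f + ((inner ℂ f (potMul V f)).re -
    (inner ℂ (flowE V t f) (potMul V (flowE V t f))).re) with hL
  have hbd : ∀ ε > 0, dirichlet (flowE V t f) < ⊤ ∧ gradNormSq (flowE V t f) ≤ L + ε := by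
    intro ε hε
    refine dirichlet_of_weakTendsto hweak ?_
    filter_upwards [hlim.eventually_le_const (show L < L + ε by linarith)] with n hn
    exact ⟨(hgrad n).1, (hgrad n).2.trans hn⟩
  refine ⟨(hbd 1 one_pos).1, ?_⟩
  have := le_of_forall_pos_le_add fun ε hε => (hbd ε hε).2
  rw [energyNormSq_eq, energyNormSq_eq]
  linarith

theorem dirichlet_flowE (V : LInf m) (t : ℝ) {f : L2 m} (hf : dirichlet f < ⊤) :
    dirichlet (flowE V t f) < ⊤ := (energyNormSq_flowE_le V t hf).1

/-- The propagator preserves the energy norm. -/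
theorem energyNormSq_flowE (V : LInf m) (t : ℝ) {f : L2 m} (hf : dirichlet f < ⊤) :
    energyNormSq V (flowE V t f) = energyNormSq V f := by
  refine le_antisymm (energyNormSq_flowE_le V t hf).2 ?_
  -- Running the flow backwards turns the inequality into an equality.
  have := (energyNormSq_flowE_le V (-t) (dirichlet_flowE V t hf)).2
  rwa [flowE_neg_apply] at this

theorem dirichlet_transE (z : Sp m) (f : L2 m) : dirichlet (transE z f) = dirichlet f := by
  refine lintegral_congr_ae ?_
  filter_upwards [coeFn_fourier_transE z f] with ξ h
  rw [h, enorm_mul]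
  congr 2
  rw [← ofReal_norm, Complex.norm_exp_ofReal_mul_I, ENNReal.ofReal_one, one_mul]

theorem gradNormSq_transE (z : Sp m) {f : L2 m} (hf : dirichlet f < ⊤) :
    gradNormSq (transE z f) = gradNormSq f := by
  rw [gradNormSq_eq hf, gradNormSq_eq ((dirichlet_transE z f).trans_lt hf), dirichlet_transE]

theorem dirichlet_add {f g : L2 m} (hf : dirichlet f < ⊤) (hg : dirichlet g < ⊤) :
    dirichlet (f + g) < ⊤ := by
  rw [← memH1_iff] at *
  have := TemperedDistribution.MemSobolev.add hf hg
  have e : ((f + g : L2 m) : 𝓢'(Sp m, ℂ)) = (f : 𝓢'(Sp m, ℂ)) + (g : 𝓢'(Sp m, ℂ)) :=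
    (Lp.toTemperedDistributionCLM ℂ (volume : Measure (Sp m)) 2).map_add f g
  rw [MemH1, e]; exact this

theorem dirichlet_neg (f : L2 m) : dirichlet (-f) = dirichlet f := by
  refine lintegral_congr_ae ?_
  have : (𝓕 (-f) : L2 m) = -𝓕 f := (fourE m).map_neg f
  rw [this]
  filter_upwards [Lp.coeFn_neg (𝓕 f : L2 m)] with ξ h
  rw [h, Pi.neg_apply, enorm_neg]

end

noncomputable section

/-! ### Real interpolation -/

theorem lintegral_rpow_Ioc {s w : ℝ} (hs : 0 < s) (hw : 0 ≤ w) :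
    ∫⁻ t in Set.Ioc 0 w, ENNReal.ofReal (t ^ (s - 1)) = ENNReal.ofReal (w ^ s / s) := by
  have hi : IntervalIntegrable (fun t : ℝ => t ^ (s - 1)) volume 0 w :=
    intervalIntegral.intervalIntegrable_rpow' (by linarith)
  have h1 : ∫ t in (0 : ℝ)..w, t ^ (s - 1) = w ^ s / s := by
    rw [integral_rpow (Or.inl (by linarith)), sub_add_cancel, Real.zero_rpow hs.ne', sub_zero]
  rw [← h1, intervalIntegral.integral_of_le hw, ofReal_integral_eq_lintegral_ofReal]
  · exact (intervalIntegrable_iff_integrableOn_Ioc_of_le hw).1 hi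
  · filter_upwards [ae_restrict_mem measurableSet_Ioc] with t ht
    exact Real.rpow_nonneg ht.1.le _

/-- A weak-type bound at all heights whose right-hand side is the tail of a weighted integral gives
a strong bound. -/
theorem lintegral_rpow_le_of_meas_le {X Y E : Type*} [MeasurableSpace X] [MeasurableSpace Y]
    [NormedAddCommGroup E] {μ : Measure X} {ν : Measure Y} [SFinite ν] {f : X → E}
    (hf : AEStronglyMeasurable f μ) {g : Y → ℝ≥0∞} (hg : AEMeasurable g ν) {w : Y → ℝ}
    (hw : Measurable w) (hw0 : ∀ y, 0 ≤ w y) {q : ℝ} (hq : 2 < q)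
    (h : ∀ t : ℝ, 0 < t → μ {x | t < ‖f x‖} ≤
      ENNReal.ofReal (4 / t ^ 2) * ∫⁻ y in {y | t ≤ w y}, g y ∂ν) :
    ∫⁻ x, ‖f x‖ₑ ^ q ∂μ ≤
      ENNReal.ofReal (4 * q / (q - 2)) * ∫⁻ y, g y * ENNReal.ofReal (w y ^ (q - 2)) ∂ν := by
  have hq0 : 0 < q := by linarith
  have h1 : ∫⁻ x, ‖f x‖ₑ ^ q ∂μ = ∫⁻ x, ENNReal.ofReal (‖f x‖ ^ q) ∂μ := by
    refine lintegral_congr fun x => ?_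
    rw [← ofReal_norm, ENNReal.ofReal_rpow_of_nonneg (norm_nonneg _) hq0.le]
  rw [h1, lintegral_rpow_eq_lintegral_meas_lt_mul μ (Eventually.of_forall fun x => norm_nonneg _)
    hf.norm.aemeasurable hq0]
  -- In the layer-cake formula the factor `4 / t²` lowers the power of `t` to `q - 3`. After Tonelli
  -- the integral over `0 < t ≤ w y` converges because `q > 2`, and it produces the weight `w y ^ (q
  -- - 2)`.
  have h2 : ∀ t ∈ Set.Ioi (0 : ℝ), μ {a | t < ‖f a‖} * ENNReal.ofReal (t ^ (q - 1)) ≤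
      ∫⁻ y, {p : ℝ × Y | p.1 ≤ w p.2}.indicator
        (fun p => ENNReal.ofReal (4 * p.1 ^ (q - 2 - 1)) * g p.2) (t, y) ∂ν := by
    intro t ht
    have ht : 0 < t := ht
    have e : ∀ y, {p : ℝ × Y | p.1 ≤ w p.2}.indicator
        (fun p => ENNReal.ofReal (4 * p.1 ^ (q - 2 - 1)) * g p.2) (t, y) =
        ENNReal.ofReal (4 * t ^ (q - 2 - 1)) * {y | t ≤ w y}.indicator g y := fun y => by
      by_cases hy : t ≤ w y
      · rw [Set.indicator_of_mem (by exact hy), Set.indicator_of_mem (by exact hy)]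
      · rw [Set.indicator_of_notMem (by exact hy), Set.indicator_of_notMem (by exact hy), mul_zero]
    simp only [e]
    rw [lintegral_const_mul' _ _ ENNReal.ofReal_ne_top,
      lintegral_indicator (measurableSet_le measurable_const hw)]
    calc _ ≤ (ENNReal.ofReal (4 / t ^ 2) * ∫⁻ y in {y | t ≤ w y}, g y ∂ν) *
          ENNReal.ofReal (t ^ (q - 1)) := by gcongr; exact h t ht
      _ = _ := by
          rw [mul_right_comm, ← ENNReal.ofReal_mul (by positivity)]
          congr 2
          rw [show q - 2 - 1 = (q - 1) - 2 by ring, Real.rpow_sub ht (q - 1) 2, Real.rpow_two]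
          ring
  have hmeas : AEMeasurable ({p : ℝ × Y | p.1 ≤ w p.2}.indicator
        (fun p => ENNReal.ofReal (4 * p.1 ^ (q - 2 - 1)) * g p.2))
        ((volume.restrict (Set.Ioi (0 : ℝ))).prod ν) := by
    refine AEMeasurable.indicator ?_ (measurableSet_le measurable_fst (hw.comp measurable_snd))
    refine AEMeasurable.mul ?_ hg.comp_snd
    exact Measurable.aemeasurable (by fun_prop)
  calc _ ≤ ENNReal.ofReal q * ∫⁻ t in Set.Ioi (0 : ℝ),
        ∫⁻ y, {p : ℝ × Y | p.1 ≤ w p.2}.indicator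
        (fun p => ENNReal.ofReal (4 * p.1 ^ (q - 2 - 1)) * g p.2) (t, y) ∂ν := by
        gcongr ENNReal.ofReal q * ?_
        exact setLIntegral_mono' measurableSet_Ioi h2
    _ = ENNReal.ofReal q * ∫⁻ y, (∫⁻ t in Set.Ioi (0 : ℝ),
        {p : ℝ × Y | p.1 ≤ w p.2}.indicator
        (fun p => ENNReal.ofReal (4 * p.1 ^ (q - 2 - 1)) * g p.2) (t, y)) ∂ν := by
        congr 1
        exact lintegral_lintegral_swap (f := fun t y => {p : ℝ × Y | p.1 ≤ w p.2}.indicator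
          (fun p => ENNReal.ofReal (4 * p.1 ^ (q - 2 - 1)) * g p.2) (t, y)) hmeas
    _ = ENNReal.ofReal q * ∫⁻ y, ENNReal.ofReal (4 / (q - 2)) *
          (g y * ENNReal.ofReal (w y ^ (q - 2))) ∂ν := by
        congr 1
        refine lintegral_congr fun y => ?_
        have e : ∀ t, {p : ℝ × Y | p.1 ≤ w p.2}.indicator
            (fun p => ENNReal.ofReal (4 * p.1 ^ (q - 2 - 1)) * g p.2) (t, y) =
            (Set.Iic (w y)).indicator
              (fun t => g y * (ENNReal.ofReal 4 * ENNReal.ofReal (t ^ (q - 2 - 1)))) t :=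
          fun t => by
          by_cases hy : t ≤ w y
          · rw [Set.indicator_of_mem (by exact hy), Set.indicator_of_mem (by exact hy), mul_comm,
              ENNReal.ofReal_mul (by norm_num)]
          · rw [Set.indicator_of_notMem (by exact hy), Set.indicator_of_notMem (by exact hy)]
        simp only [e]
        rw [lintegral_indicator measurableSet_Iic, Measure.restrict_restrict measurableSet_Iic,
          Set.inter_comm, Set.Ioi_inter_Iic, lintegral_const_mul _ (by fun_prop),
          lintegral_const_mul _ (by fun_prop), lintegral_rpow_Ioc (by linarith) (hw0 y),
          ← ENNReal.ofReal_mul (by norm_num), mul_left_comm, ← ENNReal.ofReal_mul (by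
            exact div_nonneg (by norm_num) (by linarith))]
        congr 2
        ring
    _ = _ := by
        rw [lintegral_const_mul' _ _ ENNReal.ofReal_ne_top, ← mul_assoc,
          ← ENNReal.ofReal_mul hq0.le]
        congr 2; ring

variable {m : ℕ}

/-- Where `‖f‖ > t` the part `g` accounts for at most half, so `‖h‖ ≥ t / 2`, and Chebyshev applies
in `L²`. Used with a splitting that depends on the height `t`. -/
theorem meas_lt_norm_le_of_add {f g h : Sp m → ℂ} (hfgh : ∀ᵐ x, f x = g x + h x) {t : ℝ}
    (ht : 0 < t) (hg : ∀ᵐ x, ‖g x‖ ≤ t / 2) (hh : AEStronglyMeasurable h volume) :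
    volume {x | t < ‖f x‖} ≤ ENNReal.ofReal (4 / t ^ 2) * ∫⁻ x, ‖h x‖ₑ ^ 2 := by
  have h1 : volume {x | t < ‖f x‖} ≤ volume {x | ENNReal.ofReal (t ^ 2 / 4) ≤ ‖h x‖ₑ ^ 2} := by
    refine measure_mono_ae ?_
    filter_upwards [hfgh, hg] with x hx hgx hfx
    have hfx : t < ‖f x‖ := hfx
    change ENNReal.ofReal (t ^ 2 / 4) ≤ ‖h x‖ₑ ^ 2
    rw [← ofReal_norm, ← ENNReal.ofReal_pow (norm_nonneg _)]
    refine ENNReal.ofReal_le_ofReal ?_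
    rw [hx] at hfx
    have := norm_add_le (g x) (h x)
    have h3 : t / 2 ≤ ‖h x‖ := by linarith
    calc t ^ 2 / 4 = (t / 2) ^ 2 := by ring
      _ ≤ _ := by gcongr
  refine h1.trans ?_
  have h2 := mul_meas_ge_le_lintegral₀ (μ := volume) (hh.enorm.pow_const 2)
    (ENNReal.ofReal (t ^ 2 / 4))
  have ht4 : 0 < t ^ 2 / 4 := by positivity
  calc volume {x | ENNReal.ofReal (t ^ 2 / 4) ≤ ‖h x‖ₑ ^ 2}
      = ENNReal.ofReal (4 / t ^ 2) * (ENNReal.ofReal (t ^ 2 / 4) *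
        volume {x | ENNReal.ofReal (t ^ 2 / 4) ≤ ‖h x‖ₑ ^ 2}) := by
        rw [← mul_assoc, ← ENNReal.ofReal_mul (by positivity)]
        have : 4 / t ^ 2 * (t ^ 2 / 4) = 1 := by field_simp
        rw [this, ENNReal.ofReal_one, one_mul]
    _ ≤ _ := by gcongr

/-! ### Sobolev embedding -/

/-- The restriction of `f` to the frequencies in `A`. -/
def freqRestrict (A : Set (Sp m)) (hA : MeasurableSet A) (f : L2 m) : L2 m :=
  𝓕⁻ (((Lp.memLp (𝓕 f : L2 m)).indicator hA).toLp _ : L2 m)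

theorem coeFn_fourier_freqRestrict {A : Set (Sp m)} (hA : MeasurableSet A) (f : L2 m) :
    (𝓕 (freqRestrict A hA f) : L2 m) =ᵐ[volume] A.indicator (𝓕 f : L2 m) := by
  rw [freqRestrict, FourierTransform.fourier_fourierInv_eq]
  exact MemLp.coeFn_toLp _

theorem norm_freqRestrict_le {A : Set (Sp m)} (hA : MeasurableSet A) (f : L2 m) {B : ℝ}
    (h : ∫⁻ ξ in A, ‖(𝓕 f : L2 m) ξ‖ₑ ≤ ENNReal.ofReal B) (hB : 0 ≤ B) :
    ∀ᵐ x, ‖freqRestrict A hA f x‖ ≤ B := by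
  set G : L2 m := ((Lp.memLp (𝓕 f : L2 m)).indicator hA).toLp _ with hG
  have hGae : G =ᵐ[volume] A.indicator (𝓕 f : L2 m) := MemLp.coeFn_toLp _
  have hlin : ∫⁻ ξ, ‖G ξ‖ₑ ≤ ENNReal.ofReal B := by
    rw [← lintegral_indicator hA] at h
    refine le_trans (le_of_eq (lintegral_congr_ae ?_)) h
    filter_upwards [hGae] with ξ hξ
    rw [hξ, enorm_indicator_eq_indicator_enorm]
  have hint : Integrable G volume :=
    ⟨Lp.aestronglyMeasurable G, hlin.trans_lt ENNReal.ofReal_lt_top⟩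
  filter_upwards [coeFn_fourierInv_of_integrable G hint] with x hx
  change ‖(𝓕⁻ G : L2 m) x‖ ≤ B
  rw [hx]
  refine (norm_fourierInv_le_integral _ _).trans ?_
  rw [integral_norm_eq_lintegral_enorm hint.1]
  exact ENNReal.toReal_le_of_le_ofReal hB hlin

theorem lintegral_enorm_freqRestrict_compl {A : Set (Sp m)} (hA : MeasurableSet A) (f : L2 m) :
    ∫⁻ x, ‖(f - freqRestrict A hA f) x‖ₑ ^ 2 = ∫⁻ ξ in Aᶜ, ‖(𝓕 f : L2 m) ξ‖ₑ ^ 2 := by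
  rw [← L2.enorm_sq_eq_lintegral, ← ofReal_norm, ← Lp.norm_fourier_eq, ofReal_norm,
    L2.enorm_sq_eq_lintegral, ← lintegral_indicator hA.compl]
  refine lintegral_congr_ae ?_
  filter_upwards [coeFn_fourier_sub f (freqRestrict A hA f), coeFn_fourier_freqRestrict hA f]
    with ξ h1 h2
  rw [h1, h2]
  by_cases h : ξ ∈ A
  · rw [Set.indicator_of_mem h, sub_self, Set.indicator_of_notMem (by simpa using h)]; simp
  · rw [Set.indicator_of_notMem h, sub_zero, Set.indicator_of_mem (by simpa using h)]

theorem lintegral_weight_le {f : L2 m} (hf : dirichlet f < ⊤) {N : ℝ}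
    (hN : ‖f‖ ^ 2 + gradNormSq f ≤ N ^ 2) :
    ∫⁻ ξ : Sp m, ENNReal.ofReal ((1 + ‖ξ‖) ^ 2) * ‖(𝓕 f : L2 m) ξ‖ₑ ^ 2 ≤
      ENNReal.ofReal (2 * N ^ 2) := by
  have h1 : ∀ ξ : Sp m, ENNReal.ofReal ((1 + ‖ξ‖) ^ 2) * ‖(𝓕 f : L2 m) ξ‖ₑ ^ 2 ≤
      2 * (‖(𝓕 f : L2 m) ξ‖ₑ ^ 2 + ‖ξ‖ₑ ^ 2 * ‖(𝓕 f : L2 m) ξ‖ₑ ^ 2) := fun ξ => by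
    have : ENNReal.ofReal ((1 + ‖ξ‖) ^ 2) ≤ 2 * (1 + ‖ξ‖ₑ ^ 2) := by
      have h2 : 2 * (1 + ‖ξ‖ₑ ^ 2) = ENNReal.ofReal (2 * (1 + ‖ξ‖ ^ 2)) := by
        rw [ENNReal.ofReal_mul (by norm_num), ENNReal.ofReal_add (by norm_num) (by positivity),
          ENNReal.ofReal_pow (norm_nonneg _), ofReal_norm, ENNReal.ofReal_one,
          ENNReal.ofReal_ofNat]
      rw [h2]
      refine ENNReal.ofReal_le_ofReal ?_
      nlinarith [sq_nonneg (1 - ‖ξ‖)]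
    calc _ ≤ 2 * (1 + ‖ξ‖ₑ ^ 2) * ‖(𝓕 f : L2 m) ξ‖ₑ ^ 2 := by gcongr
      _ = _ := by ring
  refine (lintegral_mono h1).trans ?_
  rw [lintegral_const_mul' _ _ (by norm_num),
    lintegral_add_left' ((Lp.aestronglyMeasurable _).enorm.pow_const 2),
    ← L2.enorm_sq_eq_lintegral, ← ofReal_norm, Lp.norm_fourier_eq]
  change 2 * (ENNReal.ofReal ‖f‖ ^ 2 + dirichlet f) ≤ _
  have h2 : dirichlet f ≤ ENNReal.ofReal (gradNormSq f) := by
    rw [ofReal_gradNormSq hf]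
    refine le_mul_of_one_le_left' ?_
    rw [ENNReal.one_le_ofReal]
    nlinarith [Real.pi_gt_three]
  calc _ ≤ 2 * (ENNReal.ofReal ‖f‖ ^ 2 + ENNReal.ofReal (gradNormSq f)) := by gcongr
    _ = ENNReal.ofReal (2 * (‖f‖ ^ 2 + gradNormSq f)) := by
      rw [← ENNReal.ofReal_pow (norm_nonneg _), ← ENNReal.ofReal_add (by positivity)
        (gradNormSq_nonneg f), ENNReal.ofReal_mul (by norm_num)]; norm_num
    _ ≤ _ := ENNReal.ofReal_le_ofReal (by linarith)

/-- A Sobolev inequality with weights on the Fourier side. -/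
theorem lintegral_rpow_le_weight {s q : ℝ} (hs : 0 < s) (hsd : ((m + 1 : ℕ) : ℝ) < 2 + 2 * s)
    (hq : 2 < q) : ∃ C : ℝ, 0 ≤ C ∧ ∀ (f : L2 m) (N : ℝ), 0 < N → dirichlet f < ⊤ →
      ‖f‖ ^ 2 + gradNormSq f ≤ N ^ 2 →
      ∫⁻ x, ‖f x‖ₑ ^ q ≤ ENNReal.ofReal (C * N ^ (q - 2)) *
        ∫⁻ ξ : Sp m, ENNReal.ofReal ((1 + ‖ξ‖) ^ (s * (q - 2))) * ‖(𝓕 f : L2 m) ξ‖ₑ ^ 2 := by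
  have hI : Integrable (fun ξ : Sp m => (1 + ‖ξ‖) ^ (-(2 + 2 * s))) :=
    integrable_one_add_norm (by simpa using hsd)
  set I : ℝ := ∫ ξ : Sp m, (1 + ‖ξ‖) ^ (-(2 + 2 * s)) with hIdef
  have hI0 : 0 ≤ I := integral_nonneg fun ξ => by positivity
  -- Cauchy–Schwarz against `(1 + ‖ξ‖)^(-(1+s))`, together with the bound `2 N²` for the weighted
  -- norm, gives `√I · √2 · N`. The `+ 1` only ensures positivity.
  set K : ℝ := Real.sqrt 2 * Real.sqrt I + 1 with hK
  have hK0 : 0 < K := by positivity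
  refine ⟨4 * q / (q - 2) * (2 * K) ^ (q - 2), ?_, fun f N hN hf hfN => ?_⟩
  · have : 0 < q - 2 := by linarith
    positivity
  set w : Sp m → ℝ := fun ξ => 2 * K * N * (1 + ‖ξ‖) ^ s with hw
  have hwm : Measurable w := by
    have : Continuous w := by
      refine continuous_const.mul ?_
      exact Continuous.rpow_const (by fun_prop) fun ξ => Or.inr hs.le
    exact this.measurable
  have key := lintegral_rpow_le_of_meas_le (μ := volume) (ν := (volume : Measure (Sp m)))
    (Lp.aestronglyMeasurable f) (g := fun ξ => ‖(𝓕 f : L2 m) ξ‖ₑ ^ 2)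
    ((Lp.aestronglyMeasurable _).enorm.pow_const 2) hwm (fun ξ => by simp only [hw]; positivity) hq
    (fun t ht => by
      -- The frequency cutoff depends on the height `t`: the part of `f` with frequencies in `A` is
      -- at most `t / 2` pointwise, and the rest is measured in `L²`.
      set A : Set (Sp m) := {ξ | w ξ < t} with hA
      have hAm : MeasurableSet A := measurableSet_lt hwm measurable_const
      have hAc : Aᶜ = {ξ | t ≤ w ξ} := by ext ξ; simp [hA]
      have hlow : ∫⁻ ξ in A, ‖(𝓕 f : L2 m) ξ‖ₑ ≤ ENNReal.ofReal (t / 2) := by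
        have e1 : ∀ ξ ∈ A, ‖(𝓕 f : L2 m) ξ‖ₑ ≤ ENNReal.ofReal (t / (2 * K * N)) *
            (ENNReal.ofReal ((1 + ‖ξ‖) ^ (-(1 + s))) *
              (ENNReal.ofReal (1 + ‖ξ‖) * ‖(𝓕 f : L2 m) ξ‖ₑ)) := fun ξ hξ => by
          have hξ : 2 * K * N * (1 + ‖ξ‖) ^ s < t := hξ
          have h1 : 1 ≤ t / (2 * K * N) * ((1 + ‖ξ‖) ^ (-(1 + s)) * (1 + ‖ξ‖)) := by
            have e : (1 + ‖ξ‖) ^ (-(1 + s)) * (1 + ‖ξ‖) = ((1 + ‖ξ‖) ^ s)⁻¹ := by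
              have h0 : 0 < 1 + ‖ξ‖ := by positivity
              rw [← Real.rpow_neg h0.le]
              nth_rewrite 2 [← Real.rpow_one (1 + ‖ξ‖)]
              rw [← Real.rpow_add h0]; congr 1; ring
            rw [e, ← div_eq_mul_inv, div_div, le_div_iff₀ (by positivity), one_mul]
            exact hξ.le
          rw [← mul_assoc, ← mul_assoc, ← ENNReal.ofReal_mul (by positivity),
            ← ENNReal.ofReal_mul (by positivity)]
          refine le_mul_of_one_le_left' ?_
          rw [ENNReal.one_le_ofReal, mul_assoc]
          exact h1
        calc ∫⁻ ξ in A, ‖(𝓕 f : L2 m) ξ‖ₑ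
            ≤ ∫⁻ ξ in A, ENNReal.ofReal (t / (2 * K * N)) *
            (ENNReal.ofReal ((1 + ‖ξ‖) ^ (-(1 + s))) *
              (ENNReal.ofReal (1 + ‖ξ‖) * ‖(𝓕 f : L2 m) ξ‖ₑ)) := setLIntegral_mono' hAm e1
          _ ≤ ∫⁻ ξ, ENNReal.ofReal (t / (2 * K * N)) *
            (ENNReal.ofReal ((1 + ‖ξ‖) ^ (-(1 + s))) *
              (ENNReal.ofReal (1 + ‖ξ‖) * ‖(𝓕 f : L2 m) ξ‖ₑ)) := setLIntegral_le_lintegral _ _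
          _ = ENNReal.ofReal (t / (2 * K * N)) * ∫⁻ ξ : Sp m,
            (ENNReal.ofReal ((1 + ‖ξ‖) ^ (-(1 + s))) *
              (ENNReal.ofReal (1 + ‖ξ‖) * ‖(𝓕 f : L2 m) ξ‖ₑ)) :=
              lintegral_const_mul' _ _ ENNReal.ofReal_ne_top
          _ ≤ ENNReal.ofReal (t / (2 * K * N)) *
              ((∫⁻ ξ : Sp m, ENNReal.ofReal ((1 + ‖ξ‖) ^ (-(1 + s))) ^ (2 : ℝ)) ^ (1 / (2 : ℝ)) *
              (∫⁻ ξ : Sp m, (ENNReal.ofReal (1 + ‖ξ‖) * ‖(𝓕 f : L2 m) ξ‖ₑ) ^ (2 : ℝ)) ^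
                (1 / (2 : ℝ))) := by
              gcongr
              refine ENNReal.lintegral_mul_le_Lp_mul_Lq _ Real.HolderConjugate.two_two ?_ ?_
              · refine (Continuous.measurable ?_).ennreal_ofReal.aemeasurable
                exact Continuous.rpow_const (by fun_prop) fun ξ => Or.inl (by positivity)
              · exact ((by fun_prop : Continuous fun ξ : Sp m =>
                  1 + ‖ξ‖).measurable.ennreal_ofReal.aemeasurable).mul
                  (Lp.aestronglyMeasurable _).enorm
          _ ≤ ENNReal.ofReal (t / (2 * K * N)) *
              ((ENNReal.ofReal I) ^ (1 / (2 : ℝ)) * (ENNReal.ofReal (2 * N ^ 2)) ^ (1 / (2 : ℝ))) := by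
              gcongr
              · rw [hIdef, ofReal_integral_eq_lintegral_ofReal hI
                  (Eventually.of_forall fun ξ => by positivity)]
                refine le_of_eq (lintegral_congr fun ξ => ?_)
                rw [ENNReal.ofReal_rpow_of_nonneg (by positivity) (by norm_num),
                  ← Real.rpow_mul (by positivity)]
                congr 2; ring
              · refine le_trans (le_of_eq (lintegral_congr fun ξ => ?_)) (lintegral_weight_le hf hfN)
                rw [ENNReal.mul_rpow_of_nonneg _ _ (by norm_num), ENNReal.rpow_two,
                  ENNReal.rpow_two, ENNReal.ofReal_pow (by positivity)]
          _ = ENNReal.ofReal (t / (2 * K * N) * (Real.sqrt I * Real.sqrt (2 * N ^ 2))) := by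
              rw [ENNReal.ofReal_rpow_of_nonneg hI0 (by norm_num),
                ENNReal.ofReal_rpow_of_nonneg (by positivity) (by norm_num),
                ← ENNReal.ofReal_mul (by positivity), ← ENNReal.ofReal_mul (by positivity),
                ← Real.sqrt_eq_rpow, ← Real.sqrt_eq_rpow]
          _ ≤ ENNReal.ofReal (t / 2) := by
              refine ENNReal.ofReal_le_ofReal ?_
              rw [Real.sqrt_mul (by norm_num), Real.sqrt_sq hN.le]
              have e : t / (2 * K * N) * (Real.sqrt I * (Real.sqrt 2 * N)) =
                  t / 2 * ((Real.sqrt 2 * Real.sqrt I) / K) := by field_simp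
              rw [e]
              refine mul_le_of_le_one_right (by positivity) ?_
              rw [div_le_one hK0]; linarith
      have hsm := norm_freqRestrict_le hAm f hlow (by positivity)
      have h4 := meas_lt_norm_le_of_add (f := f) (g := freqRestrict A hAm f)
        (h := (f - freqRestrict A hAm f : L2 m)) (by
          filter_upwards [Lp.coeFn_sub f (freqRestrict A hAm f)] with x hx
          rw [hx]; simp) ht hsm (Lp.aestronglyMeasurable _)
      rw [lintegral_enorm_freqRestrict_compl hAm, hAc] at h4
      exact h4)
  refine key.trans (le_of_eq ?_)
  have hq2 : 0 < q - 2 := by linarith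
  have e : ∀ ξ : Sp m, ‖(𝓕 f : L2 m) ξ‖ₑ ^ 2 * ENNReal.ofReal (w ξ ^ (q - 2)) =
      ENNReal.ofReal ((2 * K) ^ (q - 2) * N ^ (q - 2)) *
        (ENNReal.ofReal ((1 + ‖ξ‖) ^ (s * (q - 2))) * ‖(𝓕 f : L2 m) ξ‖ₑ ^ 2) := fun ξ => by
    simp only [hw]
    rw [Real.mul_rpow (by positivity) (by positivity), Real.mul_rpow (by positivity) hN.le,
      ← Real.rpow_mul (by positivity), ENNReal.ofReal_mul (by positivity)]
    ring
  simp only [e]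
  rw [lintegral_const_mul' _ _ ENNReal.ofReal_ne_top, ← mul_assoc,
    ← ENNReal.ofReal_mul (by positivity), mul_assoc]

/-! ### The functional `∫ |f|^q` -/

/-- `∫ |f|^q` with values in `[0, ∞]`. -/
def lqLint (q : ℝ) (f : L2 m) : ℝ≥0∞ := ∫⁻ x, ‖f x‖ₑ ^ q

theorem eLpNorm_rpow_eq {q : ℝ} (hq : 0 < q) (f : L2 m) :
    eLpNorm f (ENNReal.ofReal q) volume ^ q = lqLint q f := by
  rw [eLpNorm_eq_lintegral_rpow_enorm_toReal (by simpa using hq) ENNReal.ofReal_ne_top,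
    ENNReal.toReal_ofReal hq.le, ← ENNReal.rpow_mul, one_div_mul_cancel hq.ne', ENNReal.rpow_one]
  rfl

theorem eLpNorm_eq_lqLint_rpow {q : ℝ} (hq : 0 < q) (f : L2 m) :
    eLpNorm f (ENNReal.ofReal q) volume = lqLint q f ^ (1 / q) := by
  rw [← eLpNorm_rpow_eq hq, ← ENNReal.rpow_mul, mul_one_div_cancel hq.ne', ENNReal.rpow_one]

theorem lqNormPow_eq {q : ℝ} (hq : 0 < q) (f : L2 m) : lqNormPow q f = (lqLint q f).toReal := by
  rw [lqNormPow, ENNReal.toReal_rpow, eLpNorm_rpow_eq hq]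

theorem lqLint_transE (q : ℝ) (z : Sp m) (f : L2 m) : lqLint q (transE z f) = lqLint q f := by
  have h : lqLint q (transE z f) = ∫⁻ x, ‖f (x - z)‖ₑ ^ q :=
    lintegral_congr_ae (by filter_upwards [coeFn_transE z f] with x hx; rw [hx])
  rw [h]
  exact lintegral_sub_right_eq_self (fun x => ‖f x‖ₑ ^ q) z

/-- The exponents `2 < q < 2d / (d - 2)` with `d = m + 1`. -/
def IsSubcritical (m : ℕ) (q : ℝ) : Prop := 2 < q ∧ ((m : ℝ) - 1) * q < 2 * (m + 1)

/-- `f ∈ H¹` with `‖f‖_{H¹} ≤ N`. -/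
def H1Bound (N : ℝ) (f : L2 m) : Prop := dirichlet f < ⊤ ∧ ‖f‖ ^ 2 + gradNormSq f ≤ N ^ 2

theorem H1Bound.norm_le {N : ℝ} (hN : 0 ≤ N) {f : L2 m} (h : H1Bound N f) : ‖f‖ ≤ N := by
  have := h.2
  have h2 := gradNormSq_nonneg f
  exact abs_le_of_sq_le_sq' (by linarith) hN |>.2

theorem exists_h1Bound {f : L2 m} (hf : dirichlet f < ⊤) : ∃ N, 0 < N ∧ H1Bound N f := by
  refine ⟨‖f‖ + gradNormSq f + 1, ?_, hf, ?_⟩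
  · have := gradNormSq_nonneg f; positivity
  · have := gradNormSq_nonneg f
    nlinarith [norm_nonneg f]

theorem H1Bound.of_fourier_le {N : ℝ} {f g : L2 m} (h : H1Bound N f)
    (hfg : ∀ᵐ ξ, ‖(𝓕 g : L2 m) ξ‖ ≤ ‖(𝓕 f : L2 m) ξ‖) : H1Bound N g := by
  have h1 : dirichlet g ≤ dirichlet f := by
    refine lintegral_mono_ae ?_
    filter_upwards [hfg] with ξ hξ
    have : ‖(𝓕 g : L2 m) ξ‖ₑ ≤ ‖(𝓕 f : L2 m) ξ‖ₑ := enorm_le_iff_norm_le.2 hξ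
    gcongr
  have h2 : ‖g‖ ≤ ‖f‖ := by
    rw [← Lp.norm_fourier_eq g, ← Lp.norm_fourier_eq f]
    exact Lp.norm_le_norm_of_ae_le hfg
  have hg := h1.trans_lt h.1
  refine ⟨hg, le_trans ?_ h.2⟩
  rw [gradNormSq_eq hg, gradNormSq_eq h.1]
  have h3 := ENNReal.toReal_mono h.1.ne h1
  gcongr

theorem H1Bound.transE {N : ℝ} {f : L2 m} (h : H1Bound N f) (z : Sp m) :
    H1Bound N (transE z f) :=
  ⟨by rw [dirichlet_transE]; exact h.1, by
    rw [gradNormSq_transE z h.1, LinearIsometryEquiv.norm_map]; exact h.2⟩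

/-- Strict subcriticality leaves room: the inequality costs only `s (q - 2) < 2` powers of `1 +
‖ξ‖`, and the unused powers turn into decay in the lower frequency threshold `R`. The case `R = 0`
is the Sobolev embedding. -/
theorem lqLint_le_of_fourier_eq_zero {q : ℝ} (hq : IsSubcritical m q) :
    ∃ C δ : ℝ, 0 ≤ C ∧ 0 < δ ∧ ∀ (f : L2 m) (N R : ℝ), 0 < N → 0 ≤ R → H1Bound N f →
      (∀ᵐ ξ, ‖ξ‖ < R → (𝓕 f : L2 m) ξ = 0) →
      lqLint q f ≤ ENNReal.ofReal (C * (1 + R) ^ (-δ) * N ^ q) := by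
  obtain ⟨hq2, hqd⟩ := hq
  have hq0 : 0 < q - 2 := by linarith
  -- The lower bound makes `(1 + ‖ξ‖)^(-(2+2s))` integrable, and the upper one keeps the weight
  -- below that of `H¹`. The interval is nonempty exactly because `q` is subcritical.
  obtain ⟨s, hs1, hs2⟩ : ∃ s, max 0 (((m : ℝ) - 1) / 2) < s ∧ s < 2 / (q - 2) := by
    refine exists_between (max_lt (by positivity) ?_)
    rw [div_lt_div_iff₀ (by norm_num) hq0]
    linarith
  have hs0 : 0 < s := (le_max_left _ _).trans_lt hs1
  have hsd := (le_max_right _ _).trans_lt hs1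
  rw [lt_div_iff₀ hq0] at hs2
  obtain ⟨C, hC, hCf⟩ := lintegral_rpow_le_weight (m := m) hs0 (by push_cast; linarith) hq2
  refine ⟨2 * C, 2 - s * (q - 2), by positivity, by linarith, fun f N R hN hR hf hsupp => ?_⟩
  have h1 : ∫⁻ ξ : Sp m, ENNReal.ofReal ((1 + ‖ξ‖) ^ (s * (q - 2))) * ‖(𝓕 f : L2 m) ξ‖ₑ ^ 2 ≤
      ENNReal.ofReal ((1 + R) ^ (-(2 - s * (q - 2)))) * ENNReal.ofReal (2 * N ^ 2) := by
    refine le_trans ?_ (mul_le_mul_right (lintegral_weight_le hf.1 hf.2) _)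
    rw [← lintegral_const_mul' _ _ ENNReal.ofReal_ne_top]
    refine lintegral_mono_ae ?_
    filter_upwards [hsupp] with ξ hξ
    by_cases h : ‖ξ‖ < R
    · rw [hξ h]; simp
    · rw [← mul_assoc, ← ENNReal.ofReal_mul (by positivity)]
      gcongr
      have e : s * (q - 2) = -(2 - s * (q - 2)) + 2 := by ring
      nth_rewrite 1 [e]
      rw [Real.rpow_add (by positivity), Real.rpow_two]
      refine mul_le_mul_of_nonneg_right ?_ (by positivity)
      exact Real.rpow_le_rpow_of_nonpos (by positivity) (by linarith [not_lt.1 h]) (by linarith)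
  refine (hCf f N hN hf.1 hf.2).trans ((mul_le_mul_right h1 _).trans (le_of_eq ?_))
  rw [← ENNReal.ofReal_mul (by positivity), ← ENNReal.ofReal_mul (by positivity)]
  congr 1
  rw [show q = (q - 2) + 2 by ring, Real.rpow_add hN, Real.rpow_two]
  ring_nf

theorem exists_lqLint_le {q : ℝ} (hq : IsSubcritical m q) :
    ∃ C : ℝ, 0 < C ∧ ∀ (f : L2 m) (N : ℝ), 0 < N → H1Bound N f →
      lqLint q f ≤ ENNReal.ofReal (C * N ^ q) := by
  obtain ⟨C, δ, hC, -, h⟩ := lqLint_le_of_fourier_eq_zero hq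
  refine ⟨C + 1, by positivity, fun f N hN hf => ?_⟩
  refine (h f N 0 hN le_rfl hf (Eventually.of_forall fun ξ hξ =>
    absurd hξ (not_lt.2 (norm_nonneg _)))).trans (ENNReal.ofReal_le_ofReal ?_)
  rw [add_zero, Real.one_rpow, mul_one]
  gcongr
  linarith

theorem lqLint_lt_top {q : ℝ} (hq : IsSubcritical m q) {f : L2 m} (hf : dirichlet f < ⊤) :
    lqLint q f < ⊤ := by
  obtain ⟨C, -, h⟩ := exists_lqLint_le hq
  obtain ⟨N, hN, hfN⟩ := exists_h1Bound hf
  exact (h f N hN hfN).trans_lt ENNReal.ofReal_lt_top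

/-! ### Low frequencies -/

/-- The kernel of the frequency projection `lowPass`. -/
def lowKer (m : ℕ) (R : ℝ) : L2 m :=
  𝓕⁻ (indicatorConstLp 2 (measurableSet_ball (x := (0 : Sp m)) (ε := R))
    measure_ball_lt_top.ne (1 : ℂ) : L2 m)

/-- Values of the low-frequency part are correlations with translates of one fixed `L²` function.
Thus weak limits, which control correlations, also control sizes. -/
theorem lowPass_ae_eq_inner (R : ℝ) (f : L2 m) :
    ∀ᵐ x, lowPass R f x = inner ℂ (transE x (lowKer m R)) f := by
  set B := Metric.ball (0 : Sp m) R
  have hBfin : volume B ≠ ⊤ := measure_ball_lt_top.ne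
  set G : L2 m := 𝓕 (lowPass R f) with hG
  have hGae : G =ᵐ[volume] B.indicator (𝓕 f : L2 m) := coeFn_fourier_lowPass R f
  have hint : Integrable G volume := by
    refine Integrable.congr ?_ hGae.symm
    refine IntegrableOn.integrable_indicator ?_ measurableSet_ball
    have : IsFiniteMeasure (volume.restrict B) := isFiniteMeasure_restrict.2 hBfin
    exact ((Lp.memLp (𝓕 f : L2 m)).restrict B).integrable (by norm_num)
  have h1 := coeFn_fourierInv_of_integrable G hint
  rw [hG, FourierTransform.fourierInv_fourier_eq] at h1
  filter_upwards [h1] with x hx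
  rw [hx, ← hG, Real.fourierInv_eq, ← Lp.inner_fourier_eq, L2.inner_def]
  refine integral_congr_ae ?_
  have h2 : (𝓕 (lowKer m R) : L2 m) =ᵐ[volume] B.indicator fun _ => (1 : ℂ) := by
    rw [lowKer, FourierTransform.fourier_fourierInv_eq]
    exact indicatorConstLp_coeFn
  filter_upwards [hGae, h2, coeFn_fourier_transE x (lowKer m R)] with ξ a b c
  rw [a, c, b]
  by_cases h : ξ ∈ B
  · rw [Set.indicator_of_mem h, Set.indicator_of_mem h, mul_one, Circle.smul_def,
      Real.fourierChar_apply, RCLike.inner_apply, ← Complex.exp_conj, smul_eq_mul, mul_comm]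
    congr 2
    simp [real_inner_comm, Complex.conj_ofNat]
  · rw [Set.indicator_of_notMem h, Set.indicator_of_notMem h]; simp

theorem setLIntegral_rpow_le_of_norm_le {q η : ℝ} (hq : 2 ≤ q) (hη : 0 ≤ η) (f : L2 m)
    {A : Set (Sp m)} (hA : MeasurableSet A) (h : ∀ᵐ x, x ∈ A → ‖f x‖ ≤ η) :
    ∫⁻ x in A, ‖f x‖ₑ ^ q ≤ ENNReal.ofReal (η ^ (q - 2) * ‖f‖ ^ 2) := by
  have h1 : ∫⁻ x in A, ‖f x‖ₑ ^ q ≤ ∫⁻ x in A, ENNReal.ofReal (η ^ (q - 2)) * ‖f x‖ₑ ^ 2 := by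
    refine lintegral_mono_ae ?_
    filter_upwards [(ae_restrict_iff' hA).2 h] with x hx
    rw [← ofReal_norm, ENNReal.ofReal_rpow_of_nonneg (norm_nonneg _) (by linarith),
      ← ENNReal.ofReal_pow (norm_nonneg _), ← ENNReal.ofReal_mul (by positivity)]
    refine ENNReal.ofReal_le_ofReal ?_
    rcases (norm_nonneg (f x)).eq_or_lt with h0 | h0
    · rw [← h0, Real.zero_rpow (by linarith)]; positivity
    · rw [show q = (q - 2) + 2 by ring, Real.rpow_add h0, Real.rpow_two,
        show q - 2 + 2 - 2 = q - 2 by ring]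
      gcongr
  refine h1.trans ((setLIntegral_le_lintegral _ _).trans ?_)
  rw [lintegral_const_mul' _ _ ENNReal.ofReal_ne_top, ← L2.enorm_sq_eq_lintegral,
    ENNReal.ofReal_mul (by positivity), ENNReal.ofReal_pow (norm_nonneg _), ofReal_norm]

theorem setLIntegral_rpow_add_le {q : ℝ} (hq : 1 ≤ q) (f g : L2 m) (A : Set (Sp m)) :
    ∫⁻ x in A, ‖(f + g : L2 m) x‖ₑ ^ q ≤
      2 ^ (q - 1) * ((∫⁻ x in A, ‖f x‖ₑ ^ q) + ∫⁻ x in A, ‖g x‖ₑ ^ q) := by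
  have h2 : (2 : ℝ≥0∞) ^ (q - 1) ≠ ⊤ := ENNReal.rpow_ne_top_of_nonneg (by linarith) (by norm_num)
  rw [← lintegral_add_left' ((Lp.aestronglyMeasurable f).enorm.pow_const q).restrict,
    ← lintegral_const_mul' _ _ h2]
  refine lintegral_mono_ae (ae_restrict_of_ae ?_)
  filter_upwards [Lp.coeFn_add f g] with x hx
  rw [hx]
  refine le_trans ?_ (ENNReal.rpow_add_le_mul_rpow_add_rpow _ _ hq)
  exact ENNReal.rpow_le_rpow (enorm_add_le _ _) (by linarith)

/-- A function bounded in `H¹` whose local averages at a suitable scale are small on `A` is small in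
`L^q(A)`. -/
theorem exists_setLIntegral_rpow_le {q : ℝ} (hq : IsSubcritical m q) {N ε : ℝ} (hN : 0 < N)
    (hε : 0 < ε) : ∃ R δ : ℝ, 0 < δ ∧ ∀ (f : L2 m) (A : Set (Sp m)), MeasurableSet A →
      H1Bound N f → (∀ x ∈ A, ‖(inner ℂ (transE x (lowKer m R)) f : ℂ)‖ ≤ δ) →
      ∫⁻ x in A, ‖f x‖ₑ ^ q ≤ ENNReal.ofReal ε := by
  obtain ⟨C, δ, hC, hδ, h⟩ := lqLint_le_of_fourier_eq_zero hq
  have hq2 := hq.1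
  have hq0 : 0 < q - 2 := by linarith
  -- The constant of `(a + b)^q ≤ K (a^q + b^q)`. First `R` is chosen so that the frequencies above
  -- it contribute little, then `η` so that the low part is small through `∫ |g|^q ≤ (sup |g|)^(q-2)
  -- ‖g‖²`.
  set K : ℝ := 2 ^ (q - 1) with hK
  have hK0 : 0 < K := by positivity
  obtain ⟨R, hR0, hR⟩ : ∃ R : ℝ, 0 ≤ R ∧ C * (1 + R) ^ (-δ) * N ^ q ≤ ε / (2 * K) := by
    have h1 : Tendsto (fun R : ℝ => C * (1 + R) ^ (-δ) * N ^ q) atTop (𝓝 (C * 0 * N ^ q)) :=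
      (((tendsto_rpow_neg_atTop hδ).comp (tendsto_atTop_add_const_left _ 1 tendsto_id)).const_mul
        C).mul_const _
    rw [mul_zero, zero_mul] at h1
    obtain ⟨R, h2, h3⟩ := ((h1.eventually_le_const (show 0 < ε / (2 * K) by positivity)).and
      (eventually_ge_atTop 0)).exists
    exact ⟨R, h3, h2⟩
  obtain ⟨η, hη, hη2⟩ : ∃ η : ℝ, 0 < η ∧ η ^ (q - 2) * N ^ 2 ≤ ε / (2 * K) := by
    refine ⟨(ε / (2 * K) / N ^ 2) ^ (1 / (q - 2)), by positivity, ?_⟩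
    rw [← Real.rpow_mul (by positivity), one_div_mul_cancel hq0.ne', Real.rpow_one]
    exact (div_mul_cancel₀ _ (by positivity)).le
  refine ⟨R, η, hη, fun f A hA hf hfA => ?_⟩
  have e : f = lowPass R f + (f - lowPass R f) := by abel
  have hlow : ∫⁻ x in A, ‖lowPass R f x‖ₑ ^ q ≤ ENNReal.ofReal (ε / (2 * K)) := by
    refine (setLIntegral_rpow_le_of_norm_le hq2.le hη.le _ hA ?_).trans
      (ENNReal.ofReal_le_ofReal (le_trans ?_ hη2))
    · filter_upwards [lowPass_ae_eq_inner R f] with x hx hxA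
      rw [hx]; exact hfA x hxA
    · gcongr
      exact (norm_lowPass_le R f).trans (hf.norm_le hN.le)
  have hhigh : ∫⁻ x in A, ‖(f - lowPass R f : L2 m) x‖ₑ ^ q ≤ ENNReal.ofReal (ε / (2 * K)) := by
    refine (setLIntegral_le_lintegral _ _).trans ((h _ N R hN hR0 (hf.of_fourier_le ?_) ?_).trans
      (ENNReal.ofReal_le_ofReal hR))
    · filter_upwards [coeFn_fourier_sub f (lowPass R f), coeFn_fourier_lowPass R f] with ξ h1 h2
      rw [h1, h2]
      by_cases h : ξ ∈ Metric.ball (0 : Sp m) R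
      · rw [Set.indicator_of_mem h, sub_self, norm_zero]; positivity
      · rw [Set.indicator_of_notMem h, sub_zero]
    · filter_upwards [coeFn_fourier_sub f (lowPass R f), coeFn_fourier_lowPass R f]
        with ξ h1 h2 hξ
      rw [h1, h2, Set.indicator_of_mem (by simpa using hξ), sub_self]
  calc ∫⁻ x in A, ‖f x‖ₑ ^ q
      = ∫⁻ x in A, ‖(lowPass R f + (f - lowPass R f) : L2 m) x‖ₑ ^ q := by rw [← e]
    _ ≤ 2 ^ (q - 1) * ((∫⁻ x in A, ‖lowPass R f x‖ₑ ^ q) +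
        ∫⁻ x in A, ‖(f - lowPass R f : L2 m) x‖ₑ ^ q) :=
        setLIntegral_rpow_add_le (by linarith) _ _ _
    _ ≤ 2 ^ (q - 1) * (ENNReal.ofReal (ε / (2 * K)) + ENNReal.ofReal (ε / (2 * K))) := by gcongr
    _ = ENNReal.ofReal ε := by
        rw [← ENNReal.ofReal_add (by positivity) (by positivity)]
        have : (2 : ℝ≥0∞) ^ (q - 1) = ENNReal.ofReal K := by
          rw [hK, ← ENNReal.ofReal_rpow_of_pos (by norm_num), ENNReal.ofReal_ofNat]
        rw [this, ← ENNReal.ofReal_mul hK0.le]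
        congr 1; field_simp; norm_num

/-- The translates of `g` by points of `K` form a compact set in `L²`, and pairing with the bounded
`u n` is equi-Lipschitz. -/
theorem tendsto_inner_transE_of_isCompact {ι : Type*} {l : Filter ι} {u : ι → L2 m} {N : ℝ}
    (hN : ∀ n, ‖u n‖ ≤ N) (hu : WeakTendsto u l 0) (g : L2 m) {K : Set (Sp m)} (hK : IsCompact K)
    {δ : ℝ} (hδ : 0 < δ) :
    ∀ᶠ n in l, ∀ x ∈ K, ‖(inner ℂ (transE x g) (u n) : ℂ)‖ < δ := by
  have h1 : IsCompact ((fun x => transE x g) '' K) := hK.image (continuous_transE g)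
  have h2 := eventually_forall_norm_lt_of_isCompact (l := l) (K := N)
    (T := fun n (f : L2 m) => (inner ℂ f (u n) : ℂ)) (fun n x y => by
      rw [← inner_sub_left, dist_eq_norm, mul_comm]
      exact (norm_inner_le_norm _ _).trans (by gcongr; exact hN n)) (fun x => by
      simpa using hu x) h1 hδ
  filter_upwards [h2] with n hn x hx
  exact hn _ (Set.mem_image_of_mem _ hx)

/-- Local compactness of the embedding `H¹ ⊂ L^q`. -/
theorem tendsto_setLIntegral_ball {ι : Type*} {l : Filter ι} {u : ι → L2 m} {N q : ℝ}
    (hq : IsSubcritical m q) (hN : 0 < N) (hN' : ∀ n, H1Bound N (u n)) (hu : WeakTendsto u l 0)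
    (ρ : ℝ) : Tendsto (fun n => ∫⁻ x in Metric.ball 0 ρ, ‖u n x‖ₑ ^ q) l (𝓝 0) := by
  rw [ENNReal.tendsto_nhds_zero]
  intro ε hε
  obtain ⟨ε', hε', hε2⟩ : ∃ ε' : ℝ, 0 < ε' ∧ ENNReal.ofReal ε' ≤ ε := by
    rcases eq_or_ne ε ⊤ with rfl | h
    · exact ⟨1, one_pos, le_top⟩
    · exact ⟨ε.toReal, ENNReal.toReal_pos hε.ne' h, ENNReal.ofReal_toReal_le⟩
  obtain ⟨R, δ, hδ, h⟩ := exists_setLIntegral_rpow_le hq hN hε'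
  filter_upwards [tendsto_inner_transE_of_isCompact (fun n => (hN' n).norm_le hN.le) hu (lowKer m R)
    (isCompact_closedBall (0 : Sp m) ρ) hδ] with n hn
  exact (h _ _ measurableSet_ball (hN' n) fun x hx =>
    (hn x (Metric.ball_subset_closedBall hx)).le).trans hε2

/-! ### Consequences of the dispersive estimate -/

/-- The restriction of `f` to the set `A`. -/
def setRestrict (A : Set (Sp m)) (hA : MeasurableSet A) (f : L2 m) : L2 m :=
  ((Lp.memLp f).indicator hA).toLp _

theorem coeFn_setRestrict {A : Set (Sp m)} (hA : MeasurableSet A) (f : L2 m) :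
    setRestrict A hA f =ᵐ[volume] A.indicator f := MemLp.coeFn_toLp _

theorem setRestrict_add_compl {A : Set (Sp m)} (hA : MeasurableSet A) (f : L2 m) :
    setRestrict A hA f + setRestrict Aᶜ hA.compl f = f := by
  refine Lp.ext ?_
  filter_upwards [Lp.coeFn_add (setRestrict A hA f) (setRestrict Aᶜ hA.compl f),
    coeFn_setRestrict hA f, coeFn_setRestrict hA.compl f] with x h1 h2 h3
  rw [h1, Pi.add_apply, h2, h3]
  exact congrFun (Set.indicator_self_add_compl A f) x

theorem lintegral_setRestrict {A : Set (Sp m)} (hA : MeasurableSet A) (f : L2 m)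
    {φ : ℝ≥0∞ → ℝ≥0∞} (hφ : φ 0 = 0) :
    ∫⁻ x, φ ‖setRestrict A hA f x‖ₑ = ∫⁻ x in A, φ ‖f x‖ₑ := by
  rw [← lintegral_indicator hA]
  refine lintegral_congr_ae ?_
  filter_upwards [coeFn_setRestrict hA f] with x h
  rw [h]
  by_cases hx : x ∈ A
  · rw [Set.indicator_of_mem hx, Set.indicator_of_mem hx]
  · rw [Set.indicator_of_notMem hx, Set.indicator_of_notMem hx, enorm_zero, hφ]

/-- Interpolation between `L¹ → L^∞` and `L² → L²`. -/
theorem lqLint_le_of_L1_bound {r A I : ℝ} (hr : 2 < r) (hA : 0 < A) (T : L2 m ≃ₗᵢ[ℂ] L2 m)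
    (hT : ∀ f : L2 m, MemLp f 1 volume →
      eLpNorm (T f) ∞ volume ≤ ENNReal.ofReal A * eLpNorm f 1 volume)
    (F : L2 m) (hI : 0 < I) (hF : lqLint (r / (r - 1)) F ≤ ENNReal.ofReal I) :
    lqLint r (T F) ≤ ENNReal.ofReal (4 * r / (r - 2) * (2 * A) ^ (r - 2) * I ^ (r - 1)) := by
  have hr1 : 0 < r - 1 := by linarith
  have hr2 : 0 < r - 2 := by linarith
  -- The set `w < t` is where `F` is large. There `‖F‖ = ‖F‖^(-1/(r-1)) ‖F‖^(r/(r-1))` bounds the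
  -- `L¹` norm by `t / (2 A)`, hence the image under `T` by `t / 2`. At zeros of `F` the power is
  -- `0` by convention, which only puts them into the part where `F` contributes nothing.
  set w : Sp m → ℝ := fun y => 2 * A * I * ‖F y‖ ^ (-(1 / (r - 1))) with hw
  have hFm : Measurable fun y => ‖F y‖ := (Lp.stronglyMeasurable F).measurable.norm
  have hwm : Measurable w := (hFm.pow_const _).const_mul _
  have key := lintegral_rpow_le_of_meas_le (μ := volume) (ν := (volume : Measure (Sp m)))
    (Lp.aestronglyMeasurable (T F)) (g := fun y => ‖F y‖ₑ ^ 2)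
    ((Lp.aestronglyMeasurable F).enorm.pow_const 2) hwm (fun y => by simp only [hw]; positivity) hr
    (fun t ht => by
      set B : Set (Sp m) := {y | w y < t} with hB
      have hBm : MeasurableSet B := measurableSet_lt hwm measurable_const
      have hBc : Bᶜ = {y | t ≤ w y} := by ext y; simp [hB]
      have hL1 : eLpNorm (setRestrict B hBm F) 1 volume ≤ ENNReal.ofReal (t / (2 * A)) := by
        rw [eLpNorm_one_eq_lintegral_enorm]
        refine (le_of_eq (lintegral_setRestrict hBm F (φ := id) rfl)).trans ?_
        have e1 : ∀ y ∈ B, id ‖F y‖ₑ ≤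
            ENNReal.ofReal (t / (2 * A * I)) * ‖F y‖ₑ ^ (r / (r - 1)) := fun y hy => by
          have hy : 2 * A * I * ‖F y‖ ^ (-(1 / (r - 1))) < t := hy
          rw [id, ← ofReal_norm, ENNReal.ofReal_rpow_of_nonneg (norm_nonneg _) (by positivity),
            ← ENNReal.ofReal_mul (by positivity)]
          refine ENNReal.ofReal_le_ofReal ?_
          rcases (norm_nonneg (F y)).eq_or_lt with h0 | h0
          · rw [← h0]; positivity
          · have h1 : ‖F y‖ ^ (-(1 / (r - 1))) ≤ t / (2 * A * I) := by
              rw [le_div_iff₀ (by positivity)]; linarith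
            calc ‖F y‖ = ‖F y‖ ^ (-(1 / (r - 1))) * ‖F y‖ ^ (r / (r - 1)) := by
                  rw [← Real.rpow_add h0]
                  rw [show -(1 / (r - 1)) + r / (r - 1) = 1 by field_simp; ring, Real.rpow_one]
              _ ≤ _ := by gcongr
        refine (setLIntegral_mono' hBm e1).trans ((setLIntegral_le_lintegral _ _).trans ?_)
        rw [lintegral_const_mul' _ _ ENNReal.ofReal_ne_top]
        refine (mul_le_mul_right hF _).trans (le_of_eq ?_)
        rw [← ENNReal.ofReal_mul (by positivity)]
        congr 1; field_simp
      have hmem : MemLp (setRestrict B hBm F) 1 volume :=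
        ⟨Lp.aestronglyMeasurable _, hL1.trans_lt ENNReal.ofReal_lt_top⟩
      have hsm : ∀ᵐ x, ‖T (setRestrict B hBm F) x‖ ≤ t / 2 := by
        have h1 : eLpNorm (T (setRestrict B hBm F)) ∞ volume ≤ ENNReal.ofReal (t / 2) := by
          refine (hT _ hmem).trans ((mul_le_mul_right hL1 _).trans (le_of_eq ?_))
          rw [← ENNReal.ofReal_mul hA.le]
          congr 1; field_simp
        rw [eLpNorm_exponent_top] at h1
        filter_upwards [ae_le_eLpNormEssSup (f := T (setRestrict B hBm F)) (μ := volume)] with x hx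
        have := hx.trans h1
        rwa [← ofReal_norm, ENNReal.ofReal_le_ofReal_iff (by positivity)] at this
      have h4 := meas_lt_norm_le_of_add (f := T F) (g := T (setRestrict B hBm F))
        (h := T (setRestrict Bᶜ hBm.compl F)) (by
          have e : T F = T (setRestrict B hBm F) + T (setRestrict Bᶜ hBm.compl F) := by
            rw [← map_add, setRestrict_add_compl]
          filter_upwards [Lp.coeFn_add (T (setRestrict B hBm F))
            (T (setRestrict Bᶜ hBm.compl F))] with x hx
          rw [e, hx]; rfl) ht hsm (Lp.aestronglyMeasurable _)
      rw [← L2.enorm_sq_eq_lintegral, ← ofReal_norm, LinearIsometryEquiv.norm_map, ofReal_norm,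
        L2.enorm_sq_eq_lintegral,
        lintegral_setRestrict hBm.compl F (φ := fun a => a ^ 2) (by simp), hBc] at h4
      exact h4)
  refine key.trans ?_
  have e : ∀ y : Sp m, ‖F y‖ₑ ^ 2 * ENNReal.ofReal (w y ^ (r - 2)) =
      ENNReal.ofReal ((2 * A * I) ^ (r - 2)) * ‖F y‖ₑ ^ (r / (r - 1)) := fun y => by
    simp only [hw]
    rw [Real.mul_rpow (by positivity) (by positivity), ENNReal.ofReal_mul (by positivity),
      mul_left_comm, ← ofReal_norm, ENNReal.ofReal_rpow_of_nonneg (norm_nonneg _) (by positivity),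
      ← ENNReal.ofReal_pow (norm_nonneg _), ← ENNReal.ofReal_mul (by positivity)]
    congr 2
    rcases (norm_nonneg (F y)).eq_or_lt with h0 | h0
    · rw [← h0, Real.zero_rpow (x := r / (r - 1)) (by positivity)]; simp
    · rw [← Real.rpow_mul h0.le, ← Real.rpow_two, ← Real.rpow_add h0]
      congr 1; field_simp; ring
  simp only [e]
  rw [lintegral_const_mul' _ _ ENNReal.ofReal_ne_top]
  refine (mul_le_mul_right (mul_le_mul_right hF _) _).trans (le_of_eq ?_)
  rw [← ENNReal.ofReal_mul (by positivity), ← ENNReal.ofReal_mul (by positivity)]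
  congr 1
  rw [Real.mul_rpow (by positivity) hI.le, show r - 1 = (r - 2) + 1 by ring, Real.rpow_add hI,
    Real.rpow_one]
  ring

/-- The dispersive estimate with a positive constant. -/
theorem DispersiveEstimate.exists_pos {V : LInf m} (h : DispersiveEstimate V) :
    ∃ C : ℝ, 0 < C ∧ ∀ t : ℝ, t ≠ 0 → ∀ f : L2 m, MemLp f 1 volume →
      eLpNorm (flowE V t f) ∞ volume ≤
        ENNReal.ofReal (C * |t| ^ (-((m + 1 : ℕ) : ℝ) / 2)) * eLpNorm f 1 volume := by
  obtain ⟨C, hC⟩ := h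
  refine ⟨max C 1, by positivity, fun t ht f hf => (hC t ht f hf).trans ?_⟩
  gcongr
  exact le_max_left _ _

/-- Decay of the propagator from `L^{r'}` to `L^r`. -/
theorem DispersiveEstimate.exists_lqLint_le {V : LInf m} (h : DispersiveEstimate V) {r : ℝ}
    (hr : 2 < r) : ∃ K : ℝ, 0 < K ∧ ∀ (t I : ℝ), t ≠ 0 → 0 < I → ∀ F : L2 m,
      lqLint (r / (r - 1)) F ≤ ENNReal.ofReal I →
      lqLint r (flowE V t F) ≤
        ENNReal.ofReal (K * |t| ^ (-(((m : ℝ) + 1) / 2 * (r - 2))) * I ^ (r - 1)) := by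
  obtain ⟨C, hC, h⟩ := h.exists_pos
  have hr2 : 0 < r - 2 := by linarith
  refine ⟨4 * r / (r - 2) * (2 * C) ^ (r - 2), by positivity, fun t I ht hI F hF => ?_⟩
  have ht' : 0 < |t| := abs_pos.2 ht
  refine (lqLint_le_of_L1_bound hr (A := C * |t| ^ (-((m + 1 : ℕ) : ℝ) / 2)) (by positivity) _
    (h t ht) F hI hF).trans (ENNReal.ofReal_le_ofReal (le_of_eq ?_))
  rw [← mul_assoc 2 C, Real.mul_rpow (x := 2 * C) (by positivity) (by positivity),
    ← Real.rpow_mul ht'.le]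
  push_cast
  ring_nf

/-! ### Decay of correlations -/

/-- Unitarity makes the approximation errors independent of `n` and of the extra index `k`, so
uniformity in `k` (in the application, pairs of positions) passes from a dense set to all vectors.
-/
theorem eventually_norm_inner_lt_of_dense {ι κ H : Type*} [NormedAddCommGroup H]
    [InnerProductSpace ℂ H] {l : Filter ι} {A : ι → κ → H ≃ₗᵢ[ℂ] H} {D : Set H} (hD : Dense D)
    (h : ∀ f ∈ D, ∀ g ∈ D, ∀ ε : ℝ, 0 < ε → ∀ᶠ n in l, ∀ k, ‖(inner ℂ f (A n k g) : ℂ)‖ < ε)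
    (f g : H) {ε : ℝ} (hε : 0 < ε) : ∀ᶠ n in l, ∀ k, ‖(inner ℂ f (A n k g) : ℂ)‖ < ε := by
  obtain ⟨f', hf', hff⟩ := hD.exists_dist_lt f (ε := ε / (3 * (‖g‖ + 1))) (by positivity)
  obtain ⟨g', hg', hgg⟩ := hD.exists_dist_lt g (ε := ε / (3 * (‖f'‖ + 1))) (by positivity)
  filter_upwards [h f' hf' g' hg' (ε / 3) (by positivity)] with n hn k
  have e : (inner ℂ f (A n k g) : ℂ) = inner ℂ (f - f') (A n k g) + inner ℂ f' (A n k (g - g')) +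
      inner ℂ f' (A n k g') := by
    rw [map_sub, inner_sub_left, inner_sub_right]; ring
  rw [dist_eq_norm] at hff hgg
  rw [e]
  have h1 : ‖(inner ℂ (f - f') (A n k g) : ℂ)‖ ≤ ε / 3 := by
    refine (norm_inner_le_norm _ _).trans ?_
    rw [LinearIsometryEquiv.norm_map]
    calc _ ≤ ε / (3 * (‖g‖ + 1)) * (‖g‖ + 1) := by gcongr; linarith
      _ = ε / 3 := by have : ‖g‖ + 1 ≠ 0 := by positivity
                      field_simp
  have h2 : ‖(inner ℂ f' (A n k (g - g')) : ℂ)‖ ≤ ε / 3 := by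
    refine (norm_inner_le_norm _ _).trans ?_
    rw [LinearIsometryEquiv.norm_map, mul_comm]
    calc _ ≤ ε / (3 * (‖f'‖ + 1)) * (‖f'‖ + 1) := by gcongr; linarith
      _ = ε / 3 := by have : ‖f'‖ + 1 ≠ 0 := by positivity
                      field_simp
  calc _ ≤ ‖(inner ℂ (f - f') (A n k g) : ℂ)‖ + ‖(inner ℂ f' (A n k (g - g')) : ℂ)‖ +
      ‖(inner ℂ f' (A n k g') : ℂ)‖ := norm_add₃_le
    _ < ε := by linarith [hn k]

/-- Square-integrable functions that are integrable and vanish outside a ball. -/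
def boundedSupport (m : ℕ) : Set (L2 m) :=
  {g | MemLp g 1 volume ∧ ∃ ρ : ℝ, ∀ᵐ x, ρ ≤ ‖x‖ → g x = 0}

theorem dense_boundedSupport (m : ℕ) : Dense (boundedSupport m) := by
  refine Metric.dense_iff.2 fun f ε hε => ?_
  obtain ⟨g, hgc, hfg, hcont, hgm⟩ := (Lp.memLp f).exists_hasCompactSupport_eLpNorm_sub_le
    (by norm_num) (ε := ENNReal.ofReal (ε / 2)) (by simpa using hε)
  refine ⟨hgm.toLp g, ?_, ?_, ?_⟩
  · rw [Metric.mem_ball, dist_comm, Lp.dist_def]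
    have : eLpNorm (f - hgm.toLp g : Sp m → ℂ) 2 volume ≤ ENNReal.ofReal (ε / 2) := by
      refine le_trans (le_of_eq (eLpNorm_congr_ae ?_)) hfg
      filter_upwards [hgm.coeFn_toLp] with x hx
      simp [hx]
    refine (ENNReal.toReal_le_of_le_ofReal (by positivity) this).trans_lt (by linarith)
  · exact memLp_one_iff_integrable.2
      ((hcont.integrable_of_hasCompactSupport hgc).congr hgm.coeFn_toLp.symm)
  · obtain ⟨ρ, hρ⟩ := hgc.isCompact.isBounded.subset_ball (0 : Sp m)
    refine ⟨ρ, ?_⟩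
    filter_upwards [hgm.coeFn_toLp] with x hx hxρ
    rw [hx]
    exact image_eq_zero_of_notMem_tsupport fun h => by
      have := hρ h
      rw [mem_ball_zero_iff] at this
      linarith

theorem eLpNorm_transE (z : Sp m) (f : L2 m) (p : ℝ≥0∞) :
    eLpNorm (transE z f) p volume = eLpNorm f p volume := by
  rw [eLpNorm_congr_ae (coeFn_transE z f)]
  exact eLpNorm_comp_measurePreserving (Lp.aestronglyMeasurable f)
    (measurePreserving_sub_right volume z)

theorem norm_inner_le_L1_Linf (f g : L2 m) {a b : ℝ} (ha : 0 ≤ a) (hb : 0 ≤ b)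
    (hf : eLpNorm f 1 volume ≤ ENNReal.ofReal a) (hg : eLpNorm g ∞ volume ≤ ENNReal.ofReal b) :
    ‖(inner ℂ f g : ℂ)‖ ≤ a * b := by
  rw [L2.inner_def]
  refine (ENNReal.ofReal_le_ofReal_iff (by positivity)).1 ?_
  rw [ofReal_norm]
  refine (enorm_integral_le_lintegral_enorm _).trans ?_
  have h1 : ∫⁻ x, ‖(inner ℂ (f x) (g x) : ℂ)‖ₑ ≤ ∫⁻ x, ‖f x‖ₑ * ENNReal.ofReal b := by
    refine lintegral_mono_ae ?_
    rw [eLpNorm_exponent_top] at hg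
    filter_upwards [ae_le_eLpNormEssSup (f := g) (μ := volume)] with x hx
    have h2 : ‖(inner ℂ (f x) (g x) : ℂ)‖ₑ ≤ ‖f x‖ₑ * ‖g x‖ₑ := by
      rw [← ofReal_norm, ← ofReal_norm, ← ofReal_norm, ← ENNReal.ofReal_mul (norm_nonneg _)]
      exact ENNReal.ofReal_le_ofReal (norm_inner_le_norm _ _)
    exact h2.trans (mul_le_mul_right (hx.trans hg) _)
  refine h1.trans ?_
  rw [lintegral_mul_const' _ _ ENNReal.ofReal_ne_top, ← eLpNorm_one_eq_lintegral_enorm,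
    ENNReal.ofReal_mul ha]
  gcongr

/-- Time separation kills correlations, uniformly in the positions. -/
theorem eventually_inner_flowE_lt {V : LInf m} (hV : DispersiveEstimate V) {ι : Type*}
    {l : Filter ι} {t : ι → ℝ} (ht : Tendsto (fun n => |t n|) l atTop) (f g : L2 m) {ε : ℝ}
    (hε : 0 < ε) : ∀ᶠ n in l, ∀ x y : Sp m,
      ‖(inner ℂ (transE y f) (flowE V (t n) (transE x g)) : ℂ)‖ < ε := by
  obtain ⟨C, hC, h⟩ := hV.exists_pos
  have := eventually_norm_inner_lt_of_dense (l := l)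
    (A := fun n (z : Sp m × Sp m) => (transE z.1).trans ((flowE V (t n)).trans (transE z.2).symm))
    (dense_boundedSupport m) (fun f hf g hg ε hε => by
      set a := (eLpNorm f 1 volume).toReal
      set b := (eLpNorm g 1 volume).toReal
      have hlim : Tendsto (fun n => a * (C * |t n| ^ (-(((m + 1 : ℕ) : ℝ) / 2)) * b)) l
          (𝓝 (a * (C * 0 * b))) :=
        ((((tendsto_rpow_neg_atTop (by positivity)).comp ht).const_mul C).mul_const b).const_mul a
      simp only [mul_zero, zero_mul] at hlim
      filter_upwards [hlim.eventually_lt_const hε, ht.eventually_gt_atTop 0] with n hn hn0 z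
      simp only [LinearIsometryEquiv.trans_apply]
      rw [← (transE z.2).inner_map_map, LinearIsometryEquiv.apply_symm_apply]
      refine lt_of_le_of_lt (norm_inner_le_L1_Linf _ _ (a := a) ENNReal.toReal_nonneg
        (by positivity) ?_ ?_) hn
      · rw [eLpNorm_transE, ENNReal.ofReal_toReal hf.1.2.ne]
      · have hg1 : MemLp (transE z.1 g) 1 volume :=
          ⟨Lp.aestronglyMeasurable _, by rw [eLpNorm_transE]; exact hg.1.2⟩
        refine (h (t n) (abs_pos.1 hn0) _ hg1).trans (le_of_eq ?_)
        rw [eLpNorm_transE, ENNReal.ofReal_mul (q := b) (by positivity),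
          ENNReal.ofReal_toReal hg.1.2.ne, neg_div]) f g hε
  filter_upwards [this] with n hn x y
  have := hn (x, y)
  simp only [LinearIsometryEquiv.trans_apply] at this
  rwa [← (transE y).inner_map_map, LinearIsometryEquiv.apply_symm_apply] at this

/-- Space separation kills correlations. -/
theorem weakTendsto_transE {ι : Type*} {l : Filter ι} {z : ι → Sp m}
    (hz : Tendsto (fun n => ‖z n‖) l atTop) (g : L2 m) :
    WeakTendsto (fun n => transE (z n) g) l 0 := fun f => by
  rw [inner_zero_right, tendsto_zero_iff_norm_tendsto_zero, Metric.tendsto_nhds]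
  intro ε hε
  have := eventually_norm_inner_lt_of_dense (l := l) (κ := Unit) (A := fun n _ => transE (z n))
    (dense_boundedSupport m) (fun f hf g hg ε hε => by
      obtain ⟨ρ₁, h1⟩ := hf.2
      obtain ⟨ρ₂, h2⟩ := hg.2
      filter_upwards [hz.eventually_ge_atTop (ρ₁ + ρ₂)] with n hn _
      rw [L2.inner_def, integral_eq_zero_of_ae, norm_zero]
      · exact hε
      · filter_upwards [h1, coeFn_transE (z n) g, (measurePreserving_sub_right
          (volume : Measure (Sp m)) (z n)).quasiMeasurePreserving.ae h2] with x a b c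
        rw [b]
        by_cases hx : ρ₁ ≤ ‖x‖
        · rw [a hx]; simp
        · rw [c]
          · simp
          · have := norm_sub_norm_le (z n) x
            rw [norm_sub_rev] at this
            linarith) f g hε
  filter_upwards [this] with n hn
  simpa using hn ()

end

noncomputable section

/-! ### The `TT*` argument at the level of weak-type estimates -/

/-- Cut the kernel at distance `a`, the measure of `E`: the near part integrates to at most `2
a^(1-θ) / (1-θ)`, and the far part is at most `a^(-θ)` on a set of measure `a`. -/
theorem setLIntegral_abs_sub_rpow_le {θ : ℝ} (hθ0 : 0 < θ) (hθ1 : θ < 1) (t : ℝ) {E : Set ℝ}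
    (hE : volume E ≠ ⊤) (ha : 0 < volume.real E) :
    ∫⁻ s in E, ENNReal.ofReal (|t - s| ^ (-θ)) ≤
      ENNReal.ofReal ((2 / (1 - θ) + 1) * volume.real E ^ (1 - θ)) := by
  set a := volume.real E with hadef
  set g : ℝ → ℝ≥0∞ := (Set.Ioc 0 a).indicator fun u => ENNReal.ofReal (u ^ (-θ)) with hg
  have hgm : Measurable g := by
    refine Measurable.indicator ?_ measurableSet_Ioc
    exact (measurable_id.pow_const _).ennreal_ofReal
  have hgI : ∫⁻ u, g u = ENNReal.ofReal (a ^ (1 - θ) / (1 - θ)) := by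
    rw [hg, lintegral_indicator measurableSet_Ioc, ← lintegral_rpow_Ioc (by linarith) ha.le]
    congr 1; ext u; congr 2; ring
  have hpt : ∀ u : ℝ, ENNReal.ofReal (|u| ^ (-θ)) ≤
      (g u + g (-u)) + ENNReal.ofReal (a ^ (-θ)) := fun u => by
    rcases lt_or_ge a |u| with h | h
    · refine le_trans (ENNReal.ofReal_le_ofReal ?_) le_add_self
      exact Real.rpow_le_rpow_of_nonpos ha h.le (by linarith)
    · rcases lt_trichotomy u 0 with hu | hu | hu
      · have : g (-u) = ENNReal.ofReal (|u| ^ (-θ)) := by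
          rw [hg, Set.indicator_of_mem, abs_of_neg hu]
          exact ⟨by linarith, by rwa [abs_of_neg hu] at h⟩
        rw [← this]
        exact le_trans le_add_self le_self_add
      · rw [hu, abs_zero, Real.zero_rpow (by linarith), ENNReal.ofReal_zero]; positivity
      · have : g u = ENNReal.ofReal (|u| ^ (-θ)) := by
          rw [hg, Set.indicator_of_mem, abs_of_pos hu]
          exact ⟨hu, by rwa [abs_of_pos hu] at h⟩
        rw [← this]
        exact le_trans le_self_add le_self_add
  calc ∫⁻ s in E, ENNReal.ofReal (|t - s| ^ (-θ))
      ≤ ∫⁻ s in E, ((g (t - s) + g (-(t - s))) + ENNReal.ofReal (a ^ (-θ))) :=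
        lintegral_mono fun s => hpt (t - s)
    _ = (∫⁻ s in E, (g (t - s) + g (-(t - s)))) + ENNReal.ofReal (a ^ (-θ)) * volume E := by
        rw [lintegral_add_right _ measurable_const, setLIntegral_const]
    _ ≤ (∫⁻ s, (g (t - s) + g (-(t - s)))) + ENNReal.ofReal (a ^ (-θ)) * volume E := by
        exact add_le_add_left (setLIntegral_le_lintegral _ _) _
    _ = ((∫⁻ u, g u) + ∫⁻ u, g u) + ENNReal.ofReal (a ^ (-θ)) * ENNReal.ofReal a := by
        have hgt : Measurable fun s => g (t - s) := hgm.comp (by fun_prop)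
        rw [lintegral_add_left hgt, lintegral_sub_left_eq_self g t, hadef, ofReal_measureReal hE]
        simp only [neg_sub]
        rw [lintegral_sub_right_eq_self g t]
    _ = _ := by
        rw [← ENNReal.ofReal_mul (by positivity), hgI]
        have h1 : 0 < 1 - θ := by linarith
        rw [← ENNReal.ofReal_add (by positivity) (by positivity),
          ← ENNReal.ofReal_add (by positivity) (by positivity)]
        congr 1
        rw [show a ^ (-θ) * a = a ^ (1 - θ) by
          rw [sub_eq_neg_add, Real.rpow_add ha, Real.rpow_one]]
        ring

/-- `TT*` on a level set: for `w = ∫_E F`, pairing with `f` gives `η |E| ≤ ‖f‖ ‖w‖`, while expanding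
`‖w‖²` gives at most a constant times `|E|^(2-θ)`. Comparing powers of `|E|` bounds the measure.
This is only a weak-type bound, but it needs neither the Hardy–Littlewood–Sobolev inequality nor a
space-time dual norm. -/
theorem measureReal_le_of_inner_decay {H : Type*} [NormedAddCommGroup H] [InnerProductSpace ℂ H]
    [CompleteSpace H] {θ K η : ℝ} (hθ0 : 0 < θ) (hθ1 : θ < 1) (hK : 0 ≤ K) (hη : 0 < η)
    {F : ℝ → H} {E : Set ℝ} (hEm : MeasurableSet E) (hE : volume E ≠ ⊤) (hF : IntegrableOn F E)
    (hFK : ∀ t ∈ E, ∀ s ∈ E, t ≠ s → ‖(inner ℂ (F t) (F s) : ℂ)‖ ≤ K * |t - s| ^ (-θ))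
    (f : H) (hf : ∀ t ∈ E, η ≤ (inner ℂ f (F t) : ℂ).re) :
    volume.real E ≤ (K * (2 / (1 - θ) + 1) * ‖f‖ ^ 2 / η ^ 2) ^ (1 / θ) := by
  have h1θ : 0 < 1 - θ := by linarith
  set a := volume.real E with hadef
  rcases (measureReal_nonneg : 0 ≤ volume.real E).eq_or_lt with h0 | ha
  · rw [hadef, ← h0]; positivity
  set Cθ := 2 / (1 - θ) + 1 with hCθ
  have hCθ0 : 0 < Cθ := by positivity
  set w : H := ∫ t in E, F t with hw
  have hint : ∀ c : H, IntegrableOn (fun t => (inner ℂ c (F t) : ℂ)) E := fun c =>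
    hF.const_inner c
  have hin : ∀ c : H, ∫ t in E, (inner ℂ c (F t) : ℂ) = inner ℂ c w := fun c => integral_inner hF c
  have h1 : η * a ≤ ‖f‖ * ‖w‖ := by
    have e1 : η * a ≤ ∫ t in E, (inner ℂ f (F t) : ℂ).re := by
      have := setIntegral_mono_on (μ := volume) (s := E) (f := fun _ => η)
        (g := fun t => (inner ℂ f (F t) : ℂ).re) (integrableOn_const hE) (hint f).re hEm hf
      rwa [setIntegral_const, smul_eq_mul, mul_comm] at this
    have e2 : ∫ t in E, (inner ℂ f (F t) : ℂ).re = (inner ℂ f w : ℂ).re := by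
      rw [← hin f]; exact integral_re (hint f)
    rw [e2] at e1
    exact e1.trans ((Complex.re_le_norm _).trans (norm_inner_le_norm _ _))
  have h2 : ∀ t ∈ E, ‖(inner ℂ w (F t) : ℂ)‖ ≤ K * Cθ * a ^ (1 - θ) := by
    intro t ht
    rw [norm_inner_symm, ← hin (F t)]
    refine (ENNReal.ofReal_le_ofReal_iff (by positivity)).1 ?_
    rw [ofReal_norm]
    refine (enorm_integral_le_lintegral_enorm _).trans ?_
    calc ∫⁻ s in E, ‖(inner ℂ (F t) (F s) : ℂ)‖ₑ
        ≤ ∫⁻ s in E, ENNReal.ofReal K * ENNReal.ofReal (|t - s| ^ (-θ)) := by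
          refine lintegral_mono_ae ?_
          have hne : ∀ᵐ s : ℝ, s ≠ t := by
            rw [ae_iff]; simp
          filter_upwards [ae_restrict_mem hEm, ae_restrict_of_ae hne] with s hs hst
          rw [← ofReal_norm, ← ENNReal.ofReal_mul hK]
          exact ENNReal.ofReal_le_ofReal (hFK t ht s hs (Ne.symm hst))
      _ = ENNReal.ofReal K * ∫⁻ s in E, ENNReal.ofReal (|t - s| ^ (-θ)) :=
          lintegral_const_mul' _ _ ENNReal.ofReal_ne_top
      _ ≤ ENNReal.ofReal K * ENNReal.ofReal (Cθ * a ^ (1 - θ)) := by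
          gcongr; exact setLIntegral_abs_sub_rpow_le hθ0 hθ1 t hE ha
      _ = _ := by rw [← ENNReal.ofReal_mul hK, mul_assoc]
  have h3 : ‖w‖ ^ 2 ≤ K * Cθ * a ^ (1 - θ) * a := by
    have e1 : ‖w‖ ^ 2 = ‖(inner ℂ w w : ℂ)‖ := by
      rw [inner_self_eq_norm_sq_to_K]; simp
    rw [e1]
    nth_rewrite 2 [hw]
    rw [← integral_inner hF w]
    exact norm_setIntegral_le_of_norm_le_const hE.lt_top h2
  have h4 : (η * a) ^ 2 ≤ ‖f‖ ^ 2 * (K * Cθ * a ^ (1 - θ) * a) := by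
    calc (η * a) ^ 2 ≤ (‖f‖ * ‖w‖) ^ 2 := by gcongr
      _ = ‖f‖ ^ 2 * ‖w‖ ^ 2 := by ring
      _ ≤ _ := by gcongr
  have h5 : a ^ θ ≤ K * Cθ * ‖f‖ ^ 2 / η ^ 2 := by
    rw [le_div_iff₀ (by positivity)]
    have e1 : a ^ (1 - θ) * a ^ θ = a := by
      rw [← Real.rpow_add ha, sub_add_cancel, Real.rpow_one]
    have hp : 0 < a ^ (1 - θ) * a := by positivity
    refine le_of_mul_le_mul_right ?_ hp
    calc a ^ θ * η ^ 2 * (a ^ (1 - θ) * a) = η ^ 2 * (a ^ (1 - θ) * a ^ θ) * a := by ring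
      _ = (η * a) ^ 2 := by rw [e1]; ring
      _ ≤ _ := h4
      _ = _ := by ring
  calc a = (a ^ θ) ^ (1 / θ) := by
        rw [← Real.rpow_mul ha.le, mul_one_div_cancel hθ0.ne', Real.rpow_one]
    _ ≤ _ := by gcongr

/-! ### Truncated powers -/

theorem rpow_sub_rpow_le {p b c : ℝ} (hp : 1 ≤ p) (hb : 0 ≤ b) (hc : 0 < c) :
    c ^ p - b ^ p ≤ p * c ^ (p - 1) * (c - b) := by
  have h := one_add_mul_self_le_rpow_one_add (s := b / c - 1) (by
    have : 0 ≤ b / c := by positivity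
    linarith) hp
  rw [add_sub_cancel, Real.div_rpow hb hc.le] at h
  have hcp : 0 < c ^ p := by positivity
  have h1 := mul_le_mul_of_nonneg_right h hcp.le
  rw [div_mul_cancel₀ _ hcp.ne'] at h1
  have h2 : c ^ p = c ^ (p - 1) * c := by
    rw [← Real.rpow_add_one hc.ne', sub_add_cancel]
  have h3 : (1 + p * (b / c - 1)) * c ^ p = c ^ p + p * c ^ (p - 1) * (b - c) := by
    rw [add_mul, one_mul, h2]; field_simp
  rw [h3] at h1
  nlinarith

/-- The truncated power `min(|z|, N)^β z`. -/
def truncPow (β N : ℝ) (z : ℂ) : ℂ := ((min ‖z‖ N ^ β : ℝ) : ℂ) * z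

/-- The change of the real factor is always multiplied by `‖w‖`. This matters for `β < 1`, where `s
↦ s^β` is not Lipschitz at `0`: the product is dominated by a difference of powers `β + 1 ≥ 1`, to
which Bernoulli applies. -/
theorem norm_truncPow_sub_le {β N : ℝ} (hβ : 0 < β) (hN : 0 < N) {z w : ℂ} (h : ‖w‖ ≤ ‖z‖) :
    ‖truncPow β N z - truncPow β N w‖ ≤ (β + 2) * N ^ β * ‖z - w‖ := by
  have hz0 : 0 ≤ min ‖z‖ N := le_min (norm_nonneg _) hN.le
  have hw0 : 0 ≤ min ‖w‖ N := le_min (norm_nonneg _) hN.le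
  have hmono : min ‖w‖ N ^ β ≤ min ‖z‖ N ^ β := by gcongr
  have e : truncPow β N z - truncPow β N w = ((min ‖z‖ N ^ β : ℝ) : ℂ) * (z - w) +
      ((min ‖z‖ N ^ β - min ‖w‖ N ^ β : ℝ) : ℂ) * w := by
    simp only [truncPow]; push_cast; ring
  have h1 : ‖((min ‖z‖ N ^ β : ℝ) : ℂ) * (z - w)‖ ≤ N ^ β * ‖z - w‖ := by
    rw [norm_mul, Complex.norm_real, Real.norm_of_nonneg (by positivity)]
    gcongr
    exact min_le_right _ _
  have h2 : ‖((min ‖z‖ N ^ β - min ‖w‖ N ^ β : ℝ) : ℂ) * w‖ ≤ (β + 1) * N ^ β * ‖z - w‖ := by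
    rw [norm_mul, Complex.norm_real, Real.norm_of_nonneg (by linarith)]
    rcases le_total N ‖w‖ with hNw | hNw
    · rw [min_eq_right hNw, min_eq_right (hNw.trans h), sub_self, zero_mul]; positivity
    · rw [min_eq_left hNw]
      set c := min ‖z‖ N with hc
      have hbc : ‖w‖ ≤ c := le_min h hNw
      rcases hz0.eq_or_lt with hc0 | hc0
      · have : ‖w‖ = 0 := le_antisymm (by rw [hc0]; exact hbc) (norm_nonneg _)
        rw [this, mul_zero]; positivity
      · calc (c ^ β - ‖w‖ ^ β) * ‖w‖ = c ^ β * ‖w‖ - ‖w‖ ^ (β + 1) := by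
              rw [Real.rpow_add_one' (norm_nonneg _) (by linarith)]; ring
          _ ≤ c ^ β * c - ‖w‖ ^ (β + 1) := by gcongr
          _ = c ^ (β + 1) - ‖w‖ ^ (β + 1) := by rw [Real.rpow_add_one hc0.ne']
          _ ≤ (β + 1) * c ^ (β + 1 - 1) * (c - ‖w‖) :=
              rpow_sub_rpow_le (by linarith) (norm_nonneg _) hc0
          _ ≤ (β + 1) * N ^ β * ‖z - w‖ := by
              rw [add_sub_cancel_right]
              have : c - ‖w‖ ≤ ‖z - w‖ :=
                (sub_le_sub_right (min_le_left _ _) _).trans (norm_sub_norm_le z w)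
              have hcN : c ≤ N := min_le_right _ _
              gcongr
  rw [e]
  refine (norm_add_le _ _).trans ?_
  linarith

/-- Truncation makes the duality map `|z|^β z` Lipschitz, so that it acts continuously on `L²` and
the vectors used in the `TT*` argument depend continuously on time. -/
theorem lipschitzWith_truncPow {β N : ℝ} (hβ : 0 < β) (hN : 0 < N) :
    LipschitzWith ((β + 2) * N ^ β).toNNReal (truncPow β N) := by
  refine LipschitzWith.of_dist_le_mul fun z w => ?_
  rw [dist_eq_norm, dist_eq_norm, Real.coe_toNNReal _ (by positivity)]
  rcases le_total ‖w‖ ‖z‖ with h | h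
  · exact norm_truncPow_sub_le hβ hN h
  · rw [norm_sub_rev, norm_sub_rev z]
    exact norm_truncPow_sub_le hβ hN h

variable {m : ℕ}

/-! ### Space-time estimates -/

/-- Superposition with a truncated power. -/
def truncMap {β N : ℝ} (hβ : 0 < β) (hN : 0 < N) : L2 m → L2 m :=
  (lipschitzWith_truncPow hβ hN).compLp (by simp [truncPow])

theorem coeFn_truncMap {β N : ℝ} (hβ : 0 < β) (hN : 0 < N) (f : L2 m) :
    truncMap hβ hN f =ᵐ[volume] fun x => truncPow β N (f x) :=
  (lipschitzWith_truncPow hβ hN).coeFn_compLp _ f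

theorem continuous_truncMap {β N : ℝ} (hβ : 0 < β) (hN : 0 < N) :
    Continuous (truncMap (m := m) hβ hN) :=
  (lipschitzWith_truncPow hβ hN).continuous_compLp _

theorem continuous_isometry_apply {X Y H : Type*} [TopologicalSpace X] [TopologicalSpace Y]
    [NormedAddCommGroup H] [InnerProductSpace ℂ H] {A : X → H ≃ₗᵢ[ℂ] H}
    (hA : ∀ f, Continuous fun t => A t f) {c : Y → X} (hc : Continuous c) {u : Y → H}
    (hu : Continuous u) : Continuous fun y => A (c y) (u y) :=
  (continuous_uncurry_of_isometry hA).comp (hc.prodMk hu)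

theorem continuous_flowE_truncMap (V : LInf m) {β N : ℝ} (hβ : 0 < β) (hN : 0 < N) (f : L2 m) :
    Continuous fun t => flowE V (-t) (truncMap hβ hN (flowE V t f)) := by
  exact continuous_isometry_apply (A := flowE V) (continuous_flowE V) continuous_neg
    ((continuous_truncMap hβ hN).comp (continuous_flowE V f))

theorem ofReal_re_inner_truncMap {β N : ℝ} (hβ : 0 < β) (hN : 0 < N) (f : L2 m) :
    ENNReal.ofReal (inner ℂ f (truncMap hβ hN f) : ℂ).re =
      ∫⁻ x, ENNReal.ofReal (min ‖f x‖ N ^ β * ‖f x‖ ^ 2) := by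
  have hpt : (fun x => (inner ℂ (f x) (truncMap hβ hN f x) : ℂ)) =ᵐ[volume]
      fun x => ((min ‖f x‖ N ^ β * ‖f x‖ ^ 2 : ℝ) : ℂ) := by
    filter_upwards [coeFn_truncMap hβ hN f] with x hx
    rw [hx, truncPow, RCLike.inner_apply, mul_assoc]
    change _ * (f x * (starRingEnd ℂ) (f x)) = _
    rw [Complex.mul_conj, Complex.normSq_eq_norm_sq]
    push_cast; rfl
  have hint : Integrable (fun x => min ‖f x‖ N ^ β * ‖f x‖ ^ 2) := by
    exact ((L2.integrable_inner f (truncMap hβ hN f)).congr hpt).re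
  rw [L2.inner_def, integral_congr_ae hpt, integral_complex_ofReal, Complex.ofReal_re,
    ofReal_integral_eq_lintegral_ofReal hint]
  exact Eventually.of_forall fun x =>
    mul_nonneg (Real.rpow_nonneg (le_min (norm_nonneg _) hN.le) _) (by positivity)

/-- Without truncation `|f|^(r-2) f` has `L^{r'}` norm to the power `r'` equal to `∫ |f|^r`.
Bounding one factor `min(|f|, N)` by `|f|` preserves the useful half of this identity. -/
theorem lqLint_truncMap_le {r N : ℝ} (hr : 0 < r - 2) (hN : 0 < N) (f : L2 m) :
    lqLint (r / (r - 1)) (truncMap hr hN f) ≤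
      ENNReal.ofReal (inner ℂ f (truncMap hr hN f) : ℂ).re := by
  have hr1 : 0 < r - 1 := by linarith
  rw [ofReal_re_inner_truncMap]
  refine lintegral_mono_ae ?_
  filter_upwards [coeFn_truncMap hr hN f] with x hx
  rw [hx, truncPow, ← ofReal_norm, norm_mul, Complex.norm_real]
  have hmin : 0 ≤ min ‖f x‖ N ^ (r - 2) := Real.rpow_nonneg (le_min (norm_nonneg _) hN.le) _
  have hrr : 0 < r := by linarith
  rw [Real.norm_of_nonneg hmin, ENNReal.ofReal_rpow_of_nonneg (by positivity)
    (by positivity)]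
  refine ENNReal.ofReal_le_ofReal ?_
  rcases (norm_nonneg (f x)).eq_or_lt with h0 | h0
  · rw [← h0, mul_zero, Real.zero_rpow (by positivity)]; simp
  · have hmin : 0 < min ‖f x‖ N := lt_min h0 hN
    rw [Real.mul_rpow (by positivity) h0.le, ← Real.rpow_mul hmin.le]
    have e1 : (r - 2) * (r / (r - 1)) = (r - 2) + (r - 2) / (r - 1) := by field_simp; ring
    have e2 : ‖f x‖ ^ 2 = ‖f x‖ ^ ((r - 2) / (r - 1)) * ‖f x‖ ^ (r / (r - 1)) := by
      rw [← Real.rpow_add h0, ← Real.rpow_two]; congr 1; field_simp; ring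
    rw [e1, Real.rpow_add hmin, e2, mul_assoc]
    gcongr
    exact min_le_left _ _

/-- Monotone convergence in the truncation level. It presents the `L^r` norm along the flow as a
supremum of continuous functions of time, which also supplies its measurability. -/
theorem iSup_re_inner_truncMap {r : ℝ} (hr : 0 < r - 2) (f : L2 m) :
    ⨆ n : ℕ, ENNReal.ofReal (inner ℂ f (truncMap hr (n.cast_add_one_pos (α := ℝ)) f) : ℂ).re =
      lqLint r f := by
  have hfm : Measurable fun x => ‖f x‖ := (Lp.stronglyMeasurable f).measurable.norm
  simp only [ofReal_re_inner_truncMap]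
  rw [← lintegral_iSup]
  · refine lintegral_congr fun x => ?_
    have e : ‖f x‖ₑ ^ r = ENNReal.ofReal (‖f x‖ ^ (r - 2) * ‖f x‖ ^ 2) := by
      rw [← ofReal_norm, ENNReal.ofReal_rpow_of_nonneg (norm_nonneg _) (by linarith)]
      rcases (norm_nonneg (f x)).eq_or_lt with h0 | h0
      · rw [← h0, Real.zero_rpow (by linarith)]; simp
      · rw [← Real.rpow_two, ← Real.rpow_add h0, sub_add_cancel]
    rw [e]
    refine le_antisymm (iSup_le fun n => ENNReal.ofReal_le_ofReal ?_) ?_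
    · have : 0 ≤ min ‖f x‖ ((n : ℝ) + 1) := by positivity
      gcongr
      exact min_le_left _ _
    · obtain ⟨n, hn⟩ := exists_nat_ge ‖f x‖
      refine le_trans (le_of_eq ?_) (le_iSup _ n)
      rw [min_eq_left (by linarith)]
  · intro n
    exact (((hfm.min measurable_const).pow_const _).mul (hfm.pow_const 2)).ennreal_ofReal
  · intro n k hnk x
    refine ENNReal.ofReal_le_ofReal ?_
    have : 0 ≤ min ‖f x‖ ((n : ℝ) + 1) := by positivity
    gcongr

theorem norm_inner_le_lqLint {r a b : ℝ} (hr : 2 < r) (ha : 0 ≤ a) (hb : 0 ≤ b) (f g : L2 m)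
    (hf : lqLint (r / (r - 1)) f ≤ ENNReal.ofReal a) (hg : lqLint r g ≤ ENNReal.ofReal b) :
    ‖(inner ℂ f g : ℂ)‖ ≤ a ^ ((r - 1) / r) * b ^ (1 / r) := by
  have hr1 : 0 < r - 1 := by linarith
  have hc : (r / (r - 1)).HolderConjugate r := by
    refine (Real.holderConjugate_iff).2 ⟨?_, ?_⟩
    · rw [lt_div_iff₀ hr1]; linarith
    · field_simp; ring
  rw [L2.inner_def]
  refine (ENNReal.ofReal_le_ofReal_iff (by positivity)).1 ?_
  rw [ofReal_norm]
  refine (enorm_integral_le_lintegral_enorm _).trans ?_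
  have h1 : ∫⁻ x, ‖(inner ℂ (f x) (g x) : ℂ)‖ₑ ≤ ∫⁻ x, ‖f x‖ₑ * ‖g x‖ₑ := by
    refine lintegral_mono fun x => ?_
    rw [← ofReal_norm, ← ofReal_norm, ← ofReal_norm, ← ENNReal.ofReal_mul (norm_nonneg _)]
    exact ENNReal.ofReal_le_ofReal (norm_inner_le_norm _ _)
  refine h1.trans ((ENNReal.lintegral_mul_le_Lp_mul_Lq volume hc
    (Lp.aestronglyMeasurable f).enorm (Lp.aestronglyMeasurable g).enorm).trans ?_)
  rw [ENNReal.ofReal_mul (by positivity), ← ENNReal.ofReal_rpow_of_nonneg ha (by positivity),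
    ← ENNReal.ofReal_rpow_of_nonneg hb (by positivity), one_div_div]
  exact mul_le_mul' (ENNReal.rpow_le_rpow hf (by positivity))
    (ENNReal.rpow_le_rpow hg (by positivity))

/-- The decay exponent `d/2 (1 - 2/r)`. -/
def decayExp (m : ℕ) (r : ℝ) : ℝ := ((m : ℝ) + 1) / 2 * (r - 2) / r

theorem decayExp_pos {r : ℝ} (hr : 2 < r) : 0 < decayExp m r := by
  have : 0 < r - 2 := by linarith
  rw [decayExp]; positivity

set_option maxHeartbeats 800000 in
/-- The weak-type space-time estimate. -/
theorem DispersiveEstimate.exists_measure_le {V : LInf m} (hV : DispersiveEstimate V) {r : ℝ}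
    (hr : 2 < r) (hθ : decayExp m r < 1) : ∃ C : ℝ, 0 < C ∧ ∀ (f : L2 m) (η : ℝ), 0 < η →
      volume {t : ℝ | ENNReal.ofReal (η ^ r) < lqLint r (flowE V t f)} ≤
        ENNReal.ofReal (C * (‖f‖ / η) ^ (2 / decayExp m r)) := by
  obtain ⟨K, hK, h⟩ := hV.exists_lqLint_le hr
  have hθ0 := decayExp_pos (m := m) hr
  set θ := decayExp m r with hθdef
  have h1θ : 0 < 1 - θ := by linarith
  have hr1 : 0 < r - 1 := by linarith
  have hr2 : 0 < r - 2 := by linarith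
  set C₀ := K ^ (1 / r) * (2 / (1 - θ) + 1) with hC₀
  have hC₀' : 0 < C₀ := by positivity
  refine ⟨C₀ ^ (1 / θ), by positivity, fun f η hη => ?_⟩
  set b : ℕ → ℝ → ℝ := fun n t =>
    (inner ℂ (flowE V t f) (truncMap hr2 (n.cast_add_one_pos (α := ℝ)) (flowE V t f)) : ℂ).re
    with hb
  have hbc : ∀ n, Continuous (b n) := fun n =>
    Complex.continuous_re.comp ((continuous_flowE V f).inner
      ((continuous_truncMap _ _).comp (continuous_flowE V f)))
  -- Time window and truncation level grow together. Each set has finite measure, and the sets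
  -- increase to cover the level set, so a bound independent of `n` suffices.
  set E : ℕ → Set ℝ := fun n => {t | t ∈ Set.Icc (-(n : ℝ)) n ∧ η ^ r < b n t} with hE
  have hEm : ∀ n, MeasurableSet (E n) := fun n =>
    measurableSet_Icc.inter (measurableSet_lt measurable_const (hbc n).measurable)
  have hEfin : ∀ n, volume (E n) ≠ ⊤ := fun n =>
    ((measure_mono Set.inter_subset_left).trans_lt measure_Icc_lt_top).ne
  have hbmono : ∀ t, Monotone fun n => ENNReal.ofReal (b n t) := fun t n k hnk => by
    simp only [hb, ofReal_re_inner_truncMap]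
    refine lintegral_mono fun x => ENNReal.ofReal_le_ofReal ?_
    have : 0 ≤ min ‖flowE V t f x‖ ((n : ℝ) + 1) := by positivity
    gcongr
  have hηr : 0 < η ^ r := by positivity
  have hEmono : Monotone E := fun n k hnk t ht => by
    have h1 := hbmono t hnk
    refine ⟨Set.Icc_subset_Icc (by gcongr) (by gcongr) ht.1, ht.2.trans_le ?_⟩
    have h2 : 0 < b n t := hηr.trans ht.2
    rcases le_or_gt (b k t) 0 with h3 | h3
    · simp only [ENNReal.ofReal_of_nonpos h3, nonpos_iff_eq_zero, ENNReal.ofReal_eq_zero] at h1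
      linarith
    · exact (ENNReal.ofReal_le_ofReal_iff h3.le).1 h1
  have hsub : {t : ℝ | ENNReal.ofReal (η ^ r) < lqLint r (flowE V t f)} ⊆ ⋃ n, E n := by
    intro t ht
    have ht : ENNReal.ofReal (η ^ r) < lqLint r (flowE V t f) := ht
    rw [← iSup_re_inner_truncMap hr2, lt_iSup_iff] at ht
    obtain ⟨n, hn⟩ := ht
    obtain ⟨k, hk⟩ := exists_nat_ge |t|
    refine Set.mem_iUnion.2 ⟨max n k, ?_, ?_⟩
    · have : (k : ℝ) ≤ (max n k : ℕ) := by exact_mod_cast le_max_right _ _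
      rw [abs_le] at hk
      exact ⟨by linarith, by linarith⟩
    · have h2 := hn.trans_le (hbmono t (le_max_left n k))
      exact (ENNReal.ofReal_lt_ofReal_iff_of_nonneg hηr.le).1 h2
  have hbound : ∀ n, volume.real (E n) ≤ C₀ ^ (1 / θ) * (‖f‖ / η) ^ (2 / θ) := fun n => by
    set T := truncMap (m := m) hr2 (n.cast_add_one_pos (α := ℝ)) with hT
    -- The exponent `(1 - r) / r` normalizes the dual vector to `L^{r'}` norm at most `1`: its
    -- correlations then decay like `K^(1/r) |t - s|^(-θ)`, while its pairing with `f` is `b n t ^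
    -- (1/r) ≥ η`.
    set F : ℝ → L2 m := fun t =>
      ((b n t ^ ((1 - r) / r) : ℝ) : ℂ) • flowE V (-t) (T (flowE V t f)) with hF
    have hpos : ∀ t ∈ E n, 0 < b n t := fun t ht => hηr.trans ht.2
    have hFc : ContinuousOn F (E n) := by
      refine ContinuousOn.smul (f := fun t => ((b n t ^ ((1 - r) / r) : ℝ) : ℂ)) ?_ ?_
      · refine Complex.continuous_ofReal.comp_continuousOn ?_
        exact ContinuousOn.rpow_const (hbc n).continuousOn fun t ht => Or.inl (hpos t ht).ne'
      · exact (continuous_flowE_truncMap V hr2 _ f).continuousOn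
    have hFb : ∀ t ∈ E n, ‖F t‖ ≤ (η ^ r) ^ ((1 - r) / r) *
        ((((r - 2) + 2) * ((n : ℝ) + 1) ^ (r - 2)).toNNReal * ‖f‖) := fun t ht => by
      rw [hF, norm_smul, Complex.norm_real, Real.norm_of_nonneg (Real.rpow_nonneg (hpos t ht).le _)]
      refine mul_le_mul ?_ ?_ (norm_nonneg _) (by positivity)
      · exact Real.rpow_le_rpow_of_nonpos hηr ht.2.le
          (div_nonpos_of_nonpos_of_nonneg (by linarith) (by linarith))
      · rw [LinearIsometryEquiv.norm_map, ← LinearIsometryEquiv.norm_map (flowE V t) f]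
        exact LipschitzWith.norm_compLp_le _ _ _
    have hFint : IntegrableOn F (E n) :=
      IntegrableOn.of_bound (hEfin n).lt_top (hFc.aestronglyMeasurable (hEm n)) _
        ((ae_restrict_iff' (hEm n)).2 (Eventually.of_forall hFb))
    have hdec : ∀ t ∈ E n, ∀ s ∈ E n, t ≠ s →
        ‖(inner ℂ (F t) (F s) : ℂ)‖ ≤ K ^ (1 / r) * |t - s| ^ (-θ) := fun t ht s hs hts => by
      have h0 : 0 < |t - s| := abs_pos.2 (sub_ne_zero.2 hts)
      have hbt := hpos t ht
      have hbs := hpos s hs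
      have e1 : (inner ℂ (flowE V (-t) (T (flowE V t f))) (flowE V (-s) (T (flowE V s f))) : ℂ) =
          inner ℂ (T (flowE V t f)) (flowE V (t - s) (T (flowE V s f))) := by
        rw [← (flowE V t).inner_map_map, flowE_apply_neg, ← flowE_add, sub_eq_add_neg]
      have h2 := norm_inner_le_lqLint hr hbt.le (b := K * |t - s| ^
          (-(((m : ℝ) + 1) / 2 * (r - 2))) * b n s ^ (r - 1)) (by positivity)
        (T (flowE V t f)) (flowE V (t - s) (T (flowE V s f)))
        (lqLint_truncMap_le hr2 _ _) (h (t - s) (b n s) (sub_ne_zero.2 hts) hbs _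
          (lqLint_truncMap_le hr2 _ _))
      rw [hF, inner_smul_left, inner_smul_right, e1, norm_mul, norm_mul, RCLike.norm_conj,
        Complex.norm_real, Complex.norm_real, Real.norm_of_nonneg (by positivity),
        Real.norm_of_nonneg (by positivity)]
      calc _ ≤ b n t ^ ((1 - r) / r) * (b n s ^ ((1 - r) / r) * (b n t ^ ((r - 1) / r) *
            (K * |t - s| ^ (-(((m : ℝ) + 1) / 2 * (r - 2))) * b n s ^ (r - 1)) ^ (1 / r))) := by
            gcongr
        _ = (b n t ^ ((1 - r) / r) * b n t ^ ((r - 1) / r)) *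
            (b n s ^ ((1 - r) / r) * b n s ^ ((r - 1) / r)) * (K ^ (1 / r) * |t - s| ^ (-θ)) := by
            rw [Real.mul_rpow (by positivity) (by positivity), Real.mul_rpow hK.le (by positivity),
              ← Real.rpow_mul h0.le, ← Real.rpow_mul hbs.le, hθdef, decayExp,
              mul_one_div, mul_one_div, neg_div]
            ring
        _ = _ := by
            rw [← Real.rpow_add hbt, ← Real.rpow_add hbs]
            have : (1 - r) / r + (r - 1) / r = 0 := by field_simp; ring
            rw [this, Real.rpow_zero, Real.rpow_zero, one_mul, one_mul]
    have hlow : ∀ t ∈ E n, η ≤ (inner ℂ f (F t) : ℂ).re := fun t ht => by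
      have hbt := hpos t ht
      have e1 : (inner ℂ f (flowE V (-t) (T (flowE V t f))) : ℂ) =
          inner ℂ (flowE V t f) (T (flowE V t f)) := by
        rw [← (flowE V t).inner_map_map, flowE_apply_neg]
      rw [hF, inner_smul_right, e1, Complex.re_ofReal_mul]
      change η ≤ b n t ^ ((1 - r) / r) * b n t
      rw [← Real.rpow_add_one hbt.ne']
      calc η = (η ^ r) ^ ((1 - r) / r + 1) := by
            rw [← Real.rpow_mul hη.le]
            have : r * ((1 - r) / r + 1) = 1 := by field_simp; ring
            rw [this, Real.rpow_one]
        _ ≤ _ := by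
            have : 0 ≤ (1 - r) / r + 1 := by
              have : (1 - r) / r + 1 = 1 / r := by field_simp; ring
              rw [this]; positivity
            exact Real.rpow_le_rpow hηr.le ht.2.le this
    refine (measureReal_le_of_inner_decay hθ0 hθ (by positivity) hη (hEm n) (hEfin n) hFint hdec f
      hlow).trans (le_of_eq ?_)
    rw [← hC₀, mul_div_assoc, ← div_pow, Real.mul_rpow hC₀'.le (by positivity), ← Real.rpow_two,
      ← Real.rpow_mul (by positivity), mul_one_div]
  refine (measure_mono hsub).trans ?_
  rw [hEmono.measure_iUnion]
  refine iSup_le fun n => ?_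
  rw [← ofReal_measureReal (hEfin n)]
  exact ENNReal.ofReal_le_ofReal (hbound n)

theorem measurable_lqLint_flowE (V : LInf m) {r : ℝ} (hr : 2 < r) (f : L2 m) :
    Measurable fun t => lqLint r (flowE V t f) := by
  have hr2 : 0 < r - 2 := by linarith
  simp only [← iSup_re_inner_truncMap hr2]
  refine Measurable.iSup fun n => Measurable.ennreal_ofReal (Continuous.measurable ?_)
  exact Complex.continuous_re.comp ((continuous_flowE V f).inner
      ((continuous_truncMap _ _).comp (continuous_flowE V f)))

/-- A Strichartz estimate beyond the scaling line, for functions bounded in `L^∞_t L^r_x`. -/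
theorem DispersiveEstimate.exists_mixedNorm_le {V : LInf m} (hV : DispersiveEstimate V) {p r : ℝ}
    (hr : 2 < r) (hθ : decayExp m r < 1) (hp : 2 / decayExp m r < p) :
    ∃ C : ℝ, 0 < C ∧ ∀ (f : L2 m) (S : ℝ), 0 < S →
      (∀ t, lqLint r (flowE V t f) ≤ ENNReal.ofReal (S ^ r)) →
      mixedNorm p r (fun t => flow V t f) ≤ ENNReal.ofReal
        ((C * ‖f‖ ^ (2 / decayExp m r) * S ^ (p - 2 / decayExp m r)) ^ (1 / p)) := by
  obtain ⟨C, hC, h⟩ := hV.exists_measure_le hr hθ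
  have hθ0 := decayExp_pos (m := m) hr
  set q₀ := 2 / decayExp m r with hq₀
  have hq₀0 : 0 < q₀ := by positivity
  have hp0 : 0 < p := hq₀0.trans hp
  have hpq : 0 < p - q₀ := by linarith
  refine ⟨p * C / (p - q₀), by positivity, fun f S hS hfS => ?_⟩
  rw [mixedNorm, ← ENNReal.ofReal_rpow_of_nonneg (by positivity) (by positivity)]
  refine ENNReal.rpow_le_rpow ?_ (by positivity)
  set g : ℝ → ℝ := fun t => (lqLint r (flowE V t f) ^ (1 / r)).toReal with hg
  have hgm : Measurable g := ((measurable_lqLint_flowE V hr f).pow_const _).ennreal_toReal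
  have hfin : ∀ t, lqLint r (flowE V t f) ^ (1 / r) ≤ ENNReal.ofReal S := fun t => by
    refine (ENNReal.rpow_le_rpow (hfS t) (by positivity)).trans (le_of_eq ?_)
    rw [ENNReal.ofReal_rpow_of_nonneg (by positivity) (by positivity), ← Real.rpow_mul hS.le,
      mul_one_div_cancel (by linarith), Real.rpow_one]
  have hgS : ∀ t, g t ≤ S := fun t => ENNReal.toReal_le_of_le_ofReal hS.le (hfin t)
  have e : ∀ t, eLpNorm (flow V t f) (ENNReal.ofReal r) volume ^ p = ENNReal.ofReal (g t ^ p) :=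
    fun t => by
    rw [eLpNorm_eq_lqLint_rpow (by linarith), ← ENNReal.ofReal_rpow_of_nonneg
      ENNReal.toReal_nonneg hp0.le, ENNReal.ofReal_toReal ((hfin t).trans_lt ENNReal.ofReal_lt_top).ne,
      flowE_apply]
  simp only [e]
  rw [lintegral_rpow_eq_lintegral_meas_lt_mul volume
    (Eventually.of_forall fun t => ENNReal.toReal_nonneg) hgm.aemeasurable hp0]
  have hmeas : ∀ s : ℝ, 0 < s → volume {t | s < g t} ≤ ENNReal.ofReal (C * (‖f‖ / s) ^ q₀) :=
    fun s hs => by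
    refine (measure_mono fun t ht => ?_).trans (h f s hs)
    have ht : s < g t := ht
    change ENNReal.ofReal (s ^ r) < lqLint r (flowE V t f)
    have h1 : ENNReal.ofReal s < lqLint r (flowE V t f) ^ (1 / r) :=
      (ENNReal.ofReal_lt_iff_lt_toReal hs.le ((hfin t).trans_lt ENNReal.ofReal_lt_top).ne).2 ht
    have h2 := ENNReal.rpow_lt_rpow h1 (show 0 < r by linarith)
    rwa [← ENNReal.rpow_mul, one_div_mul_cancel (by linarith), ENNReal.rpow_one,
      ENNReal.ofReal_rpow_of_pos hs] at h2
  -- Heights above `S` do not occur. Below `S` the weak-type bound leaves `s^(p - q₀ - 1)`,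
  -- integrable at `0` because `p > q₀`.
  have hpt : ∀ s ∈ Set.Ioi (0 : ℝ), volume {t | s < g t} * ENNReal.ofReal (s ^ (p - 1)) ≤
      (Set.Ioc 0 S).indicator (fun s => ENNReal.ofReal (C * ‖f‖ ^ q₀) *
        ENNReal.ofReal (s ^ (p - q₀ - 1))) s := fun s hs => by
    have hs : 0 < s := hs
    rcases le_or_gt s S with hsS | hsS
    · rw [Set.indicator_of_mem (Set.mem_Ioc.2 ⟨hs, hsS⟩)]
      refine (mul_le_mul_left (hmeas s hs) _).trans (le_of_eq ?_)
      rw [← ENNReal.ofReal_mul (by positivity), ← ENNReal.ofReal_mul (by positivity),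
        Real.div_rpow (norm_nonneg _) hs.le, show p - q₀ - 1 = (p - 1) - q₀ by ring,
        Real.rpow_sub hs (p - 1) q₀]
      congr 1; ring
    · have : {t | s < g t} = ∅ := by
        ext t; simp only [Set.mem_ofPred_eq, Set.mem_empty_iff_false, iff_false, not_lt]
        exact (hgS t).trans hsS.le
      rw [this]; simp
  calc _ ≤ ENNReal.ofReal p * ∫⁻ s in Set.Ioi (0 : ℝ),
        (Set.Ioc 0 S).indicator (fun s => ENNReal.ofReal (C * ‖f‖ ^ q₀) *
        ENNReal.ofReal (s ^ (p - q₀ - 1))) s := by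
        gcongr ENNReal.ofReal p * ?_
        exact setLIntegral_mono' measurableSet_Ioi hpt
    _ ≤ ENNReal.ofReal p * ∫⁻ s,
        (Set.Ioc 0 S).indicator (fun s => ENNReal.ofReal (C * ‖f‖ ^ q₀) *
        ENNReal.ofReal (s ^ (p - q₀ - 1))) s := by
        gcongr ENNReal.ofReal p * ?_
        exact setLIntegral_le_lintegral _ _
    _ = _ := by
        rw [lintegral_indicator measurableSet_Ioc, lintegral_const_mul' _ _ ENNReal.ofReal_ne_top,
          lintegral_rpow_Ioc hpq hS.le, ← ENNReal.ofReal_mul (by positivity),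
          ← ENNReal.ofReal_mul hp0.le]
        congr 1; ring

/-! ### Limits of translated potentials -/

theorem tendsto_apply_of_dense {ι H : Type*} [NormedAddCommGroup H] [NormedSpace ℂ H]
    {l : Filter ι} {A : ι → H →L[ℂ] H} {B : H →L[ℂ] H} {K : ℝ} (hA : ∀ n, ‖A n‖ ≤ K) {D : Set H}
    (hD : Dense D) (h : ∀ f ∈ D, Tendsto (fun n => A n f) l (𝓝 (B f))) (f : H) :
    Tendsto (fun n => A n f) l (𝓝 (B f)) := by
  rw [Metric.tendsto_nhds]
  intro ε hε
  have hK : 0 < |K| + ‖B‖ + 1 := by positivity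
  obtain ⟨f', hf', hd⟩ := hD.exists_dist_lt f (ε := ε / (2 * (|K| + ‖B‖ + 1))) (by positivity)
  filter_upwards [Metric.tendsto_nhds.1 (h f' hf') (ε / 2) (by positivity)] with n hn
  rw [dist_eq_norm] at hn hd ⊢
  have e : A n f - B f = A n (f - f') - B (f - f') + (A n f' - B f') := by
    rw [map_sub, map_sub]; abel
  rw [e]
  have h1 : ‖A n (f - f')‖ ≤ |K| * ‖f - f'‖ :=
    (A n).le_of_opNorm_le ((hA n).trans (le_abs_self K)) _
  have h2 : ‖B (f - f')‖ ≤ ‖B‖ * ‖f - f'‖ := B.le_opNorm _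
  calc _ ≤ ‖A n (f - f')‖ + ‖B (f - f')‖ + ‖A n f' - B f'‖ :=
        (norm_add_le _ _).trans (by gcongr; exact norm_sub_le _ _)
    _ ≤ (|K| + ‖B‖ + 1) * ‖f - f'‖ + ‖A n f' - B f'‖ := by nlinarith [norm_nonneg (f - f')]
    _ < (|K| + ‖B‖ + 1) * (ε / (2 * (|K| + ‖B‖ + 1))) + ε / 2 := by gcongr
    _ = ε := by field_simp; ring

/-- Strong convergence of the translated potentials `V(· + x_n)` to `W`. -/
def PotTendsto {ι : Type*} (V : LInf m) (x : ι → Sp m) (l : Filter ι) (W : LInf m) : Prop :=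
  ∀ f : L2 m, Tendsto (fun n => potMul (shiftPot (x n) V) f) l (𝓝 (potMul W f))

/-- Only local uniform closeness matters: the multipliers are bounded by `‖V‖` and functions
vanishing outside a ball are dense. -/
theorem potTendsto_of_ae_near {ι : Type*} {l : Filter ι} {V : LInf m} {x : ι → Sp m} {W : LInf m}
    (h : ∀ ε > 0, ∀ ρ : ℝ, ∀ᶠ n in l, ∀ᵐ y : Sp m, ‖y‖ ≤ ρ → |V (y + x n) - W y| ≤ ε) :
    PotTendsto V x l W := by
  refine tendsto_apply_of_dense (K := ‖V‖)
    (fun n => (opNorm_potMul_le _).trans (norm_shiftPot _ _).le) (dense_boundedSupport m) ?_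
  rintro f ⟨-, ρ, hρ⟩
  rw [Metric.tendsto_nhds]
  intro ε hε
  filter_upwards [h (ε / (‖f‖ + 1)) (by positivity) ρ] with n hn
  have h1 : ‖potMul (shiftPot (x n) V) f - potMul W f‖ ≤ ε / (‖f‖ + 1) * ‖f‖ := by
    refine Lp.norm_le_mul_norm_of_ae_le_mul ?_
    filter_upwards [hn, hρ, Lp.coeFn_sub (potMul (shiftPot (x n) V) f) (potMul W f),
      coeFn_potMul (shiftPot (x n) V) f, coeFn_potMul W f, coeFn_shiftPot (x n) V]
      with y a b c d e g
    rw [c, Pi.sub_apply, d, e, g, ← sub_mul, norm_mul, ← Complex.ofReal_sub, Complex.norm_real]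
    rcases le_total ρ ‖y‖ with hy | hy
    · rw [b hy]; simp
    · exact mul_le_mul_of_nonneg_right (a hy) (norm_nonneg _)
  rw [dist_eq_norm]
  refine h1.trans_lt ?_
  rw [div_mul_eq_mul_div, div_lt_iff₀ (by positivity)]
  nlinarith [norm_nonneg f]

/-- Constant potentials. -/
def constPot (m : ℕ) (c : ℝ) : LInf m := (memLp_top_const c : MemLp (fun _ : Sp m => c) ∞ volume).toLp _

theorem coeFn_constPot (c : ℝ) : constPot m c =ᵐ[volume] fun _ => c :=
  MemLp.coeFn_toLp _

theorem abs_apply_zero_le (y : Sp m) : |y 0| ≤ ‖y‖ := by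
  simpa using PiLp.norm_apply_le y 0

theorem IsSteplike.potTendsto_atTop {V : LInf m} (hV : IsSteplike V) {ι : Type*} {l : Filter ι}
    {x : ι → Sp m} (hx : Tendsto (fun n => x n 0) l atTop) :
    PotTendsto V x l (constPot m 1) := by
  refine potTendsto_of_ae_near fun ε hε ρ => ?_
  obtain ⟨R, hR⟩ := hV ε hε
  filter_upwards [hx.eventually_ge_atTop (R + ρ)] with n hn
  filter_upwards [(measurePreserving_add_right (volume : Measure (Sp m))
    (x n)).quasiMeasurePreserving.ae hR, coeFn_constPot (m := m) 1] with y hy h1 hyρ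
  rw [h1]
  refine hy.2 ?_
  have := (abs_le.1 ((abs_apply_zero_le y).trans hyρ)).1
  rw [PiLp.add_apply]; linarith

theorem IsSteplike.potTendsto_atBot {V : LInf m} (hV : IsSteplike V) {ι : Type*} {l : Filter ι}
    {x : ι → Sp m} (hx : Tendsto (fun n => x n 0) l atBot) :
    PotTendsto V x l (constPot m 0) := by
  refine potTendsto_of_ae_near fun ε hε ρ => ?_
  obtain ⟨R, hR⟩ := hV ε hε
  filter_upwards [hx.eventually_le_atBot (-R - ρ)] with n hn
  filter_upwards [(measurePreserving_add_right (volume : Measure (Sp m))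
    (x n)).quasiMeasurePreserving.ae hR, coeFn_constPot (m := m) 0] with y hy h1 hyρ
  rw [h1, sub_zero]
  refine hy.1 ?_
  have := (abs_le.1 ((abs_apply_zero_le y).trans hyρ)).2
  rw [PiLp.add_apply]; linarith

theorem shiftPot_zero (V : LInf m) : shiftPot 0 V = V :=
  Lp.ext (by filter_upwards [coeFn_shiftPot 0 V] with x hx; rw [hx, add_zero])

theorem IsPeriodicPotential.shiftPot_eq {P : Fin m → EuclideanSpace ℝ (Fin m)} {V : LInf m}
    (hV : IsPeriodicPotential P V) (k : Fin m → ℤ) :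
    shiftPot (splitPoint 0 (∑ l, k l • P l)) V = V := by
  refine Lp.ext ?_
  filter_upwards [coeFn_shiftPot (splitPoint 0 (∑ l, k l • P l)) V, hV k] with x h1 h2
  rw [h1, h2]

theorem potTendsto_of_eq {ι : Type*} {l : Filter ι} {V : LInf m} {x : ι → Sp m}
    (h : ∀ n, shiftPot (x n) V = V) : PotTendsto V x l V := fun f => by
  simp only [h]; exact tendsto_const_nhds

/-! ### Moving frames -/

/-- The profile `ψ` moved to position `x` and evolved for the time `t`. -/
def pushE (V : LInf m) (t : ℝ) (x : Sp m) : L2 m ≃ₗᵢ[ℂ] L2 m := (transE x).trans (flowE V t)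

/-- The inverse of `pushE`. -/
def pullE (V : LInf m) (t : ℝ) (x : Sp m) : L2 m ≃ₗᵢ[ℂ] L2 m :=
  (flowE V (-t)).trans (transE (-x))

theorem pushE_apply (V : LInf m) (t : ℝ) (x : Sp m) (f : L2 m) :
    pushE V t x f = flowE V t (transE x f) := rfl

theorem pullE_apply (V : LInf m) (t : ℝ) (x : Sp m) (f : L2 m) :
    pullE V t x f = transE (-x) (flowE V (-t) f) := rfl

theorem transE_neg_apply (x : Sp m) (f : L2 m) : transE (-x) (transE x f) = f := by
  rw [← transE_add, neg_add_cancel, transE_zero]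

theorem transE_apply_neg (x : Sp m) (f : L2 m) : transE x (transE (-x) f) = f := by
  rw [← transE_add, add_neg_cancel, transE_zero]

theorem pullE_pushE (V : LInf m) (t : ℝ) (x : Sp m) (f : L2 m) :
    pullE V t x (pushE V t x f) = f := by
  rw [pullE_apply, pushE_apply, flowE_neg_apply, transE_neg_apply]

theorem pushE_pullE (V : LInf m) (t : ℝ) (x : Sp m) (f : L2 m) :
    pushE V t x (pullE V t x f) = f := by
  rw [pullE_apply, pushE_apply, transE_apply_neg, flowE_apply_neg]

/-- Frame changes depend on the times only through their difference, and on the absolute position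
only through the shifted potential. This is what makes strong limits of frame changes available. -/
theorem pullE_pushE_eq (V : LInf m) (t s : ℝ) (x y : Sp m) (f : L2 m) :
    pullE V t x (pushE V s y f) = transE (y - x) (flowE (shiftPot y V) (s - t) f) := by
  rw [pullE_apply, pushE_apply, ← flowE_add, flowE_transE, ← transE_add]
  rw [neg_add_eq_sub, neg_add_eq_sub]

theorem inner_pushE_left (V : LInf m) (t : ℝ) (x : Sp m) (f g : L2 m) :
    (inner ℂ (pushE V t x f) g : ℂ) = inner ℂ f (pullE V t x g) := by
  rw [← (pushE V t x).inner_map_map f, pushE_pullE]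

theorem tendsto_isometry_apply {ι X H : Type*} [TopologicalSpace X] [NormedAddCommGroup H]
    [InnerProductSpace ℂ H] {l : Filter ι} {A : X → H ≃ₗᵢ[ℂ] H}
    (hA : ∀ f, Continuous fun t => A t f) {c : ι → X} {c₀ : X} (hc : Tendsto c l (𝓝 c₀))
    {u : ι → H} {u₀ : H} (hu : Tendsto u l (𝓝 u₀)) :
    Tendsto (fun n => A (c n) (u n)) l (𝓝 (A c₀ u₀)) :=
  ((continuous_uncurry_of_isometry hA).tendsto (c₀, u₀)).comp (hc.prodMk_nhds hu)

/-- Strong limits of frame changes with convergent parameters. -/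
theorem tendsto_pullE_pushE {ι : Type*} {l : Filter ι} {V W : LInf m} {t s : ι → ℝ} {x y : ι → Sp m}
    (hW : PotTendsto V y l W) {τ : ℝ} {z : Sp m} (hτ : Tendsto (fun n => s n - t n) l (𝓝 τ))
    (hz : Tendsto (fun n => y n - x n) l (𝓝 z)) (f : L2 m) :
    Tendsto (fun n => pullE V (t n) (x n) (pushE V (s n) (y n) f)) l
      (𝓝 (transE z (flowE W τ f))) := by
  simp only [pullE_pushE_eq]
  have h1 := tendsto_flowE (K := ‖V‖) (fun n => (norm_shiftPot (y n) V).le) hW hτ f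
  exact tendsto_isometry_apply continuous_transE hz h1

/-- Weak limits in frames at bounded distance are related by a unitary operator. -/
theorem WeakTendsto.change_frame {ι : Type*} {l : Filter ι} {V W : LInf m} {t s : ι → ℝ}
    {x y : ι → Sp m} (hW : PotTendsto V y l W) {τ : ℝ} {z : Sp m}
    (hτ : Tendsto (fun n => s n - t n) l (𝓝 τ)) (hz : Tendsto (fun n => y n - x n) l (𝓝 z))
    {u : ι → L2 m} {φ : L2 m} {C : ℝ} (hu : ∀ n, ‖u n‖ ≤ C)
    (h : WeakTendsto (fun n => pullE V (t n) (x n) (u n)) l φ) :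
    WeakTendsto (fun n => pullE V (s n) (y n) (u n)) l (flowE W (-τ) (transE (-z) φ)) := by
  have hB : ∀ g, transE z (flowE W τ g) =
      ((transE (-z)).trans (flowE W (-τ)) : L2 m ≃ₗᵢ[ℂ] L2 m).symm g := fun g => by
    rw [LinearIsometryEquiv.symm_trans, transE_symm, flowE_symm, neg_neg, neg_neg]; rfl
  have hA : ∀ n g, ((pushE V (t n) (x n)).trans (pullE V (s n) (y n))).symm g =
      pullE V (t n) (x n) (pushE V (s n) (y n) g) := fun n g => by
    rw [LinearIsometryEquiv.symm_apply_eq, LinearIsometryEquiv.trans_apply, pushE_pullE,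
      pullE_pushE]
  have := h.map_isometry (C := C) (fun n => by rw [LinearIsometryEquiv.norm_map]; exact hu n)
    (A := fun n => (pushE V (t n) (x n)).trans (pullE V (s n) (y n)))
    (B := (transE (-z)).trans (flowE W (-τ))) (fun g => by
      simp only [hA, ← hB]; exact tendsto_pullE_pushE hW hτ hz g)
  refine this.congr fun n => ?_
  rw [LinearIsometryEquiv.trans_apply, pushE_pullE]

/-- Profiles disappear in frames that move away from theirs. -/
theorem weakTendsto_pullE_pushE {ι : Type*} {𝒰 : Ultrafilter ι} {V W : LInf m}
    (hV : DispersiveEstimate V) {t s : ι → ℝ} {x y : ι → Sp m} (hW : PotTendsto V y 𝒰 W)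
    (hd : Tendsto (fun n => ‖x n - y n‖ + |t n - s n|) 𝒰 atTop) (f : L2 m) :
    WeakTendsto (fun n => pullE V (t n) (x n) (pushE V (s n) (y n) f)) 𝒰 0 := by
  -- Either the times separate, and dispersion acts uniformly in the positions, or the time
  -- differences converge along `𝒰` and the positions must separate.
  rcases 𝒰.tendsto_atTop_or_le fun n => |s n - t n| with h | ⟨C, hC⟩
  · intro g
    rw [inner_zero_right, tendsto_zero_iff_norm_tendsto_zero, Metric.tendsto_nhds]
    intro ε hε
    filter_upwards [eventually_inner_flowE_lt hV h g f hε] with n hn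
    rw [dist_zero_right, norm_norm, ← inner_pushE_left, pushE_apply, pushE_apply,
      ← (flowE V (-t n)).inner_map_map, flowE_neg_apply, ← flowE_add, neg_add_eq_sub]
    exact hn _ _
  · obtain ⟨τ, hτ⟩ := 𝒰.exists_tendsto_of_norm_le (f := fun n => s n - t n) hC
    have hz : Tendsto (fun n => ‖y n - x n‖) 𝒰 atTop := by
      refine tendsto_atTop_mono' _ ?_ (tendsto_atTop_add_const_right _ (-C) hd)
      filter_upwards [hC] with n hn
      have h1 := norm_sub_rev (x n) (y n)
      have h2 := abs_sub_comm (t n) (s n)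
      linarith
    simp only [pullE_pushE_eq]
    have h1 := tendsto_flowE (K := ‖V‖) (fun n => (norm_shiftPot (y n) V).le) hW hτ f
    have h2 := weakTendsto_transE hz (flowE W τ f)
    intro g
    -- The evolved profile converges strongly to the evolution under `W`; the translations are
    -- isometric, so the limit may be inserted before using that translates of a fixed function
    -- vanish weakly.
    have h3 : Tendsto (fun n => (inner ℂ g (transE (y n - x n)
        (flowE (shiftPot (y n) V) (s n - t n) f - flowE W τ f)) : ℂ)) 𝒰 (𝓝 0) := by
      refine squeeze_zero_norm (a := fun n => ‖g‖ *
        ‖flowE (shiftPot (y n) V) (s n - t n) f - flowE W τ f‖) (fun n => ?_) ?_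
      · refine (norm_inner_le_norm _ _).trans ?_
        rw [LinearIsometryEquiv.norm_map]
      · have := (tendsto_iff_norm_sub_tendsto_zero.1 h1).const_mul ‖g‖
        simpa using this
    have h4 := h3.add (h2 g)
    rw [zero_add] at h4
    refine h4.congr fun n => ?_
    rw [map_sub, inner_sub_right, sub_add_cancel]

/-! ### Asymptotic orthogonality for quadratic forms -/

theorem weakPartial_add {f g : L2 m} (hf : dirichlet f < ⊤) (hg : dirichlet g < ⊤)
    (i : Fin (m + 1)) : weakPartial i (f + g) = weakPartial i f + weakPartial i g := by
  refine fourier_injective (Lp.ext ?_)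
  filter_upwards [coeFn_fourier_weakPartial (dirichlet_add hf hg) i,
    coeFn_fourier_weakPartial hf i, coeFn_fourier_weakPartial hg i, coeFn_fourier_add f g,
    coeFn_fourier_add (weakPartial i f) (weakPartial i g)] with ξ h1 h2 h3 h4 h5
  rw [h1, h5, h2, h3, h4]; ring

theorem norm_sq_weakPartial_le (f : L2 m) (i : Fin (m + 1)) :
    ‖weakPartial i f‖ ^ 2 ≤ gradNormSq f :=
  Finset.single_le_sum (f := fun i => ‖weakPartial i f‖ ^ 2) (fun _ _ => by positivity)
    (Finset.mem_univ i)

theorem lowPass_weakPartial {f : L2 m} (hf : dirichlet f < ⊤) (R : ℝ) (i : Fin (m + 1)) :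
    lowPass R (weakPartial i f) =
      Complex.I • fMul (cutoff (fun ξ : Sp m => 2 * Real.pi * ξ i) (by fun_prop) R) f := by
  refine fourier_injective (Lp.ext ?_)
  have hs : (𝓕 (Complex.I • fMul (cutoff (fun ξ : Sp m => 2 * Real.pi * ξ i) (by fun_prop) R) f) :
      L2 m) = Complex.I • 𝓕 (fMul (cutoff (fun ξ : Sp m => 2 * Real.pi * ξ i) (by fun_prop) R) f) :=
    (fourE m).map_smul _ _
  simp only [hs]
  filter_upwards [coeFn_fourier_lowPass R (weakPartial i f), coeFn_fourier_weakPartial hf i,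
    coeFn_fourier_fMul (cutoff (fun ξ : Sp m => 2 * Real.pi * ξ i) (by fun_prop) R) f,
    coeFn_cutoff (a := fun ξ : Sp m => 2 * Real.pi * ξ i) (by fun_prop) R,
    Lp.coeFn_smul Complex.I (𝓕 (fMul (cutoff (fun ξ : Sp m => 2 * Real.pi * ξ i)
      (by fun_prop) R) f) : L2 m)] with ξ h1 h2 h3 h4 h5
  rw [h1, h5, Pi.smul_apply, h3, h4]
  by_cases h : ξ ∈ Metric.ball (0 : Sp m) R
  · rw [Set.indicator_of_mem h, Set.indicator_of_mem h, h2, smul_eq_mul]; push_cast; ring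
  · rw [Set.indicator_of_notMem h, Set.indicator_of_notMem h]; simp

/-- Against a band-limited test function the derivative moves over as a bounded multiplier, so weak
`L²` convergence suffices; such functions are dense and the derivatives are bounded. -/
theorem WeakTendsto.weakPartial {ι : Type*} {l : Filter ι} {a : ι → L2 m} {N : ℝ}
    (hN : 0 ≤ N) (ha : ∀ n, H1Bound N (a n)) (h : WeakTendsto a l 0) (i : Fin (m + 1)) :
    WeakTendsto (fun n => weakPartial i (a n)) l 0 := by
  have hD : Dense (Set.range fun p : ℕ × L2 m => lowPass (p.1 : ℝ) p.2) := fun f => by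
    refine mem_closure_of_tendsto (tendsto_lowPass f) (Eventually.of_forall fun n => ?_)
    exact ⟨(n, f), rfl⟩
  refine WeakTendsto.of_dense (C := N) (fun n => ?_) hD ?_
  · have h1 := (norm_sq_weakPartial_le (a n) i)
    have h2 := (ha n).2
    have h3 := sq_nonneg ‖a n‖
    exact (abs_le_of_sq_le_sq' (by linarith) hN).2
  · rintro _ ⟨⟨R, g⟩, rfl⟩
    have e : ∀ n, (inner ℂ (lowPass (R : ℝ) g) (_root_.weakPartial i (a n)) : ℂ) = Complex.I *
        inner ℂ (fMul (cutoff (fun ξ : Sp m => 2 * Real.pi * ξ i) (by fun_prop) R) g) (a n) :=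
      fun n => by
      have h1 := lowPass_weakPartial (ha n).1 R i
      rw [lowPass] at h1 ⊢
      rw [inner_fMul_left, h1, inner_smul_right, inner_fMul_left]
    simp only [e]
    have := (h (fMul (cutoff (fun ξ : Sp m => 2 * Real.pi * ξ i) (by fun_prop) R) g)).const_mul
      Complex.I
    simpa using this

theorem norm_add_sq_complex (f g : L2 m) :
    ‖f + g‖ ^ 2 = ‖f‖ ^ 2 + ‖g‖ ^ 2 + 2 * (inner ℂ f g : ℂ).re := by
  have := norm_add_sq (𝕜 := ℂ) f g
  simp only [RCLike.re_to_complex] at this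
  linarith

theorem WeakTendsto.tendsto_norm_sq {ι : Type*} {l : Filter ι} {a : ι → L2 m}
    (h : WeakTendsto a l 0) (ψ : L2 m) :
    Tendsto (fun n => ‖ψ + a n‖ ^ 2 - (‖ψ‖ ^ 2 + ‖a n‖ ^ 2)) l (𝓝 0) := by
  have h1 := ((Complex.continuous_re.tendsto _).comp (h ψ)).const_mul 2
  rw [inner_zero_right, Complex.zero_re, mul_zero] at h1
  refine h1.congr fun n => ?_
  rw [norm_add_sq_complex, Function.comp_apply]; ring

theorem WeakTendsto.tendsto_gradNormSq {ι : Type*} {l : Filter ι} {a : ι → L2 m} {N : ℝ}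
    (hN : 0 ≤ N) (ha : ∀ n, H1Bound N (a n)) (h : WeakTendsto a l 0) {ψ : L2 m}
    (hψ : dirichlet ψ < ⊤) :
    Tendsto (fun n => gradNormSq (ψ + a n) - (gradNormSq ψ + gradNormSq (a n))) l (𝓝 0) := by
  have h1 : Tendsto (fun n => ∑ i, (‖_root_.weakPartial i ψ + _root_.weakPartial i (a n)‖ ^ 2 -
      (‖_root_.weakPartial i ψ‖ ^ 2 + ‖_root_.weakPartial i (a n)‖ ^ 2))) l
      (𝓝 (∑ _i : Fin (m + 1), 0)) :=
    tendsto_finsetSum _ fun i _ => (h.weakPartial hN ha i).tendsto_norm_sq _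
  rw [Finset.sum_const_zero] at h1
  refine h1.congr fun n => ?_
  simp only [gradNormSq, weakPartial_add hψ (ha n).1, Finset.sum_sub_distrib,
    Finset.sum_add_distrib]

theorem energyNormSq_transE (V : LInf m) (z : Sp m) {f : L2 m} (hf : dirichlet f < ⊤) :
    energyNormSq V (transE z f) = energyNormSq (shiftPot z V) f := by
  rw [energyNormSq_eq, energyNormSq_eq, gradNormSq_transE z hf, ← transE_potMul_shiftPot,
    LinearIsometryEquiv.inner_map_map]

/-- The cross term of the potential energy pairs `V(· + x n) ψ`, which converges strongly, with the
weakly null `a n`. -/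
theorem WeakTendsto.tendsto_energyNormSq {ι : Type*} {l : Filter ι} {a : ι → L2 m} {N : ℝ}
    (hN : 0 ≤ N) (ha : ∀ n, H1Bound N (a n)) (h : WeakTendsto a l 0) {ψ : L2 m}
    (hψ : dirichlet ψ < ⊤) {V W : LInf m} {x : ι → Sp m} (hW : PotTendsto V x l W) :
    Tendsto (fun n => energyNormSq (shiftPot (x n) V) (ψ + a n) -
      (energyNormSq (shiftPot (x n) V) ψ + energyNormSq (shiftPot (x n) V) (a n))) l (𝓝 0) := by
  have h1 := h.inner_left (fun n => (ha n).norm_le hN) (hW ψ)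
  have h2 := ((Complex.continuous_re.tendsto _).comp h1).const_mul 2
  rw [inner_zero_right, Complex.zero_re, mul_zero] at h2
  have h3 := (h.tendsto_gradNormSq hN ha hψ).add h2
  rw [add_zero] at h3
  refine h3.congr fun n => ?_
  simp only [energyNormSq_eq, map_add, inner_add_left, inner_add_right, Complex.add_re,
    Function.comp_apply]
  have e : (inner ℂ (a n) (potMul (shiftPot (x n) V) ψ) : ℂ).re =
      (inner ℂ (potMul (shiftPot (x n) V) ψ) (a n) : ℂ).re := by
    rw [← inner_conj_symm, Complex.conj_re]
  rw [e, inner_potMul_left]; ring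

theorem abs_re_inner_potMul_le (V : LInf m) (f : L2 m) :
    |(inner ℂ f (potMul V f) : ℂ).re| ≤ ‖V‖ * ‖f‖ ^ 2 := by
  refine (Complex.abs_re_le_norm _).trans ((norm_inner_le_norm _ _).trans ?_)
  have := norm_potMul_le V f
  nlinarith [norm_nonneg f]

/-- The flow conserves the `L²` norm and the energy norm, and the potential energy is at most `‖V‖
‖f‖²`. The resulting bound is uniform in time and does not use the sign of `V`. -/
theorem H1Bound.flowE {N : ℝ} {f : L2 m} (h : H1Bound N f) (V : LInf m) (t : ℝ) :
    H1Bound ((1 + 2 * ‖V‖) * N) (flowE V t f) := by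
  refine ⟨dirichlet_flowE V t h.1, ?_⟩
  have h1 := energyNormSq_flowE V t h.1
  rw [energyNormSq_eq, energyNormSq_eq] at h1
  have h2 := (abs_le.1 (abs_re_inner_potMul_le V f)).2
  have h3 := (abs_le.1 (abs_re_inner_potMul_le V (_root_.flowE V t f))).1
  rw [LinearIsometryEquiv.norm_map] at h3 ⊢
  have h4 := h.2
  have h5 := gradNormSq_nonneg f
  have h6 := norm_nonneg V
  have h7 : ‖f‖ ^ 2 ≤ N ^ 2 := by linarith
  nlinarith [mul_le_mul_of_nonneg_left h7 h6, mul_nonneg h6 (mul_nonneg h6 (sq_nonneg N)), sq_nonneg N,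
    mul_nonneg h6 (sq_nonneg N)]

theorem H1Bound.pullE {N : ℝ} {f : L2 m} (h : H1Bound N f) (V : LInf m) (t : ℝ) (x : Sp m) :
    H1Bound ((1 + 2 * ‖V‖) * N) (pullE V t x f) := (h.flowE V (-t)).transE (-x)

/-! ### Asymptotic orthogonality in `L^q` -/

/-- The `L^q` norm on a set. -/
def lqSeminorm (q : ℝ) (A : Set (Sp m)) (f : L2 m) : ℝ :=
  (eLpNorm f (ENNReal.ofReal q) (volume.restrict A)).toReal

theorem eLpNorm_restrict_rpow {q : ℝ} (hq : 0 < q) (A : Set (Sp m)) (f : L2 m) :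
    eLpNorm f (ENNReal.ofReal q) (volume.restrict A) ^ q = ∫⁻ x in A, ‖f x‖ₑ ^ q := by
  rw [eLpNorm_eq_lintegral_rpow_enorm_toReal (by simpa using hq) ENNReal.ofReal_ne_top,
    ENNReal.toReal_ofReal hq.le, ← ENNReal.rpow_mul, one_div_mul_cancel hq.ne', ENNReal.rpow_one]

theorem lqSeminorm_rpow {q : ℝ} (hq : 0 < q) (A : Set (Sp m)) (f : L2 m) :
    lqSeminorm q A f ^ q = (∫⁻ x in A, ‖f x‖ₑ ^ q).toReal := by
  rw [lqSeminorm, ENNReal.toReal_rpow, eLpNorm_restrict_rpow hq]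

theorem lqNormPow_eq_add {q : ℝ} (hq : 0 < q) {A : Set (Sp m)} (hA : MeasurableSet A) {f : L2 m}
    (hf : lqLint q f ≠ ⊤) :
    lqNormPow q f = lqSeminorm q A f ^ q + lqSeminorm q Aᶜ f ^ q := by
  rw [lqNormPow_eq hq, lqSeminorm_rpow hq, lqSeminorm_rpow hq, ← ENNReal.toReal_add]
  · congr 1
    exact (lintegral_add_compl _ hA).symm
  · exact ((setLIntegral_le_lintegral _ _).trans_lt hf.lt_top).ne
  · exact ((setLIntegral_le_lintegral _ _).trans_lt hf.lt_top).ne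

theorem lqSeminorm_nonneg (q : ℝ) (A : Set (Sp m)) (f : L2 m) : 0 ≤ lqSeminorm q A f :=
  ENNReal.toReal_nonneg

theorem memLp_of_lqLint {q : ℝ} (hq : 0 < q) {f : L2 m} (hf : lqLint q f ≠ ⊤) :
    MemLp f (ENNReal.ofReal q) volume := by
  refine ⟨Lp.aestronglyMeasurable f, ?_⟩
  rw [eLpNorm_eq_lqLint_rpow hq]
  exact ENNReal.rpow_lt_top_of_nonneg (by positivity) hf

theorem lqSeminorm_mono {q : ℝ} (hq : 0 < q) (A : Set (Sp m)) {f : L2 m} (hf : lqLint q f ≠ ⊤) :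
    lqSeminorm q A f ≤ lqSeminorm q Set.univ f := by
  rw [lqSeminorm, lqSeminorm, Measure.restrict_univ]
  exact ENNReal.toReal_mono (memLp_of_lqLint hq hf).2.ne
    (eLpNorm_mono_measure _ Measure.restrict_le_self)

theorem abs_lqSeminorm_add_sub_le {q : ℝ} (hq : 1 ≤ q) (A : Set (Sp m)) {f g : L2 m}
    (hf : lqLint q f ≠ ⊤) (hg : lqLint q g ≠ ⊤) :
    |lqSeminorm q A (f + g) - lqSeminorm q A f| ≤ lqSeminorm q A g := by
  have hq0 : 0 < q := by linarith
  have hq1 : 1 ≤ ENNReal.ofReal q := by rwa [ENNReal.one_le_ofReal]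
  have hfm := (memLp_of_lqLint hq0 hf).restrict A
  have hgm := (memLp_of_lqLint hq0 hg).restrict A
  have e : eLpNorm (f + g : L2 m) (ENNReal.ofReal q) (volume.restrict A) =
      eLpNorm ((f : Sp m → ℂ) + (g : Sp m → ℂ)) (ENNReal.ofReal q) (volume.restrict A) :=
    eLpNorm_congr_ae (ae_restrict_of_ae (Lp.coeFn_add f g))
  simp only [lqSeminorm, e]
  rw [abs_le]
  constructor
  · have h1 : eLpNorm f (ENNReal.ofReal q) (volume.restrict A) ≤
        eLpNorm ((f : Sp m → ℂ) + (g : Sp m → ℂ)) (ENNReal.ofReal q) (volume.restrict A) +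
          eLpNorm g (ENNReal.ofReal q) (volume.restrict A) := by
      have := eLpNorm_sub_le (hfm.add hgm).1 hgm.1 hq1
      rwa [add_sub_cancel_right] at this
    have h2 := ENNReal.toReal_mono (ENNReal.add_ne_top.2 ⟨(hfm.add hgm).2.ne, hgm.2.ne⟩) h1
    rw [ENNReal.toReal_add (hfm.add hgm).2.ne hgm.2.ne] at h2
    linarith
  · have h1 := eLpNorm_add_le hfm.1 hgm.1 hq1
    have h2 := ENNReal.toReal_mono (ENNReal.add_ne_top.2 ⟨hfm.2.ne, hgm.2.ne⟩) h1
    rw [ENNReal.toReal_add hfm.2.ne hgm.2.ne] at h2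
    linarith

/-- The map `s ↦ s^q` is uniformly continuous on bounded sets. -/
theorem exists_abs_rpow_sub_rpow_le {q K ε : ℝ} (hq : 1 ≤ q) (hε : 0 < ε) :
    ∃ δ > 0, ∀ a b : ℝ, 0 ≤ a → 0 ≤ b → a ≤ K → b ≤ K → |a - b| ≤ δ → |a ^ q - b ^ q| ≤ ε := by
  have hc : ContinuousOn (fun s : ℝ => s ^ q) (Set.Icc 0 K) :=
    (Real.continuous_rpow_const (by linarith)).continuousOn
  have hu := isCompact_Icc.uniformContinuousOn_of_continuous hc
  rw [Metric.uniformContinuousOn_iff] at hu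
  obtain ⟨δ, hδ, h⟩ := hu ε hε
  refine ⟨δ / 2, by positivity, fun a b ha hb haK hbK hab => ?_⟩
  have := h a ⟨ha, haK⟩ b ⟨hb, hbK⟩ (by rw [Real.dist_eq]; linarith)
  rw [Real.dist_eq] at this
  exact this.le

theorem lqNormPow_eq_lqSeminorm (q : ℝ) (f : L2 m) :
    lqNormPow q f = lqSeminorm q Set.univ f ^ q := by
  rw [lqSeminorm, Measure.restrict_univ]; rfl

/-- Adding a sequence that is small in `L^q` does not change `L^q` norms asymptotically. -/
theorem tendsto_lqNormPow_add_of_tendsto_zero {ι : Type*} {l : Filter ι} {q : ℝ} (hq : 1 ≤ q)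
    {f g : ι → L2 m} {K : ℝ} (hf : ∀ n, lqLint q (f n) ≤ ENNReal.ofReal K)
    (hg : ∀ n, lqLint q (g n) ≤ ENNReal.ofReal K)
    (h0 : Tendsto (fun n => lqLint q (g n)) l (𝓝 0)) :
    Tendsto (fun n => lqNormPow q (g n + f n) - (lqNormPow q (g n) + lqNormPow q (f n))) l
      (𝓝 0) := by
  have hq0 : 0 < q := by linarith
  have hK : ∀ u : L2 m, lqLint q u ≤ ENNReal.ofReal K →
      lqSeminorm q Set.univ u ≤ |K| ^ (1 / q) := fun u hu => by
    have h1 : lqSeminorm q Set.univ u ^ q ≤ |K| := by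
      rw [← lqNormPow_eq_lqSeminorm, lqNormPow_eq hq0]
      exact ENNReal.toReal_le_of_le_ofReal (abs_nonneg _)
        (hu.trans (ENNReal.ofReal_le_ofReal (le_abs_self K)))
    calc _ = (lqSeminorm q Set.univ u ^ q) ^ (1 / q) := by
          rw [← Real.rpow_mul (lqSeminorm_nonneg _ _ _), mul_one_div_cancel hq0.ne', Real.rpow_one]
      _ ≤ _ := Real.rpow_le_rpow (Real.rpow_nonneg (lqSeminorm_nonneg _ _ _) _) h1 (by positivity)
  have hgt : Tendsto (fun n => lqNormPow q (g n)) l (𝓝 0) := by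
    simp only [lqNormPow_eq hq0]
    exact (ENNReal.tendsto_toReal ENNReal.zero_ne_top).comp h0
  have hgs : Tendsto (fun n => lqSeminorm q Set.univ (g n)) l (𝓝 0) := by
    have h1 : Tendsto (fun n => lqNormPow q (g n) ^ (1 / q)) l (𝓝 (0 ^ (1 / q))) :=
      hgt.rpow_const (Or.inr (by positivity))
    rw [Real.zero_rpow (by positivity)] at h1
    refine h1.congr fun n => ?_
    rw [lqNormPow_eq_lqSeminorm, ← Real.rpow_mul (lqSeminorm_nonneg _ _ _),
      mul_one_div_cancel hq0.ne', Real.rpow_one]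
  have hmain : Tendsto (fun n => lqNormPow q (g n + f n) - lqNormPow q (f n)) l (𝓝 0) := by
    rw [Metric.tendsto_nhds]
    intro ε hε
    obtain ⟨δ, hδ, h⟩ := exists_abs_rpow_sub_rpow_le (q := q) (K := 2 * |K| ^ (1 / q))
      (ε := ε / 2) hq (by positivity)
    filter_upwards [hgs.eventually_le_const hδ] with n hn
    have hfn := hK _ (hf n)
    have hgn := hK _ (hg n)
    have h1 := abs_lqSeminorm_add_sub_le hq Set.univ ((hf n).trans_lt ENNReal.ofReal_lt_top).ne
      ((hg n).trans_lt ENNReal.ofReal_lt_top).ne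
    have h2 := (abs_le.1 h1).2
    have h3 : 0 ≤ |K| ^ (1 / q) := by positivity
    rw [dist_zero_right, Real.norm_eq_abs, lqNormPow_eq_lqSeminorm, lqNormPow_eq_lqSeminorm,
      add_comm (g n)]
    refine lt_of_le_of_lt (h _ _ (lqSeminorm_nonneg _ _ _) (lqSeminorm_nonneg _ _ _) (by linarith)
      (by linarith) (h1.trans hn)) (by linarith)
  have := hmain.sub hgt
  rw [sub_zero] at this
  refine this.congr fun n => by ring

theorem tendsto_lqSeminorm_compl_ball {q : ℝ} (hq : 0 < q) {f : L2 m} (hf : lqLint q f ≠ ⊤) :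
    Tendsto (fun n : ℕ => lqSeminorm q (Metric.ball (0 : Sp m) n)ᶜ f) atTop (𝓝 0) := by
  have h1 : Tendsto (fun n : ℕ => ∫⁻ x in Metric.ball (0 : Sp m) n, ‖f x‖ₑ ^ q) atTop
      (𝓝 (lqLint q f)) :=
    (aecover_ball tendsto_natCast_atTop_atTop).lintegral_tendsto_of_countably_generated
      ((Lp.aestronglyMeasurable f).enorm.pow_const q)
  have h2 : Tendsto (fun n : ℕ => lqSeminorm q (Metric.ball (0 : Sp m) n) f ^ q) atTop
      (𝓝 (lqNormPow q f)) := by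
    simp only [lqSeminorm_rpow hq, lqNormPow_eq hq]
    exact (ENNReal.tendsto_toReal hf).comp h1
  have h3 : Tendsto (fun n : ℕ => lqSeminorm q (Metric.ball (0 : Sp m) n)ᶜ f ^ q) atTop
      (𝓝 0) := by
    have := (tendsto_const_nhds (x := lqNormPow q f)).sub h2
    rw [sub_self] at this
    refine this.congr fun n => ?_
    rw [lqNormPow_eq_add hq measurableSet_ball hf, add_sub_cancel_left]
  have h4 := h3.rpow_const (p := 1 / q) (Or.inr (by positivity))
  rw [Real.zero_rpow (by positivity)] at h4
  refine h4.congr fun n => ?_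
  rw [← Real.rpow_mul (lqSeminorm_nonneg _ _ _), mul_one_div_cancel hq.ne', Real.rpow_one]

theorem lqSeminorm_le_of_lqLint_le {q : ℝ} (hq : 0 < q) (A : Set (Sp m)) {u : L2 m} {K : ℝ}
    (hK : 0 ≤ K) (hu : lqLint q u ≤ ENNReal.ofReal K) : lqSeminorm q A u ≤ K ^ (1 / q) := by
  refine (lqSeminorm_mono hq A (hu.trans_lt ENNReal.ofReal_lt_top).ne).trans ?_
  have h1 : lqSeminorm q Set.univ u ^ q ≤ K := by
    rw [← lqNormPow_eq_lqSeminorm, lqNormPow_eq hq]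
    exact ENNReal.toReal_le_of_le_ofReal hK hu
  calc _ = (lqSeminorm q Set.univ u ^ q) ^ (1 / q) := by
        rw [← Real.rpow_mul (lqSeminorm_nonneg _ _ _), mul_one_div_cancel hq.ne', Real.rpow_one]
    _ ≤ _ := Real.rpow_le_rpow (Real.rpow_nonneg (lqSeminorm_nonneg _ _ _) _) h1 (by positivity)

/-- The Brezis–Lieb property for weakly null sequences bounded in `H¹`. -/
theorem WeakTendsto.tendsto_lqNormPow {ι : Type*} {l : Filter ι} {a : ι → L2 m} {N q : ℝ}
    (hq : IsSubcritical m q) (hN : 0 < N) (ha : ∀ n, H1Bound N (a n)) (h : WeakTendsto a l 0)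
    {ψ : L2 m} (hψ : dirichlet ψ < ⊤) :
    Tendsto (fun n => lqNormPow q (ψ + a n) - (lqNormPow q ψ + lqNormPow q (a n))) l (𝓝 0) := by
  have hq1 : 1 ≤ q := by linarith [hq.1]
  have hq0 : 0 < q := by linarith
  obtain ⟨C, hC, hCf⟩ := exists_lqLint_le hq
  obtain ⟨N', hN', hψN⟩ := exists_h1Bound hψ
  set K : ℝ := max (C * N ^ q) (C * N' ^ q) with hKdef
  have hK : 0 ≤ K := le_max_of_le_left (by positivity)
  have hψK : lqLint q ψ ≤ ENNReal.ofReal K :=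
    (hCf ψ N' hN' hψN).trans (ENNReal.ofReal_le_ofReal (le_max_right _ _))
  have haK : ∀ n, lqLint q (a n) ≤ ENNReal.ofReal K := fun n =>
    (hCf (a n) N hN (ha n)).trans (ENNReal.ofReal_le_ofReal (le_max_left _ _))
  have hψfin := (hψK.trans_lt ENNReal.ofReal_lt_top).ne
  have hafin := fun n => ((haK n).trans_lt ENNReal.ofReal_lt_top).ne
  have hsfin : ∀ n, lqLint q (ψ + a n) ≠ ⊤ := fun n =>
    (lqLint_lt_top hq (dirichlet_add hψ (ha n).1)).ne
  set L : ℝ := K ^ (1 / q) with hL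
  have hL0 : 0 ≤ L := by positivity
  rw [Metric.tendsto_nhds]
  intro ε hε
  obtain ⟨δ, hδ, hδε⟩ := exists_abs_rpow_sub_rpow_le (q := q) (K := 2 * L) (ε := ε / 5) hq1
    (by positivity)
  have hsmall : ∀ s : ℝ, 0 ≤ s → s ≤ L → s ≤ δ → s ^ q ≤ ε / 5 := fun s hs hsL hsδ => by
    have := hδε s 0 hs le_rfl (by linarith) (by linarith) (by rwa [sub_zero, abs_of_nonneg hs])
    rwa [Real.zero_rpow hq0.ne', sub_zero, abs_of_nonneg (by positivity)] at this
  have hpert : ∀ (A : Set (Sp m)) (f g : L2 m), lqLint q f ≤ ENNReal.ofReal K →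
      lqLint q g ≤ ENNReal.ofReal K → lqSeminorm q A g ≤ δ →
      |lqSeminorm q A (f + g) ^ q - lqSeminorm q A f ^ q| ≤ ε / 5 := fun A f g hf hg hgδ => by
    have h1 := abs_lqSeminorm_add_sub_le hq1 A (hf.trans_lt ENNReal.ofReal_lt_top).ne
      (hg.trans_lt ENNReal.ofReal_lt_top).ne
    have h2 := lqSeminorm_le_of_lqLint_le hq0 A hK hf
    have h3 := lqSeminorm_le_of_lqLint_le hq0 A hK hg
    have h4 := (abs_le.1 h1).2
    exact hδε _ _ (lqSeminorm_nonneg _ _ _) (lqSeminorm_nonneg _ _ _) (by linarith) (by linarith)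
      (h1.trans hgδ)
  -- Outside a large ball `ψ` is negligible, and inside it `a n` is negligible by local compactness.
  -- Four errors of `ε / 5` result: one perturbation and one neglected norm on each of the two sets.
  obtain ⟨ρ, hρ⟩ := ((tendsto_lqSeminorm_compl_ball hq0 hψfin).eventually_le_const hδ).exists
  set A := Metric.ball (0 : Sp m) ρ
  have hloc : Tendsto (fun n => lqSeminorm q A (a n)) l (𝓝 0) := by
    have h1 : Tendsto (fun n => lqSeminorm q A (a n) ^ q) l (𝓝 0) := by
      simp only [lqSeminorm_rpow hq0]
      exact (ENNReal.tendsto_toReal ENNReal.zero_ne_top).comp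
        (tendsto_setLIntegral_ball hq hN ha h ρ)
    have h4 := h1.rpow_const (p := 1 / q) (Or.inr (by positivity))
    rw [Real.zero_rpow (by positivity)] at h4
    refine h4.congr fun n => ?_
    rw [← Real.rpow_mul (lqSeminorm_nonneg _ _ _), mul_one_div_cancel hq0.ne', Real.rpow_one]
  filter_upwards [hloc.eventually_le_const hδ] with n hn
  rw [dist_zero_right, Real.norm_eq_abs, lqNormPow_eq_add hq0 measurableSet_ball (hsfin n),
    lqNormPow_eq_add hq0 (A := A) measurableSet_ball hψfin,
    lqNormPow_eq_add hq0 (A := A) measurableSet_ball (hafin n)]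
  have h1 := abs_le.1 (hpert A ψ (a n) hψK (haK n) hn)
  have h2 := abs_le.1 (hpert Aᶜ (a n) ψ (haK n) hψK hρ)
  rw [add_comm (a n)] at h2
  have h3 := hsmall _ (lqSeminorm_nonneg _ A (a n)) (lqSeminorm_le_of_lqLint_le hq0 A hK (haK n)) hn
  have h4 := hsmall _ (lqSeminorm_nonneg _ Aᶜ ψ) (lqSeminorm_le_of_lqLint_le hq0 Aᶜ hK hψK) hρ
  have h5 : 0 ≤ lqSeminorm q A (a n) ^ q := Real.rpow_nonneg (lqSeminorm_nonneg _ _ _) _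
  have h6 : 0 ≤ lqSeminorm q Aᶜ ψ ^ q := Real.rpow_nonneg (lqSeminorm_nonneg _ _ _) _
  rw [abs_lt]
  constructor <;> linarith [h1.1, h1.2, h2.1, h2.2]

/-! ### Extraction of one profile -/

/-- Correlations with all translates of the low-frequency kernel decay uniformly by dispersion, and
the `H¹` bound converts this into decay in `L^q`. -/
theorem tendsto_lqLint_pushE {ι : Type*} {l : Filter ι} {V : LInf m} (hV : DispersiveEstimate V)
    {q : ℝ} (hq : IsSubcritical m q) {t : ι → ℝ} (ht : Tendsto (fun n => |t n|) l atTop)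
    (x : ι → Sp m) {ψ : L2 m} (hψ : dirichlet ψ < ⊤) :
    Tendsto (fun n => lqLint q (pushE V (t n) (x n) ψ)) l (𝓝 0) := by
  obtain ⟨N, hN, hψN⟩ := exists_h1Bound hψ
  rw [ENNReal.tendsto_nhds_zero]
  intro ε hε
  obtain ⟨ε', hε', hε2⟩ : ∃ ε' : ℝ, 0 < ε' ∧ ENNReal.ofReal ε' ≤ ε := by
    rcases eq_or_ne ε ⊤ with rfl | h
    · exact ⟨1, one_pos, le_top⟩
    · exact ⟨ε.toReal, ENNReal.toReal_pos hε.ne' h, ENNReal.ofReal_toReal_le⟩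
  obtain ⟨R, δ, hδ, h⟩ := exists_setLIntegral_rpow_le hq
    (N := (1 + 2 * ‖V‖) * N) (by positivity) hε'
  filter_upwards [eventually_inner_flowE_lt hV ht (lowKer m R) ψ hδ] with n hn
  refine le_trans ?_ hε2
  have := h (pushE V (t n) (x n) ψ) Set.univ MeasurableSet.univ
    ((hψN.transE (x n)).flowE V (t n)) fun y _ => (hn (x n) y).le
  rwa [setLIntegral_univ] at this

section Step

variable {ι : Type*} {l : Filter ι} {V W : LInf m} {t : ι → ℝ} {x : ι → Sp m} {ψ : L2 m}
  {R : ι → L2 m} {N : ℝ}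

theorem tendsto_norm_sq_step (hR : WeakTendsto (fun n => pullE V (t n) (x n) (R n)) l 0) :
    Tendsto (fun n => ‖pushE V (t n) (x n) ψ + R n‖ ^ 2 - (‖ψ‖ ^ 2 + ‖R n‖ ^ 2)) l (𝓝 0) := by
  refine (hR.tendsto_norm_sq ψ).congr fun n => ?_
  have e : pullE V (t n) (x n) (pushE V (t n) (x n) ψ + R n) = ψ + pullE V (t n) (x n) (R n) := by
    rw [map_add, pullE_pushE]
  rw [← e, LinearIsometryEquiv.norm_map, LinearIsometryEquiv.norm_map]

theorem energyNormSq_pullE (V : LInf m) (t : ℝ) (x : Sp m) {f : L2 m} (hf : dirichlet f < ⊤) :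
    energyNormSq (shiftPot x V) (pullE V t x f) = energyNormSq V f := by
  have h1 : dirichlet (pullE V t x f) < ⊤ := by
    rw [pullE_apply, dirichlet_transE]; exact dirichlet_flowE V _ hf
  rw [← energyNormSq_transE V x h1, pullE_apply, transE_apply_neg, energyNormSq_flowE V _ hf]

theorem dirichlet_pushE (V : LInf m) (t : ℝ) (x : Sp m) {f : L2 m} (hf : dirichlet f < ⊤) :
    dirichlet (pushE V t x f) < ⊤ :=
  dirichlet_flowE V t ((dirichlet_transE x f).trans_lt hf)

theorem tendsto_energyNormSq_step (hψ : dirichlet ψ < ⊤) (hN : 0 ≤ N) (hRN : ∀ n, H1Bound N (R n))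
    (hR : WeakTendsto (fun n => pullE V (t n) (x n) (R n)) l 0) (hW : PotTendsto V x l W) :
    Tendsto (fun n => energyNormSq V (pushE V (t n) (x n) ψ + R n) -
      (energyNormSq V (transE (x n) ψ) + energyNormSq V (R n))) l (𝓝 0) := by
  refine (hR.tendsto_energyNormSq (N := (1 + 2 * ‖V‖) * N) (by positivity)
    (fun n => (hRN n).pullE V (t n) (x n)) hψ hW).congr fun n => ?_
  have e : pullE V (t n) (x n) (pushE V (t n) (x n) ψ + R n) = ψ + pullE V (t n) (x n) (R n) := by
    rw [map_add, pullE_pushE]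
  rw [← e, energyNormSq_pullE _ _ _ (dirichlet_add (dirichlet_pushE V _ _ hψ) (hRN n).1),
    energyNormSq_pullE _ _ _ (hRN n).1, energyNormSq_transE V _ hψ]

theorem lqNormPow_transE {q : ℝ} (hq : 0 < q) (z : Sp m) (f : L2 m) :
    lqNormPow q (transE z f) = lqNormPow q f := by
  rw [lqNormPow_eq hq, lqNormPow_eq hq, lqLint_transE]

/-- The flow does not preserve `L^q`, hence the normalization of the times. If they vanish, the
frame is a translation and the Brezis–Lieb property applies in it; if they diverge, the profile
itself tends to zero in `L^q`. -/
theorem tendsto_lqNormPow_step (hV : DispersiveEstimate V) (hψ : dirichlet ψ < ⊤) (hN : 0 < N)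
    (hRN : ∀ n, H1Bound N (R n)) (hR : WeakTendsto (fun n => pullE V (t n) (x n) (R n)) l 0)
    (ht : (∀ n, t n = 0) ∨ Tendsto (fun n => |t n|) l atTop) {q : ℝ} (hq : IsSubcritical m q) :
    Tendsto (fun n => lqNormPow q (pushE V (t n) (x n) ψ + R n) -
      (lqNormPow q (pushE V (t n) (x n) ψ) + lqNormPow q (R n))) l (𝓝 0) := by
  have hq0 : 0 < q := by linarith [hq.1]
  rcases ht with ht | ht
  · refine (hR.tendsto_lqNormPow hq (N := (1 + 2 * ‖V‖) * N) (by positivity)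
      (fun n => (hRN n).pullE V (t n) (x n)) hψ).congr fun n => ?_
    have e1 : ∀ f, pullE V (t n) (x n) f = transE (-(x n)) f := fun f => by
      rw [pullE_apply, ht, neg_zero, flowE_zero]
    have e : pullE V (t n) (x n) (pushE V (t n) (x n) ψ + R n) =
        ψ + pullE V (t n) (x n) (R n) := by rw [map_add, pullE_pushE]
    have e2 : lqNormPow q ψ = lqNormPow q (pushE V (t n) (x n) ψ) := by
      rw [pushE_apply, ht, flowE_zero, lqNormPow_transE hq0]
    rw [← e, e1, lqNormPow_transE hq0, e1, lqNormPow_transE hq0, ← e2]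
  · obtain ⟨C, hC, hCf⟩ := exists_lqLint_le hq
    obtain ⟨N', hN', hψN⟩ := exists_h1Bound hψ
    refine tendsto_lqNormPow_add_of_tendsto_zero (by linarith [hq.1])
      (K := max (C * N ^ q) (C * ((1 + 2 * ‖V‖) * N') ^ q)) (fun n => ?_) (fun n => ?_)
      (tendsto_lqLint_pushE hV hq ht x hψ)
    · exact (hCf _ N hN (hRN n)).trans (ENNReal.ofReal_le_ofReal (le_max_left _ _))
    · exact (hCf _ _ (by positivity) ((hψN.transE (x n)).flowE V (t n))).trans
        (ENNReal.ofReal_le_ofReal (le_max_right _ _))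

theorem tendsto_energy_step (hV : DispersiveEstimate V) (hψ : dirichlet ψ < ⊤) (hN : 0 < N)
    (hRN : ∀ n, H1Bound N (R n)) (hR : WeakTendsto (fun n => pullE V (t n) (x n) (R n)) l 0)
    (hW : PotTendsto V x l W) (ht : (∀ n, t n = 0) ∨ Tendsto (fun n => |t n|) l atTop) {α : ℝ}
    (hα : IsSubcritical m (α + 2)) :
    Tendsto (fun n => energy V α (pushE V (t n) (x n) ψ + R n) -
      (energy V α (pushE V (t n) (x n) ψ) + energy V α (R n))) l (𝓝 0) := by
  have h1 := tendsto_energyNormSq_step hψ hN.le hRN hR hW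
  have h2 := tendsto_lqNormPow_step hV hψ hN hRN hR ht hα
  have h3 := (h1.add (h2.const_mul (2 / (α + 2)))).const_mul (1 / 2)
  rw [mul_zero, add_zero, mul_zero] at h3
  refine h3.congr fun n => ?_
  have e : energyNormSq V (pushE V (t n) (x n) ψ) = energyNormSq V (transE (x n) ψ) :=
    energyNormSq_flowE V _ ((dirichlet_transE _ _).trans_lt hψ)
  simp only [energy, e]
  ring

end Step

/-! ### Normalization of parameters -/

/-- The admissible sequences of times. -/
def IsTimeParam (t : ℕ → ℝ) (l : Filter ℕ) : Prop :=
  (∀ n, t n = 0) ∨ Tendsto t l atTop ∨ Tendsto t l atBot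

/-- The admissible sequences of positions. -/
def IsSpaceParam (P : Fin m → EuclideanSpace ℝ (Fin m)) (x : ℕ → Sp m) (l : Filter ℕ) : Prop :=
  (∀ n, x n = 0) ∨ Tendsto (fun n => x n 0) l atTop ∨ Tendsto (fun n => x n 0) l atBot ∨
    ∃ k : ℕ → Fin m → ℤ, (∀ n, x n = splitPoint 0 (∑ i, k n i • P i)) ∧
      Tendsto (fun n => ∑ i, |k n i|) l atTop

theorem IsTimeParam.eq_zero_or_tendsto {t : ℕ → ℝ} {l : Filter ℕ} (h : IsTimeParam t l) :
    (∀ n, t n = 0) ∨ Tendsto (fun n => |t n|) l atTop := by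
  rcases h with h | h | h
  · exact Or.inl h
  · exact Or.inr (tendsto_abs_atTop_atTop.comp h)
  · exact Or.inr (tendsto_abs_atBot_atTop.comp h)

/-- The normal forms of the positions are chosen for this: at the origin and at lattice points the
shifted potential is `V` itself, and at infinity it approaches the constants `1` or `0`. -/
theorem IsSpaceParam.exists_potTendsto {P : Fin m → EuclideanSpace ℝ (Fin m)} {V : LInf m}
    (hper : IsPeriodicPotential P V) (hstep : IsSteplike V) {x : ℕ → Sp m} {l : Filter ℕ}
    (h : IsSpaceParam P x l) : ∃ W, PotTendsto V x l W := by
  rcases h with h | h | h | ⟨k, hk, -⟩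
  · exact ⟨V, potTendsto_of_eq fun n => by rw [h, shiftPot_zero]⟩
  · exact ⟨_, hstep.potTendsto_atTop h⟩
  · exact ⟨_, hstep.potTendsto_atBot h⟩
  · exact ⟨V, potTendsto_of_eq fun n => by rw [hk, hper.shiftPot_eq]⟩

theorem norm_splitPoint_le (a : ℝ) (y : EuclideanSpace ℝ (Fin m)) :
    ‖splitPoint a y‖ ≤ |a| + ‖y‖ := by
  have h : ‖splitPoint a y‖ ^ 2 = |a| ^ 2 + ‖y‖ ^ 2 := by
    rw [EuclideanSpace.norm_sq_eq, EuclideanSpace.norm_sq_eq, Fin.sum_univ_succ]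
    simp [splitPoint]
  refine abs_le_of_sq_le_sq' ?_ (by positivity) |>.2
  nlinarith [abs_nonneg a, norm_nonneg y]

theorem exists_isTimeParam (𝒰 : Ultrafilter ℕ) (t : ℕ → ℝ) :
    ∃ s τ, IsTimeParam s 𝒰 ∧ Tendsto (fun n => s n - t n) 𝒰 (𝓝 τ) := by
  rcases 𝒰.tendsto_atTop_or_le t with h1 | ⟨C₁, h1⟩
  · exact ⟨t, 0, Or.inr (Or.inl h1), by simp⟩
  rcases 𝒰.tendsto_atTop_or_le fun n => -t n with h2 | ⟨C₂, h2⟩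
  · exact ⟨t, 0, Or.inr (Or.inr (tendsto_neg_atTop_iff.1 h2)), by simp⟩
  have : ∀ᶠ n in (𝒰 : Filter ℕ), ‖(0 : ℝ) - t n‖ ≤ max C₁ C₂ := by
    filter_upwards [h1, h2] with n a b
    rw [zero_sub, norm_neg, Real.norm_eq_abs, abs_le]
    exact ⟨by linarith [le_max_right C₁ C₂], a.trans (le_max_left _ _)⟩
  obtain ⟨τ, hτ⟩ := 𝒰.exists_tendsto_of_norm_le this
  exact ⟨fun _ => 0, τ, Or.inl fun _ => rfl, hτ⟩

/-- Every point is at bounded distance from the lattice generated by `P`. -/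
theorem exists_int_norm_sub_le {P : Fin m → EuclideanSpace ℝ (Fin m)} (hP : LinearIndependent ℝ P)
    (y : EuclideanSpace ℝ (Fin m)) : ∃ k : Fin m → ℤ, ‖y - ∑ i, k i • P i‖ ≤ ∑ i, ‖P i‖ := by
  have hspan := hP.span_eq_top_of_card_eq_finrank' (by simp)
  set b := Module.Basis.mk hP hspan.ge with hb
  have hbP : ∀ i, b i = P i := fun i => by rw [hb, Module.Basis.mk_apply]
  refine ⟨fun i => ⌊b.repr y i⌋, ?_⟩
  have e : y - ∑ i, ⌊b.repr y i⌋ • P i = ∑ i, Int.fract (b.repr y i) • P i := by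
    nth_rewrite 1 [← b.sum_repr y]
    simp only [hbP]
    rw [← Finset.sum_sub_distrib]
    refine Finset.sum_congr rfl fun i _ => ?_
    rw [← Int.cast_smul_eq_zsmul ℝ, ← sub_smul]; rfl
  rw [e]
  refine (norm_sum_le _ _).trans (Finset.sum_le_sum fun i _ => ?_)
  rw [norm_smul, Real.norm_of_nonneg (Int.fract_nonneg _)]
  exact mul_le_of_le_one_left (norm_nonneg _) (Int.fract_lt_one _).le

theorem eq_splitPoint (x : Sp m) : x = splitPoint (x 0) (WithLp.toLp 2 fun i => x i.succ) := by
  ext i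
  refine Fin.cases ?_ (fun j => ?_) i <;> simp [splitPoint]

theorem splitPoint_sub (a b : ℝ) (y z : EuclideanSpace ℝ (Fin m)) :
    splitPoint a y - splitPoint b z = splitPoint (a - b) (y - z) := by
  ext i
  refine Fin.cases ?_ (fun j => ?_) i <;> simp [splitPoint]

/-- If the first coordinate stays bounded it can be set to `0`, and the others rounded to the
lattice; if the lattice coefficients are bounded too, the origin serves. The displacement is bounded
in each case, hence converges along the ultrafilter. -/
theorem exists_isSpaceParam (𝒰 : Ultrafilter ℕ) {P : Fin m → EuclideanSpace ℝ (Fin m)}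
    (hP : LinearIndependent ℝ P) (x : ℕ → Sp m) :
    ∃ y z, IsSpaceParam P y 𝒰 ∧ Tendsto (fun n => y n - x n) 𝒰 (𝓝 z) := by
  rcases 𝒰.tendsto_atTop_or_le fun n => x n 0 with h1 | ⟨C₁, h1⟩
  · exact ⟨x, 0, Or.inr (Or.inl h1), by simp⟩
  rcases 𝒰.tendsto_atTop_or_le fun n => -x n 0 with h2 | ⟨C₂, h2⟩
  · exact ⟨x, 0, Or.inr (Or.inr (Or.inl (tendsto_neg_atTop_iff.1 h2))), by simp⟩
  have hx0 : ∀ᶠ n in (𝒰 : Filter ℕ), |x n 0| ≤ max C₁ C₂ := by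
    filter_upwards [h1, h2] with n a b
    rw [abs_le]
    exact ⟨by linarith [le_max_right C₁ C₂], a.trans (le_max_left _ _)⟩
  choose k hk using fun n => exists_int_norm_sub_le hP (WithLp.toLp 2 fun i => x n i.succ)
  have hdist : ∀ᶠ n in (𝒰 : Filter ℕ),
      ‖splitPoint 0 (∑ i, k n i • P i) - x n‖ ≤ max C₁ C₂ + ∑ i, ‖P i‖ := by
    filter_upwards [hx0] with n hn
    rw [norm_sub_rev]
    nth_rewrite 1 [eq_splitPoint (x n)]
    rw [splitPoint_sub, sub_zero]
    exact (norm_splitPoint_le _ _).trans (add_le_add hn (hk n))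
  rcases 𝒰.tendsto_atTop_or_le fun n => ((∑ i, |k n i| : ℤ) : ℝ) with h3 | ⟨C₃, h3⟩
  · obtain ⟨z, hz⟩ := 𝒰.exists_tendsto_of_norm_le hdist
    exact ⟨_, z, Or.inr (Or.inr (Or.inr ⟨k, fun n => rfl, tendsto_intCast_atTop_iff.1 h3⟩)), hz⟩
  · have hbd : ∀ᶠ n in (𝒰 : Filter ℕ), ‖(0 : Sp m) - x n‖ ≤
        C₃ * ∑ i, ‖P i‖ + (max C₁ C₂ + ∑ i, ‖P i‖) := by
      filter_upwards [hdist, h3] with n a b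
      have e : (0 : Sp m) - x n = -splitPoint 0 (∑ i, k n i • P i) +
        (splitPoint 0 (∑ i, k n i • P i) - x n) := by abel
      rw [e]
      refine (norm_add_le _ _).trans (add_le_add ?_ a)
      rw [norm_neg]
      refine (norm_splitPoint_le _ _).trans ?_
      rw [abs_zero, zero_add, Finset.mul_sum]
      refine (norm_sum_le _ _).trans (Finset.sum_le_sum fun i _ => ?_)
      rw [← Int.cast_smul_eq_zsmul ℝ, norm_smul]
      gcongr
      refine le_trans ?_ b
      rw [Real.norm_eq_abs, ← Int.cast_abs]
      exact_mod_cast Finset.single_le_sum (f := fun i => |k n i|) (fun _ _ => abs_nonneg _)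
        (Finset.mem_univ i)
    obtain ⟨z, hz⟩ := 𝒰.exists_tendsto_of_norm_le hbd
    exact ⟨fun _ => 0, z, Or.inl fun _ => rfl, hz⟩

/-! ### Choice of a profile -/

/-- A profile of nearly maximal size in a bounded sequence, in a frame that separates from given
frames in which the sequence has no profile. -/
theorem exists_profile {𝒰 : Ultrafilter ℕ} (h𝒰 : (𝒰 : Filter ℕ) ≤ atTop) {V : LInf m}
    {P : Fin m → EuclideanSpace ℝ (Fin m)} (hP : LinearIndependent ℝ P)
    (hper : IsPeriodicPotential P V) (hstep : IsSteplike V) {u : ℕ → L2 m} {C : ℝ}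
    (hu : ∀ n, ‖u n‖ ≤ C) (hist : List ((ℕ → ℝ) × (ℕ → Sp m)))
    (hhist : ∀ p ∈ hist, WeakTendsto (fun n => pullE V (p.1 n) (p.2 n) (u n)) 𝒰 0) :
    ∃ (t : ℕ → ℝ) (x : ℕ → Sp m) (ψ : L2 m), IsTimeParam t 𝒰 ∧ IsSpaceParam P x 𝒰 ∧
      WeakTendsto (fun n => pullE V (t n) (x n) (u n)) 𝒰 ψ ∧
      (∀ p ∈ hist, Tendsto (fun n => ‖p.2 n - x n‖ + |p.1 n - t n|) 𝒰 atTop) ∧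
      ∀ (s : ℕ → ℝ) (y : ℕ → Sp m) (φ : L2 m),
        WeakTendsto (fun n => pullE V (s n) (y n) (u n)) 𝒰 φ → ‖φ‖ ≤ 2 * ‖ψ‖ := by
  have hpull : ∀ (s : ℕ → ℝ) (y : ℕ → Sp m) n, ‖pullE V (s n) (y n) (u n)‖ ≤ C := fun s y n => by
    rw [LinearIsometryEquiv.norm_map]; exact hu n
  -- The norms of all weak limits over all frames. Convergence along an ultrafilter gives every
  -- frame a limit, so no further subsequences enter the supremum.
  set S : Set ℝ := {a | ∃ (s : ℕ → ℝ) (y : ℕ → Sp m) (φ : L2 m),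
    WeakTendsto (fun n => pullE V (s n) (y n) (u n)) 𝒰 φ ∧ ‖φ‖ = a} with hS
  have hSb : BddAbove S := ⟨C, by
    rintro _ ⟨s, y, φ, h, rfl⟩
    exact h.norm_le (Eventually.of_forall (hpull s y))⟩
  by_cases hpos : ∃ a ∈ S, 0 < a
  · obtain ⟨a, haS, ha⟩ := hpos
    have hsup : 0 < sSup S := ha.trans_le (le_csSup hSb haS)
    obtain ⟨_, ⟨s, y, φ, h, rfl⟩, hφ⟩ := exists_lt_of_lt_csSup ⟨a, haS⟩ (half_lt_self hsup)
    obtain ⟨t, τ, ht, hτ⟩ := exists_isTimeParam 𝒰 s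
    obtain ⟨x, z, hx, hz⟩ := exists_isSpaceParam 𝒰 hP y
    obtain ⟨W, hW⟩ := hx.exists_potTendsto hper hstep
    have hψ := h.change_frame hW hτ hz hu
    set ψ := flowE W (-τ) (transE (-z) φ) with hψdef
    have hnorm : ‖ψ‖ = ‖φ‖ := by
      rw [hψdef, LinearIsometryEquiv.norm_map, LinearIsometryEquiv.norm_map]
    refine ⟨t, x, ψ, ht, hx, hψ, fun p hp => ?_, fun s' y' φ' h' => ?_⟩
    · rcases 𝒰.tendsto_atTop_or_le fun n => ‖p.2 n - x n‖ + |p.1 n - t n| with h1 | ⟨K, hK⟩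
      · exact h1
      -- At bounded distance from an earlier frame the limit would be the transported zero limit,
      -- although `‖ψ‖ = ‖φ‖` exceeds `sSup S / 2 > 0`.
      · exfalso
        have b1 : ∀ᶠ n in (𝒰 : Filter ℕ), ‖t n - p.1 n‖ ≤ K := by
          filter_upwards [hK] with n hn
          rw [Real.norm_eq_abs, abs_sub_comm]
          linarith [norm_nonneg (p.2 n - x n)]
        have b2 : ∀ᶠ n in (𝒰 : Filter ℕ), ‖x n - p.2 n‖ ≤ K := by
          filter_upwards [hK] with n hn
          rw [norm_sub_rev]
          linarith [abs_nonneg (p.1 n - t n)]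
        obtain ⟨τ', hτ'⟩ := 𝒰.exists_tendsto_of_norm_le b1
        obtain ⟨z', hz'⟩ := 𝒰.exists_tendsto_of_norm_le b2
        have h2 := (hhist p hp).change_frame hW hτ' hz' hu
        rw [map_zero, map_zero] at h2
        rw [hψ.unique h2, norm_zero] at hnorm
        linarith
    · have h1 : ‖φ'‖ ≤ sSup S := le_csSup hSb ⟨s', y', φ', h', rfl⟩
      linarith
  · push Not at hpos
    -- No nonzero profile is left, but the parameters must still separate. The first coordinate
    -- exceeds the sum of all earlier positions by `n`, so this frame moves away from each of them.
    set x : ℕ → Sp m := fun n =>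
      splitPoint ((n : ℝ) + (hist.map fun p => ‖p.2 n‖).sum) 0 with hx
    have hx0 : ∀ n, x n 0 = (n : ℝ) + (hist.map fun p => ‖p.2 n‖).sum := fun n => by
      simp [hx, splitPoint]
    have hsum : ∀ n, ∀ p ∈ hist, ‖p.2 n‖ ≤ (hist.map fun p => ‖p.2 n‖).sum := fun n p hp =>
      List.single_le_sum (by
        intro a ha
        obtain ⟨p, -, rfl⟩ := List.mem_map.1 ha
        exact norm_nonneg _) _ (List.mem_map.2 ⟨p, hp, rfl⟩)
    have hsum0 : ∀ n, 0 ≤ (hist.map fun p => ‖p.2 n‖).sum := fun n =>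
      List.sum_nonneg (by
        intro a ha
        obtain ⟨p, -, rfl⟩ := List.mem_map.1 ha
        exact norm_nonneg _)
    have hn : Tendsto (fun n : ℕ => (n : ℝ)) 𝒰 atTop := tendsto_natCast_atTop_atTop.mono_left h𝒰
    obtain ⟨ψ, hψ⟩ := exists_weakTendsto 𝒰 (hpull (fun _ => 0) x)
    refine ⟨fun _ => 0, x, ψ, Or.inl fun _ => rfl, Or.inr (Or.inl ?_), hψ, fun p hp => ?_,
      fun s' y' φ' h' => ?_⟩
    · exact tendsto_atTop_mono (fun n => by rw [hx0]; linarith [hsum0 n]) hn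
    · refine tendsto_atTop_mono (fun n => ?_) hn
      have h1 : x n 0 ≤ ‖x n‖ := (le_abs_self _).trans (abs_apply_zero_le (x n))
      have h2 := norm_sub_norm_le (x n) (p.2 n)
      rw [norm_sub_rev] at h2
      rw [hx0] at h1
      linarith [hsum n p hp, abs_nonneg (p.1 n - 0)]
    · have h1 := hpos _ ⟨s', y', φ', h', rfl⟩
      linarith [norm_nonneg ψ]

/-! ### Iterated extraction -/

theorem h1Bound_of_le {N M : ℝ} {f : L2 m} (hf : dirichlet f < ⊤) (h : ‖f‖ ^ 2 + gradNormSq f ≤ M)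
    (hN : M ≤ N ^ 2) : H1Bound N f := ⟨hf, h.trans hN⟩

theorem gradNormSq_le_energyNormSq {V : LInf m} (hV : ∀ᵐ x, 0 ≤ V x) (f : L2 m) :
    gradNormSq f ≤ energyNormSq V f := by
  rw [energyNormSq]
  have : 0 ≤ ∫ x, V x * ‖f x‖ ^ 2 := integral_nonneg_of_ae (by
    filter_upwards [hV] with x hx
    exact mul_nonneg hx (by positivity))
  linarith

theorem H1Bound.sub {N M : ℝ} (hN : 0 ≤ N) (hM : 0 ≤ M) {f g : L2 m} (hf : H1Bound N f)
    (hg : H1Bound M g) : H1Bound (2 * (N + M)) (f - g) := by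
  have hf' : dirichlet (-g) < ⊤ := by rw [dirichlet_neg]; exact hg.1
  have h0 : gradNormSq (-g) = gradNormSq g := by
    rw [gradNormSq_eq hf', gradNormSq_eq hg.1, dirichlet_neg]
  have hgrad : gradNormSq (f + -g) ≤ 2 * (gradNormSq f + gradNormSq (-g)) := by
    simp only [gradNormSq, weakPartial_add hf.1 hf']
    rw [← Finset.sum_add_distrib, Finset.mul_sum]
    refine Finset.sum_le_sum fun i _ => ?_
    have := parallelogram_law_with_norm ℂ (weakPartial i f) (weakPartial i (-g))
    nlinarith [sq_nonneg ‖weakPartial i f - weakPartial i (-g)‖]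
  have hnorm := parallelogram_law_with_norm ℂ f g
  have h1 := hf.2
  have h2 := hg.2
  rw [sub_eq_add_neg] at *
  refine ⟨dirichlet_add hf.1 hf', ?_⟩
  rw [h0] at hgrad
  nlinarith [sq_nonneg ‖f + g‖, mul_nonneg hN hM]

/-- The data carried along the extraction: the remainders and the parameters already used. -/
structure ExtractionState (V : LInf m) (𝒰 : Ultrafilter ℕ) where
  /-- the current remainders -/
  rem : ℕ → L2 m
  /-- the parameters of the profiles found so far -/
  hist : List ((ℕ → ℝ) × (ℕ → Sp m))
  bound : ∃ N, 0 < N ∧ ∀ n, H1Bound N (rem n)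
  null : ∀ p ∈ hist, WeakTendsto (fun n => pullE V (p.1 n) (p.2 n) (rem n)) 𝒰 0

/-- A profile found in `u`, in a frame adapted to it. -/
structure IsProfile (V : LInf m) (P : Fin m → EuclideanSpace ℝ (Fin m)) (𝒰 : Ultrafilter ℕ)
    (u : ℕ → L2 m) (t : ℕ → ℝ) (x : ℕ → Sp m) (ψ : L2 m) : Prop where
  time : IsTimeParam t 𝒰
  space : IsSpaceParam P x 𝒰
  weak : WeakTendsto (fun n => pullE V (t n) (x n) (u n)) 𝒰 ψ
  finite : dirichlet ψ < ⊤
  maximal : ∀ (s : ℕ → ℝ) (y : ℕ → Sp m) (φ : L2 m),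
    WeakTendsto (fun n => pullE V (s n) (y n) (u n)) 𝒰 φ → ‖φ‖ ≤ 2 * ‖ψ‖

/-- Subtracting the profile makes the pull-back in the new frame weakly null. The old frames stay
null because they separate from the new one and do not see the subtracted profile. -/
theorem ExtractionState.exists_next {V : LInf m} {P : Fin m → EuclideanSpace ℝ (Fin m)}
    {𝒰 : Ultrafilter ℕ} (h𝒰 : (𝒰 : Filter ℕ) ≤ atTop) (hP : LinearIndependent ℝ P)
    (hper : IsPeriodicPotential P V) (hstep : IsSteplike V) (hdisp : DispersiveEstimate V)
    (s : ExtractionState V 𝒰) :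
    ∃ (s' : ExtractionState V 𝒰) (t : ℕ → ℝ) (x : ℕ → Sp m) (ψ : L2 m),
      IsProfile V P 𝒰 s.rem t x ψ ∧
      (∀ p ∈ s.hist, Tendsto (fun n => ‖p.2 n - x n‖ + |p.1 n - t n|) 𝒰 atTop) ∧
      (∀ n, s.rem n = pushE V (t n) (x n) ψ + s'.rem n) ∧ s'.hist = (t, x) :: s.hist := by
  obtain ⟨N, hN, hb⟩ := s.bound
  obtain ⟨t, x, ψ, ht, hx, hψ, hdiv, hmax⟩ := exists_profile h𝒰 hP hper hstep
    (fun n => (hb n).norm_le hN.le) s.hist s.null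
  obtain ⟨W, hW⟩ := hx.exists_potTendsto hper hstep
  -- The profile is only a weak `L²` limit; it lies in `H¹` by lower semicontinuity and the uniform
  -- `H¹` bound on the pull-backs.
  have hfin : dirichlet ψ < ⊤ := (dirichlet_of_weakTendsto hψ (M := ((1 + 2 * ‖V‖) * N) ^ 2)
    (Eventually.of_forall fun n => by
      have := (hb n).pullE V (t n) (x n)
      exact ⟨this.1, by linarith [this.2, sq_nonneg ‖pullE V (t n) (x n) (s.rem n)‖]⟩)).1
  obtain ⟨N', hN', hψN⟩ := exists_h1Bound hfin
  refine ⟨⟨fun n => s.rem n - pushE V (t n) (x n) ψ, (t, x) :: s.hist, ?_, ?_⟩, t, x, ψ,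
    ⟨ht, hx, hψ, hfin, hmax⟩, hdiv, fun n => (add_sub_cancel _ _).symm, rfl⟩
  · exact ⟨2 * (N + (1 + 2 * ‖V‖) * N'), by positivity, fun n =>
      (hb n).sub hN.le (by positivity) ((hψN.transE (x n)).flowE V (t n))⟩
  · intro p hp
    rcases List.mem_cons.1 hp with rfl | hp
    · have := hψ.sub (weakTendsto_const (ψ := ψ))
      rw [sub_self] at this
      refine this.congr fun n => ?_
      rw [map_sub, pullE_pushE]
    · have := (s.null p hp).sub (weakTendsto_pullE_pushE hdisp hW (hdiv p hp) ψ)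
      rw [sub_self] at this
      refine this.congr fun n => ?_
      rw [map_sub]

/-- The profile decomposition along an ultrafilter. -/
theorem exists_profiles {V : LInf m} {P : Fin m → EuclideanSpace ℝ (Fin m)}
    {𝒰 : Ultrafilter ℕ} (h𝒰 : (𝒰 : Filter ℕ) ≤ atTop) (hP : LinearIndependent ℝ P)
    (hper : IsPeriodicPotential P V) (hstep : IsSteplike V) (hdisp : DispersiveEstimate V)
    {v : ℕ → L2 m} (hv : ∃ N, 0 < N ∧ ∀ n, H1Bound N (v n)) :
    ∃ (t : ℕ → ℕ → ℝ) (x : ℕ → ℕ → Sp m) (ψ : ℕ → L2 m) (R : ℕ → ℕ → L2 m),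
      R 0 = v ∧ (∀ J n, R J n = pushE V (t J n) (x J n) (ψ J) + R (J + 1) n) ∧
      (∀ J, ∃ N, 0 < N ∧ ∀ n, H1Bound N (R J n)) ∧
      (∀ J, IsProfile V P 𝒰 (R J) (t J) (x J) (ψ J)) ∧
      (∀ J, WeakTendsto (fun n => pullE V (t J n) (x J n) (R (J + 1) n)) 𝒰 0) ∧
      ∀ j k, j < k → Tendsto (fun n => ‖x j n - x k n‖ + |t j n - t k n|) 𝒰 atTop := by
  choose next t x ψ hprof hdiv hrem hhist using
    ExtractionState.exists_next (V := V) (P := P) h𝒰 hP hper hstep hdisp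
  obtain ⟨s, hs0, hsucc⟩ : ∃ s : ℕ → ExtractionState V 𝒰, (s 0).rem = v ∧
      ∀ J, s (J + 1) = next (s J) :=
    ⟨fun J => Nat.rec ⟨v, [], hv, fun p hp => absurd hp List.not_mem_nil⟩ (fun _ s => next s) J,
      rfl, fun J => rfl⟩
  have hmem : ∀ j k, j < k → (t (s j), x (s j)) ∈ (s k).hist := by
    intro j k hjk
    induction k, hjk using Nat.le_induction with
    | base => rw [hsucc, hhist]; exact List.mem_cons_self
    | succ k _ ih => rw [hsucc, hhist]; exact List.mem_cons_of_mem _ ih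
  have hrec : ∀ J n, (s J).rem n =
      pushE V (t (s J) n) (x (s J) n) (ψ (s J)) + (s (J + 1)).rem n := fun J n => by
    rw [hsucc]; exact hrem (s J) n
  have hnull : ∀ J, WeakTendsto (fun n => pullE V (t (s J) n) (x (s J) n) ((s (J + 1)).rem n)) 𝒰 0 :=
    fun J => (s (J + 1)).null (t (s J), x (s J)) (hmem J (J + 1) (Nat.lt_succ_self J))
  have horth : ∀ j k, j < k →
      Tendsto (fun n => ‖x (s j) n - x (s k) n‖ + |t (s j) n - t (s k) n|) 𝒰 atTop :=
    fun j k h => hdiv (s k) (t (s j), x (s j)) (hmem j k h)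
  exact ⟨_, _, _, _, hs0, hrec, fun J => (s J).bound, fun J => hprof (s J), hnull, horth⟩

/-! ### Smallness of the remainders -/

section Remainders

variable {V : LInf m} {P : Fin m → EuclideanSpace ℝ (Fin m)} {𝒰 : Ultrafilter ℕ}
  {t : ℕ → ℕ → ℝ} {x : ℕ → ℕ → Sp m} {ψ : ℕ → L2 m} {R : ℕ → ℕ → L2 m}

/-- The `L²` and energy expansions are added. The energies of the translated profiles are
nonnegative because `V ≥ 0` and may be dropped, so one constant `B` serves every `J`. -/
theorem eventually_sum_norm_sq_add_le (hV : ∀ᵐ x, 0 ≤ V x)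
    (hper : IsPeriodicPotential P V) (hstep : IsSteplike V)
    (hrec : ∀ J n, R J n = pushE V (t J n) (x J n) (ψ J) + R (J + 1) n)
    (hbd : ∀ J, ∃ N, 0 < N ∧ ∀ n, H1Bound N (R J n))
    (hprof : ∀ J, IsProfile V P 𝒰 (R J) (t J) (x J) (ψ J))
    (hnull : ∀ J, WeakTendsto (fun n => pullE V (t J n) (x J n) (R (J + 1) n)) 𝒰 0) {B : ℝ}
    (hB : ∀ n, ‖R 0 n‖ ^ 2 + energyNormSq V (R 0 n) ≤ B) (J : ℕ) :
    ∀ ε > 0, ∀ᶠ n in (𝒰 : Filter ℕ), ∑ j ∈ Finset.range J, ‖ψ j‖ ^ 2 +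
      (‖R J n‖ ^ 2 + energyNormSq V (R J n)) ≤ B + ε := by
  induction J with
  | zero =>
    intro ε hε
    exact Eventually.of_forall fun n => by
      rw [Finset.sum_range_zero, zero_add]; linarith [hB n]
  | succ J ih =>
    intro ε hε
    obtain ⟨W, hW⟩ := (hprof J).space.exists_potTendsto hper hstep
    obtain ⟨N, hN, hRN⟩ := hbd (J + 1)
    have h1 := tendsto_norm_sq_step (ψ := ψ J) (hnull J)
    have h2 := tendsto_energyNormSq_step (hprof J).finite hN.le hRN (hnull J) hW
    have h3 := h1.add h2
    rw [add_zero] at h3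
    filter_upwards [ih (ε / 2) (by positivity),
      h3.eventually_const_le (show -(ε / 2) < 0 by linarith)] with n a b
    rw [← hrec] at b
    have h4 := (gradNormSq_nonneg _).trans (gradNormSq_le_energyNormSq hV (transE (x J n) (ψ J)))
    rw [Finset.sum_range_succ]
    linarith

theorem tendsto_norm_profile (hV : ∀ᵐ x, 0 ≤ V x) {B : ℝ}
    (h : ∀ J, ∀ ε > 0, ∀ᶠ n in (𝒰 : Filter ℕ), ∑ j ∈ Finset.range J, ‖ψ j‖ ^ 2 +
      (‖R J n‖ ^ 2 + energyNormSq V (R J n)) ≤ B + ε) :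
    Tendsto (fun J => ‖ψ J‖) atTop (𝓝 0) := by
  have h1 : ∀ J, ∑ j ∈ Finset.range J, ‖ψ j‖ ^ 2 ≤ B + 1 := fun J => by
    obtain ⟨n, hn⟩ := (h J 1 one_pos).exists
    have := (gradNormSq_nonneg _).trans (gradNormSq_le_energyNormSq hV (R J n))
    linarith [sq_nonneg ‖R J n‖]
  have h2 : Summable fun J => ‖ψ J‖ ^ 2 :=
    summable_of_sum_range_le (fun J => by positivity) h1
  have h3 := h2.tendsto_atTop_zero.sqrt
  rw [Real.sqrt_zero] at h3
  exact h3.congr fun J => Real.sqrt_sq (norm_nonneg _)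

/-- If all weak limits are small, then so are all localized averages. -/
theorem eventually_inner_flowE_le_of_maximal {u : ℕ → L2 m} {C η δ : ℝ} (hu : ∀ n, ‖u n‖ ≤ C)
    (hmax : ∀ (s : ℕ → ℝ) (y : ℕ → Sp m) (φ : L2 m),
      WeakTendsto (fun n => pullE V (s n) (y n) (u n)) 𝒰 φ → ‖φ‖ ≤ η) (κ : L2 m)
    (hδ : ‖κ‖ * η < δ) :
    ∀ᶠ n in (𝒰 : Filter ℕ), ∀ (s : ℝ) (y : Sp m),
      ‖(inner ℂ (transE y κ) (flowE V s (u n)) : ℂ)‖ ≤ δ := by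
  by_contra hcon
  rw [← Ultrafilter.eventually_not] at hcon
  -- At the bad indices `p n` is a time and position violating the bound; elsewhere it is
  -- irrelevant. The bad indices belong to `𝒰`, so the weak limit in these frames would be too
  -- large.
  have hex : ∀ n, ∃ p : ℝ × Sp m, (¬ ∀ (s : ℝ) (y : Sp m),
      ‖(inner ℂ (transE y κ) (flowE V s (u n)) : ℂ)‖ ≤ δ) →
      δ < ‖(inner ℂ (transE p.2 κ) (flowE V p.1 (u n)) : ℂ)‖ := fun n => by
    by_cases h : ∀ (s : ℝ) (y : Sp m), ‖(inner ℂ (transE y κ) (flowE V s (u n)) : ℂ)‖ ≤ δ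
    · exact ⟨0, fun h' => absurd h h'⟩
    · push Not at h
      obtain ⟨s, y, hsy⟩ := h
      exact ⟨(s, y), fun _ => hsy⟩
  choose p hp using hex
  obtain ⟨φ, hφ⟩ := exists_weakTendsto 𝒰 (u := fun n => pullE V (-(p n).1) (p n).2 (u n)) (C := C)
    fun n => by rw [LinearIsometryEquiv.norm_map]; exact hu n
  have h1 := hmax (fun n => -(p n).1) (fun n => (p n).2) φ hφ
  have h2 : δ ≤ ‖(inner ℂ κ φ : ℂ)‖ := by
    refine ge_of_tendsto (hφ κ).norm ?_
    filter_upwards [hcon] with n hn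
    have := hp n hn
    rw [pullE_apply, neg_neg, ← (transE (p n).2).inner_map_map, transE_apply_neg]
    exact this.le
  have h3 := norm_inner_le_norm (𝕜 := ℂ) κ φ
  have : ‖κ‖ * ‖φ‖ ≤ ‖κ‖ * η := by gcongr
  linarith

/-- Near-maximality bounds every weak limit of the `J`-th remainder by `2 ‖ψ J‖`, which tends to
`0`. Small correlations with the low-frequency kernel give a small `L^r` norm at all times, and the
estimate for the mixed norm carries a positive power of that bound. -/
theorem exists_eventually_mixedNorm_le (hV : ∀ᵐ x, 0 ≤ V x) (hdisp : DispersiveEstimate V)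
    (hbd : ∀ J, ∃ N, 0 < N ∧ ∀ n, H1Bound N (R J n))
    (hprof : ∀ J, IsProfile V P 𝒰 (R J) (t J) (x J) (ψ J)) {B : ℝ}
    (h : ∀ J, ∀ ε > 0, ∀ᶠ n in (𝒰 : Filter ℕ), ∑ j ∈ Finset.range J, ‖ψ j‖ ^ 2 +
      (‖R J n‖ ^ 2 + energyNormSq V (R J n)) ≤ B + ε) {p r : ℝ} (hr : IsSubcritical m r)
    (hθ : decayExp m r < 1) (hp : 2 / decayExp m r < p) {ε : ℝ} (hε : 0 < ε) :
    ∃ J, ∀ᶠ n in (𝒰 : Filter ℕ),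
      mixedNorm p r (fun s => flow V s (R J n)) ≤ ENNReal.ofReal ε := by
  set q₀ := 2 / decayExp m r with hq₀
  have hq₀0 : 0 < q₀ := by have := decayExp_pos (m := m) hr.1; positivity
  have hp0 : 0 < p := hq₀0.trans hp
  have hpq : 0 < p - q₀ := by linarith
  obtain ⟨C, hC, hmix⟩ := hdisp.exists_mixedNorm_le hr.1 hθ hp
  -- An `H¹` bound valid for all `J`, each for most `n`. It must be fixed before `J`, since the
  -- scale `ρ` and threshold `δ` depend on it while `J` depends on them.
  set N : ℝ := |B| + 1 with hN
  have hN0 : 0 < N := by positivity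
  have hNB : B + 1 ≤ N ^ 2 := by nlinarith [abs_nonneg B, le_abs_self B]
  have hbound : ∀ J, ∀ᶠ n in (𝒰 : Filter ℕ), H1Bound N (R J n) := fun J => by
    filter_upwards [h J 1 one_pos] with n hn
    obtain ⟨N', hN', hRN⟩ := hbd J
    refine h1Bound_of_le (hRN n).1 ?_ hNB
    have h1 : 0 ≤ ∑ j ∈ Finset.range J, ‖ψ j‖ ^ 2 := Finset.sum_nonneg fun _ _ => by positivity
    linarith [gradNormSq_le_energyNormSq hV (R J n)]
  obtain ⟨S, hS, hSε⟩ : ∃ S : ℝ, 0 < S ∧ C * N ^ q₀ * S ^ (p - q₀) ≤ ε ^ p := by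
    refine ⟨(ε ^ p / (C * N ^ q₀)) ^ (1 / (p - q₀)), by positivity, ?_⟩
    rw [← Real.rpow_mul (by positivity), one_div_mul_cancel hpq.ne', Real.rpow_one]
    exact (mul_div_cancel₀ _ (by positivity)).le
  obtain ⟨ρ, δ, hδ, hvan⟩ := exists_setLIntegral_rpow_le hr (N := (1 + 2 * ‖V‖) * N)
    (ε := S ^ r) (by positivity) (by positivity)
  have hψ0 := (tendsto_norm_profile hV h).const_mul (‖lowKer m ρ‖ * 2)
  rw [mul_zero] at hψ0
  obtain ⟨J, hJ⟩ := (hψ0.eventually_lt_const hδ).exists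
  refine ⟨J, ?_⟩
  obtain ⟨N', hN', hRN⟩ := hbd J
  filter_upwards [hbound J, eventually_inner_flowE_le_of_maximal (η := 2 * ‖ψ J‖)
    (fun n => (hRN n).norm_le hN'.le) (hprof J).maximal (lowKer m ρ)
    (by rwa [← mul_assoc])] with n h1 h2
  refine (hmix (R J n) S hS fun s => ?_).trans (ENNReal.ofReal_le_ofReal ?_)
  · have := hvan (flowE V s (R J n)) Set.univ MeasurableSet.univ (h1.flowE V s) fun y _ => h2 s y
    rwa [setLIntegral_univ] at this
  · have h3 : C * ‖R J n‖ ^ q₀ * S ^ (p - q₀) ≤ ε ^ p := by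
      refine le_trans ?_ hSε
      gcongr
      exact h1.norm_le hN0.le
    calc _ ≤ (ε ^ p) ^ (1 / p) := Real.rpow_le_rpow (by positivity) h3 (by positivity)
      _ = ε := by rw [← Real.rpow_mul hε.le, mul_one_div_cancel hp0.ne', Real.rpow_one]

end Remainders

/-! ### From an ultrafilter to a subsequence -/

section Transfer

variable {𝒰 : Ultrafilter ℕ}

/-- `p` holds for all subsequences converging along some countably generated filter coarser
than `𝒰`. -/
def Selects (𝒰 : Ultrafilter ℕ) (p : (ℕ → ℕ) → Prop) : Prop :=
  ∃ F : Filter ℕ, F.IsCountablyGenerated ∧ (𝒰 : Filter ℕ) ≤ F ∧ ∀ σ, Tendsto σ atTop F → p σ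

theorem Selects.mono {p q : (ℕ → ℕ) → Prop} (h : Selects 𝒰 p) (hpq : ∀ σ, p σ → q σ) :
    Selects 𝒰 q := by
  obtain ⟨F, hF, hU, hp⟩ := h
  exact ⟨F, hF, hU, fun σ hσ => hpq σ (hp σ hσ)⟩

theorem Selects.of_forall {p : (ℕ → ℕ) → Prop} (h : ∀ σ, p σ) : Selects 𝒰 p :=
  ⟨⊤, inferInstance, le_top, fun σ _ => h σ⟩

theorem Selects.of_tendsto {β : Type*} {f : ℕ → β} {l : Filter β} [l.IsCountablyGenerated]
    (h : Tendsto f 𝒰 l) : Selects 𝒰 fun σ => Tendsto (fun n => f (σ n)) atTop l :=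
  ⟨comap f l, inferInstance, tendsto_iff_comap.1 h, fun _ hσ => tendsto_comap.comp hσ⟩

theorem Selects.of_eventually {p : ℕ → Prop} (h : ∀ᶠ n in (𝒰 : Filter ℕ), p n) :
    Selects 𝒰 fun σ => ∀ᶠ n in atTop, p (σ n) :=
  ⟨𝓟 {n | p n}, inferInstance, le_principal_iff.2 h, fun _ hσ => tendsto_principal.1 hσ⟩

/-- A countable infimum of countably generated filters is countably generated. The ultrafilter
itself is not needed once each property is witnessed by such a coarser filter. -/
theorem Selects.forall {ι : Sort*} [Countable ι] {p : ι → (ℕ → ℕ) → Prop}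
    (h : ∀ i, Selects 𝒰 (p i)) : Selects 𝒰 fun σ => ∀ i, p i σ := by
  choose F hF hU hp using h
  exact ⟨⨅ i, F i, inferInstance, le_iInf hU,
    fun σ hσ i => hp i σ (hσ.mono_right (iInf_le F i))⟩

theorem Selects.and {p q : (ℕ → ℕ) → Prop} (hp : Selects 𝒰 p) (hq : Selects 𝒰 q) :
    Selects 𝒰 fun σ => p σ ∧ q σ := by
  obtain ⟨F, hF, hU, hp⟩ := hp
  obtain ⟨G, hG, hU', hq⟩ := hq
  exact ⟨F ⊓ G, inferInstance, le_inf hU hU',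
    fun σ hσ => ⟨hp σ (hσ.mono_right inf_le_left), hq σ (hσ.mono_right inf_le_right)⟩⟩

/-- The filter `F ⊓ atTop` is proper because it lies above `𝒰`, and it is countably generated, so
some sequence tends to it; thinning makes that sequence increasing. -/
theorem Selects.exists_strictMono (h𝒰 : (𝒰 : Filter ℕ) ≤ atTop) {p : (ℕ → ℕ) → Prop}
    (h : Selects 𝒰 p) : ∃ σ, StrictMono σ ∧ p σ := by
  obtain ⟨F, hF, hU, hp⟩ := h
  have hle : (𝒰 : Filter ℕ) ≤ F ⊓ atTop := le_inf hU h𝒰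
  have : (F ⊓ atTop).NeBot := neBot_of_le hle
  obtain ⟨s, hs⟩ := exists_seq_tendsto (F ⊓ atTop)
  obtain ⟨φ, hφ, hsφ⟩ := strictMono_subseq_of_tendsto_atTop (hs.mono_right inf_le_right)
  exact ⟨s ∘ φ, hsφ, hp _ ((hs.mono_right inf_le_left).comp hφ.tendsto_atTop)⟩

/-- Separability reduces weak convergence of a bounded sequence to countably many scalar limits. -/
theorem Selects.of_weakTendsto {H : Type*} [NormedAddCommGroup H] [InnerProductSpace ℂ H]
    [TopologicalSpace.SeparableSpace H] {u : ℕ → H} {ψ : H} {C : ℝ} (hu : ∀ n, ‖u n‖ ≤ C)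
    (h : WeakTendsto u 𝒰 ψ) : Selects 𝒰 fun σ => WeakTendsto (fun n => u (σ n)) atTop ψ := by
  refine (Selects.forall fun k : ℕ =>
    Selects.of_tendsto (h (TopologicalSpace.denseSeq H k))).mono fun σ hσ => ?_
  refine WeakTendsto.of_dense (fun n => hu (σ n)) (TopologicalSpace.denseRange_denseSeq H) ?_
  rintro _ ⟨k, rfl⟩
  exact hσ k

theorem IsTimeParam.selects {t : ℕ → ℝ} (h : IsTimeParam t 𝒰) :
    Selects 𝒰 fun σ => IsTimeParam (fun n => t (σ n)) atTop := by
  rcases h with h | h | h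
  · exact Selects.of_forall fun σ => Or.inl fun n => h _
  · exact (Selects.of_tendsto h).mono fun σ hσ => Or.inr (Or.inl hσ)
  · exact (Selects.of_tendsto h).mono fun σ hσ => Or.inr (Or.inr hσ)

theorem IsSpaceParam.selects {P : Fin m → EuclideanSpace ℝ (Fin m)} {x : ℕ → Sp m}
    (h : IsSpaceParam P x 𝒰) :
    Selects 𝒰 fun σ => IsSpaceParam P (fun n => x (σ n)) atTop := by
  rcases h with h | h | h | ⟨k, hk, h⟩
  · exact Selects.of_forall fun σ => Or.inl fun n => h _
  · exact (Selects.of_tendsto h).mono fun σ hσ => Or.inr (Or.inl hσ)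
  · exact (Selects.of_tendsto h).mono fun σ hσ => Or.inr (Or.inr (Or.inl hσ))
  · exact (Selects.of_tendsto h).mono fun σ hσ =>
      Or.inr (Or.inr (Or.inr ⟨fun n => k (σ n), fun n => hk _, hσ⟩))

end Transfer

instance separableSpace_L2 : TopologicalSpace.SeparableSpace (L2 m) := by
  have : Fact ((2 : ℝ≥0∞) ≠ ⊤) := ⟨ENNReal.ofNat_ne_top⟩
  infer_instance

/-! ### The profile decomposition of a subsequence -/

section Subsequence

variable {V : LInf m} {P : Fin m → EuclideanSpace ℝ (Fin m)}

theorem norm_sq_add_energyNormSq_le (V : LInf m) {f : L2 m} {M : ℝ}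
    (h : h1NormSq f ≤ M) : ‖f‖ ^ 2 + energyNormSq V f ≤ (1 + ‖V‖) * M := by
  have h1 := (abs_le.1 (abs_re_inner_potMul_le V f)).2
  have h2 := gradNormSq_nonneg f
  rw [h1NormSq] at h
  rw [energyNormSq_eq]
  nlinarith [norm_nonneg V, sq_nonneg ‖f‖]

/-- The expansions are not transferred, since they involve uncountably many exponents `q`. Weak
nullity in each frame is, and it implies them along the subsequence. -/
theorem exists_subsequence_profiles (hP : LinearIndependent ℝ P) (hV : ∀ᵐ x, 0 ≤ V x)
    (hper : IsPeriodicPotential P V) (hstep : IsSteplike V) (hdisp : DispersiveEstimate V)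
    {v : ℕ → L2 m} (hv : ∀ n, dirichlet (v n) < ⊤) {M : ℝ} (hM : ∀ n, h1NormSq (v n) ≤ M)
    {p r : ℝ} (hr : IsSubcritical m r) (hθ : decayExp m r < 1) (hp : 2 / decayExp m r < p) :
    ∃ (σ : ℕ → ℕ) (t : ℕ → ℕ → ℝ) (x : ℕ → ℕ → Sp m) (ψ : ℕ → L2 m) (R : ℕ → ℕ → L2 m),
      StrictMono σ ∧ (∀ j, dirichlet (ψ j) < ⊤) ∧ (∀ J, ∃ N, 0 < N ∧ ∀ n, H1Bound N (R J n)) ∧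
      (∀ n, R 0 n = v (σ n)) ∧
      (∀ J n, R J n = pushE V (t J n) (x J n) (ψ J) + R (J + 1) n) ∧
      (∀ j, IsTimeParam (t j) atTop) ∧ (∀ j, IsSpaceParam P (x j) atTop) ∧
      (∀ j k, j < k → Tendsto (fun n => ‖x j n - x k n‖ + |t j n - t k n|) atTop atTop) ∧
      (∀ ε : ℝ, 0 < ε → ∃ J, ∀ᶠ n in atTop,
        mixedNorm p r (fun s => flow V s (R J n)) ≤ ENNReal.ofReal ε) ∧
      ∀ J, WeakTendsto (fun n => pullE V (t J n) (x J n) (R (J + 1) n)) atTop 0 := by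
  set 𝒰 : Ultrafilter ℕ := hyperfilter ℕ
  have h𝒰 : (𝒰 : Filter ℕ) ≤ atTop := Nat.hyperfilter_le_atTop
  have hbd : ∃ N, 0 < N ∧ ∀ n, H1Bound N (v n) := ⟨|M| + 1, by positivity, fun n =>
    ⟨hv n, (hM n).trans (by nlinarith [le_abs_self M, abs_nonneg M])⟩⟩
  obtain ⟨t, x, ψ, R, hR0, hrec, hRN, hprof, hnull, horth⟩ :=
    exists_profiles h𝒰 hP hper hstep hdisp hbd
  have hB := eventually_sum_norm_sq_add_le hV hper hstep hrec hRN hprof hnull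
    (B := (1 + ‖V‖) * M) fun n => by
      rw [hR0]; exact norm_sq_add_energyNormSq_le V (hM n)
  -- Tolerances `1 / (k + 1)` suffice and keep the number of requirements countable.
  choose J hJ using fun k : ℕ => exists_eventually_mixedNorm_le hV hdisp hRN hprof hB hr hθ hp
    (ε := 1 / ((k : ℝ) + 1)) (by positivity)
  obtain ⟨σ, hσ, h1, h2, h3, h4, h5⟩ := Selects.exists_strictMono h𝒰 <|
    (Selects.forall fun j => (hprof j).time.selects).and <|
    (Selects.forall fun j => (hprof j).space.selects).and <|
    (Selects.forall fun j => Selects.forall fun k => Selects.forall fun h : j < k =>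
      Selects.of_tendsto (horth j k h)).and <|
    (Selects.forall fun k => Selects.of_eventually (hJ k)).and <|
    Selects.forall fun j => by
      obtain ⟨N, hN, hb⟩ := hRN (j + 1)
      exact Selects.of_weakTendsto (C := N) (fun n => by
        rw [LinearIsometryEquiv.norm_map]; exact (hb n).norm_le hN.le) (hnull j)
  refine ⟨σ, fun j n => t j (σ n), fun j n => x j (σ n), ψ, fun J n => R J (σ n), hσ,
    fun j => (hprof j).finite, fun J => ?_, fun n => congrFun hR0 (σ n), fun J n => hrec J (σ n),
    h1, h2, h3, fun ε hε => ?_, h5⟩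
  · obtain ⟨N, hN, hb⟩ := hRN J
    exact ⟨N, hN, fun n => hb (σ n)⟩
  · obtain ⟨k, hk⟩ := exists_nat_one_div_lt hε
    exact ⟨J k, (h4 k).mono fun n hn => hn.trans (ENNReal.ofReal_le_ofReal hk.le)⟩

/-- Iterating an asymptotic splitting of a functional. -/
theorem tendsto_sub_sum_of_step {a : ℕ → ℕ → ℝ} {b : ℕ → ℕ → ℝ}
    (h : ∀ J, Tendsto (fun n => a J n - (b J n + a (J + 1) n)) atTop (𝓝 0)) (J : ℕ) :
    Tendsto (fun n => a 0 n - (∑ j ∈ Finset.range J, b j n + a J n)) atTop (𝓝 0) := by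
  induction J with
  | zero => simp
  | succ J ih =>
    have := ih.add (h J)
    rw [add_zero] at this
    refine this.congr fun n => ?_
    rw [Finset.sum_range_succ]; ring

end Subsequence

/-! ### Exponents -/

/-- For `d ≤ 2` the factor `m - 1` is nonpositive, so one inequality without division covers all
dimensions. -/
theorem mul_lt_of_lt_div {a b : ℝ} (ha : 0 ≤ a) (hb : 0 < b)
    (h : 3 ≤ m + 1 → a < b / (((m + 1 : ℕ) : ℝ) - 2)) : ((m : ℝ) - 1) * a < b := by
  have e : ((m + 1 : ℕ) : ℝ) - 2 = (m : ℝ) - 1 := by push_cast; ring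
  rw [e] at h
  by_cases hm : 3 ≤ m + 1
  · have h2 : (2 : ℝ) ≤ m := by exact_mod_cast (by lia : 2 ≤ m)
    exact (lt_div_iff₀' (by linarith)).1 (h hm)
  · have h2 : (m : ℝ) ≤ 1 := by exact_mod_cast (by lia : m ≤ 1)
    nlinarith

theorem decayExp_lt_one {α : ℝ} (hα : 0 < α) (h : ((m : ℝ) - 1) * α < 4) :
    decayExp m (α + 2) < 1 := by
  rw [decayExp, div_lt_one (by linarith)]
  linarith

/-- After cross-multiplication the difference factors as `(dα - 4) · 2 (α + 2)²`: the condition `α >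
4/d` is precisely that `p` exceeds the Strichartz exponent belonging to `r`. -/
theorem two_div_decayExp_lt {α : ℝ} (hα : 4 < ((m : ℝ) + 1) * α) (h : ((m : ℝ) - 1) * α < 4) :
    2 / decayExp m (α + 2) < 2 * α * (α + 2) / (4 - ((m : ℝ) - 1) * α) := by
  have hα0 : 0 < α := pos_of_mul_pos_right (by linarith) (by positivity : (0 : ℝ) ≤ m + 1)
  rw [show 2 / decayExp m (α + 2) = 4 * (α + 2) / (((m : ℝ) + 1) * α) by
    rw [decayExp, add_sub_cancel_right]; field_simp; ring]
  rw [div_lt_div_iff₀ (by linarith) (by linarith)]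
  have : 0 < (((m : ℝ) + 1) * α - 4) * (α + 2) * (2 * (α + 2)) := by
    have := sub_pos.2 hα
    positivity
  nlinarith

end

/-! ### Assembly of the profile decomposition -/

theorem mainTheorem4 (m d : ℕ) (hd : d = m + 1)
    (α : ℝ) (hα : 4 / (d : ℝ) < α) (hα' : 3 ≤ d → α < 4 / ((d : ℝ) - 2))
    (p r : ℝ) (hr : r = α + 2) (hp : p = 2 * α * (α + 2) / (4 - ((d : ℝ) - 2) * α))
    (P : Fin m → EuclideanSpace ℝ (Fin m)) (hP : LinearIndependent ℝ P)
    (V : LInf m) (hV : ∀ᵐ x, 0 ≤ V x) (hper : IsPeriodicPotential P V) (hstep : IsSteplike V)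
    (hgrad : GradientVanishes V) (hdisp : DispersiveEstimate V)
    (v : ℕ → L2 m) (hv : ∀ n, MemH1 (v n)) (hbdd : ∃ M : ℝ, ∀ n, h1NormSq (v n) ≤ M) :
    ∃ (σ : ℕ → ℕ) (t : ℕ → ℕ → ℝ) (x : ℕ → ℕ → Sp m) (ψ : ℕ → L2 m) (R : ℕ → ℕ → L2 m),
      StrictMono σ ∧ (∀ j, MemH1 (ψ j)) ∧ (∀ J n, MemH1 (R J n)) ∧
      -- decomposition along the subsequence `σ`
      (∀ J n, v (σ n) = ∑ j ∈ Finset.range J, flow V (t j n) (translateL2 (x j n) (ψ j)) + R J n) ∧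
      -- time parameters
      (∀ j, (∀ n, t j n = 0) ∨ Tendsto (t j) atTop atTop ∨ Tendsto (t j) atTop atBot) ∧
      -- space parameters
      (∀ j, (∀ n, x j n = 0) ∨
        Tendsto (fun n => |x j n 0|) atTop atTop ∨
        ∃ k : ℕ → Fin m → ℤ, (∀ n, x j n = splitPoint 0 (∑ l, k n l • P l)) ∧
          Tendsto (fun n => ∑ l, |k n l|) atTop atTop) ∧
      -- orthogonality of the parameters
      (∀ j k, j ≠ k → Tendsto (fun n => ‖x j n - x k n‖ + |t j n - t k n|) atTop atTop) ∧
      -- smallness of the remainder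
      (∀ ε : ℝ, 0 < ε → ∃ J,
        limsup (fun n => mixedNorm p r (fun s => flow V s (R J n))) atTop ≤ ENNReal.ofReal ε) ∧
      -- Pythagorean expansions
      (∀ J, Tendsto (fun n => ‖v (σ n)‖ ^ 2 -
        (∑ j ∈ Finset.range J, ‖ψ j‖ ^ 2 + ‖R J n‖ ^ 2)) atTop (𝓝 0)) ∧
      (∀ J, Tendsto (fun n => energyNormSq V (v (σ n)) -
        (∑ j ∈ Finset.range J, energyNormSq V (translateL2 (x j n) (ψ j)) +
          energyNormSq V (R J n))) atTop (𝓝 0)) ∧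
      (∀ J, ∀ q : ℝ, 2 < q → (3 ≤ d → q < 2 * (d : ℝ) / ((d : ℝ) - 2)) →
        Tendsto (fun n => lqNormPow q (v (σ n)) -
          (∑ j ∈ Finset.range J, lqNormPow q (flow V (t j n) (translateL2 (x j n) (ψ j))) +
            lqNormPow q (R J n))) atTop (𝓝 0)) ∧
      (∀ J, Tendsto (fun n => energy V α (v (σ n)) -
        (∑ j ∈ Finset.range J, energy V α (flow V (t j n) (translateL2 (x j n) (ψ j))) +
          energy V α (R J n))) atTop (𝓝 0)) := by
  subst hd hr
  have hα4 : 4 < ((m : ℝ) + 1) * α := by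
    rwa [div_lt_iff₀' (by positivity), Nat.cast_add_one] at hα
  have hα0 : 0 < α := pos_of_mul_pos_right (by linarith) (by positivity : (0 : ℝ) ≤ m + 1)
  have hαm : ((m : ℝ) - 1) * α < 4 := mul_lt_of_lt_div hα0.le (by norm_num) hα'
  have hsub : IsSubcritical m (α + 2) := ⟨by linarith, by linarith⟩
  have hpm : 2 / decayExp m (α + 2) < p := by
    rw [hp, show ((m + 1 : ℕ) : ℝ) - 2 = (m : ℝ) - 1 by push_cast; ring]
    exact two_div_decayExp_lt hα4 hαm
  obtain ⟨M, hM⟩ := hbdd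
  obtain ⟨σ, t, x, ψ, R, hσ, hψ, hRN, hR0, hrec, ht, hx, horth, hsmall, hnull⟩ :=
    exists_subsequence_profiles hP hV hper hstep hdisp (fun n => (memH1_iff _).1 (hv n)) hM hsub
      (decayExp_lt_one hα0 hαm) hpm
  refine ⟨σ, t, x, ψ, R, hσ, fun j => (memH1_iff _).2 (hψ j), fun J n => ?_, fun J n => ?_, ht,
    fun j => ?_, fun j k hjk => ?_, fun ε hε => ?_, fun J => ?_, fun J => ?_,
    fun J q hq hq' => ?_, fun J => ?_⟩
  · obtain ⟨N, -, hN⟩ := hRN J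
    exact (memH1_iff _).2 (hN n).1
  · induction J with
    | zero => rw [Finset.sum_range_zero, zero_add, hR0]
    | succ J ih => rw [Finset.sum_range_succ, add_assoc, ih, hrec J n]; rfl
  · rcases hx j with h | h | h | h
    · exact Or.inl h
    · exact Or.inr (Or.inl (tendsto_abs_atTop_atTop.comp h))
    · exact Or.inr (Or.inl (tendsto_abs_atBot_atTop.comp h))
    · exact Or.inr (Or.inr h)
  · rcases hjk.lt_or_gt with h | h
    · exact horth j k h
    · exact (horth k j h).congr fun n => by rw [norm_sub_rev, abs_sub_comm]
  · obtain ⟨J, hJ⟩ := hsmall ε hε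
    exact ⟨J, limsup_le_of_le (by isBoundedDefault) hJ⟩
  · refine (tendsto_sub_sum_of_step (a := fun J n => ‖R J n‖ ^ 2) (b := fun j _ => ‖ψ j‖ ^ 2)
      (fun j => ?_) J).congr fun n => by rw [hR0]
    simp only [hrec j]
    exact tendsto_norm_sq_step (hnull j)
  · refine (tendsto_sub_sum_of_step (a := fun J n => energyNormSq V (R J n))
      (b := fun j n => energyNormSq V (translateL2 (x j n) (ψ j)))
      (fun j => ?_) J).congr fun n => by rw [hR0]
    simp only [hrec j]
    obtain ⟨N, hN, hb⟩ := hRN (j + 1)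
    obtain ⟨W, hW⟩ := (hx j).exists_potTendsto hper hstep
    exact tendsto_energyNormSq_step (hψ j) hN.le hb (hnull j) hW
  · have hqm : IsSubcritical m q := ⟨hq, mul_lt_of_lt_div (by linarith) (by positivity) fun h => by
      simpa only [Nat.cast_add_one] using hq' h⟩
    refine (tendsto_sub_sum_of_step (a := fun J n => lqNormPow q (R J n))
      (b := fun j n => lqNormPow q (flow V (t j n) (translateL2 (x j n) (ψ j))))
      (fun j => ?_) J).congr fun n => by rw [hR0]
    simp only [hrec j]
    obtain ⟨N, hN, hb⟩ := hRN (j + 1)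
    exact tendsto_lqNormPow_step hdisp (hψ j) hN hb (hnull j) (ht j).eq_zero_or_tendsto hqm
  · refine (tendsto_sub_sum_of_step (a := fun J n => energy V α (R J n))
      (b := fun j n => energy V α (flow V (t j n) (translateL2 (x j n) (ψ j))))
      (fun j => ?_) J).congr fun n => by rw [hR0]
    simp only [hrec j]
    obtain ⟨N, hN, hb⟩ := hRN (j + 1)
    obtain ⟨W, hW⟩ := (hx j).exists_potTendsto hper hstep
    exact tendsto_energy_step hdisp (hψ j) hN hb (hnull j) hW (ht j).eq_zero_or_tendsto hsub
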